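/- For integers $m\ge 2$, $n\ge 0$ and $k\in\mathbb Z$ let $T^{(k)}(m,n)$ be the link diagram given by the closure of the $m$-strand braid word $(\sigma_{m-1}\sigma_{m-2}\cdots\sigma_1)^n\sigma_1^k$ (the torus link $T(m,n)$ with $k$ half twists added on two strands), where all strands are oriented in parallel and the generators $\sigma_i$ are positive crossings. Let $H^{i,j}$ denote the (integral, unreduced, even) Khovanov cohomology in homological degree $i$ and quantum degree $j$. A finitely generated abelian group is said to have $\mathbb Z_{p^r}$-torsion ($p$ prime, $r\ge 1$) if $\mathbb Z_{p^r}$ is a summand in its primary decomposition. Let $s\ge 1$ be an integer and suppose that $H^{6s+1,\,16s+4}\bigl(T^{(-4s-2)}(4,4s+2)\bigr)$ has $\mathbb Z_{2^s}$-torsion. Then for every integer $k\le -4s-2$ the group $H^{6s+1,\,20s+6+k}\bigl(T^{(k)}(4,4s+2)\bigr)$ also has $\mathbb Z_{2^s}$-torsion. -/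

import Mathlib

open scoped DirectSum

noncomputable section

namespace Khovanov

/-- The two labels (markers) which a Kauffman state may assign to a crossing. -/
inductive Marker : Type
  | A : Marker
  | B : Marker
  deriving DecidableEq

instance instFintypeMarker : Fintype Marker where
  elems := {Marker.A, Marker.B}
  complete x := by cases x <;> simp

/-- The combinatorial code of an unoriented link diagram on which Kauffman states are computed.
The diagram is cut into finitely many arcs. The four arcs which end at a crossing `v` are
`ends v 0`, `ends v 1`, `ends v 2`, `ends v 3`, listed counterclockwise, where `ends v 0` and
`ends v 2` belong to the strand passing under and `ends v 1` and `ends v 3` to the strand passing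
over. Two arcs may also be joined end to end away from the crossings; this is recorded by
`joint`. The crossings are ordered. -/
structure Diagram where
  /-- the crossings -/
  Crossing : Type
  /-- the arcs -/
  Arc : Type
  [fintypeCrossing : Fintype Crossing]
  [orderCrossing : LinearOrder Crossing]
  [fintypeArc : Fintype Arc]
  /-- the arcs at a crossing, counterclockwise, beginning with one of the under-passing ends -/
  ends : Crossing → Fin 4 → Arc
  /-- pairs of arcs joined end to end away from the crossings -/
  joint : Arc → Arc → Prop

attribute [instance] Diagram.fintypeCrossing Diagram.orderCrossing Diagram.fintypeArc

namespace Diagram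

variable (D : Diagram)

/-- A Kauffman state: a label `A` or `B` at each crossing. -/
abbrev State : Type := D.Crossing → Marker

/-- Two arcs are joined in the smoothing `sD`. The `A`-smoothing merges the two regions which are
swept out when the over-passing strand is rotated counterclockwise, so it connects the ends `0, 1`
and the ends `2, 3`; the `B`-smoothing connects the ends `0, 3` and the ends `1, 2`. -/
inductive Joined (s : D.State) : D.Arc → D.Arc → Prop
  | joint {x y : D.Arc} (h : D.joint x y) : Joined s x y
  | a_zero_one (v : D.Crossing) (h : s v = Marker.A) : Joined s (D.ends v 0) (D.ends v 1)
  | a_two_three (v : D.Crossing) (h : s v = Marker.A) : Joined s (D.ends v 2) (D.ends v 3)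
  | b_zero_three (v : D.Crossing) (h : s v = Marker.B) : Joined s (D.ends v 0) (D.ends v 3)
  | b_one_two (v : D.Crossing) (h : s v = Marker.B) : Joined s (D.ends v 1) (D.ends v 2)

/-- The circles of `sD`: the classes of arcs for the equivalence relation generated by
`Joined`. -/
abbrev Circle (s : D.State) : Type := Quot (D.Joined s)

instance instFintypeCircle (s : D.State) : Fintype (D.Circle s) := Fintype.ofFinite _

/-- An enhanced Kauffman state: a state together with a sign for each circle of `sD`. -/
abbrev EnhancedState : Type := Σ s : D.State, (D.Circle s → ℤˣ)

variable {D}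

/-- The circle of `sD` through a given arc. -/
def circleThrough (s : D.EnhancedState) (x : D.Arc) : D.Circle s.1 := Quot.mk _ x

/-- The degree `a(s) = σ(s)`, the number of `A`-labels minus the number of `B`-labels. -/
def aDeg (s : D.EnhancedState) : ℤ :=
  ((Finset.univ.filter fun v => s.1 v = Marker.A).card : ℤ) -
    ((Finset.univ.filter fun v => s.1 v = Marker.B).card : ℤ)

/-- `τ(s)`, the sum of the signs of the circles. -/
def tau (s : D.EnhancedState) : ℤ := ∑ c : D.Circle s.1, (s.2 c : ℤ)

/-- The degree `b(s) = σ(s) + 2 τ(s)`. -/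
def bDeg (s : D.EnhancedState) : ℤ := aDeg s + 2 * tau s

/-- The enhanced state `s'` is adjacent to `s`, the changed crossing being `v`. The circles common
to `sD` and `s'D` are the circles of `sD` which do not meet the crossing `v`. -/
def IsAdjacentAt (s s' : D.EnhancedState) (v : D.Crossing) : Prop :=
  aDeg s' = aDeg s - 2 ∧ bDeg s' = bDeg s ∧
    s.1 v = Marker.A ∧ s'.1 v = Marker.B ∧ (∀ x, x ≠ v → s'.1 x = s.1 x) ∧
    ∀ x : D.Arc, (∀ j, circleThrough s x ≠ circleThrough s (D.ends v j)) →
      s'.2 (circleThrough s' x) = s.2 (circleThrough s x)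

open Classical in
/-- The incidence number `(s : s')`: it is `(-1) ^ t` if `s'` is adjacent to `s`, with `t` the
number of `B`-labelled crossings of `s` after the changed crossing, and `0` otherwise. At most one
crossing `v` contributes to the sum. -/
def incidence (s s' : D.EnhancedState) : ℤ :=
  ∑ v : D.Crossing, if IsAdjacentAt s s' v then
    (-1) ^ (Finset.univ.filter fun x => v < x ∧ s.1 x = Marker.B).card else 0

variable (D)

/-- The enhanced states of bidegree `(a, b)`. -/
abbrev Generator (a b : ℤ) : Type := {s : D.EnhancedState // aDeg s = a ∧ bDeg s = b}

instance instFintypeGenerator (a b : ℤ) : Fintype (D.Generator a b) := Fintype.ofFinite _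

/-- The chain group `C_{a,b}(D)`, free abelian on the enhanced states of bidegree `(a, b)`. -/
abbrev Chain (a b : ℤ) : Type := D.Generator a b →₀ ℤ

/-- The map `C_{a,b}(D) → C_{a',b}(D)`, `s ↦ ∑ (s : s') s'`. It is the differential
`∂_{a,b}` for `a' = a - 2`, and zero for all other `a'`. -/
def boundary (a a' b : ℤ) : D.Chain a b →ₗ[ℤ] D.Chain a' b :=
  Finsupp.linearCombination ℤ fun s : D.Generator a b =>
    ∑ s' : D.Generator a' b, Finsupp.single s' (incidence s.1 s'.1)

/-- The framed Khovanov homology `H_{a,b}(D) = ker ∂_{a,b} / im ∂_{a+2,b}`. -/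
abbrev FramedHomology (a b : ℤ) : Type :=
  LinearMap.ker (D.boundary a (a - 2) b) ⧸
    (LinearMap.range (D.boundary (a + 2) a b)).comap (LinearMap.ker (D.boundary a (a - 2) b)).subtype

/-- The Khovanov cohomology `H^{i,j} = H_{w-2i,3w-2j}(D)` of the diagram `D` with an orientation
of writhe `w`. -/
abbrev Cohomology (w i j : ℤ) : Type := D.FramedHomology (w - 2 * i) (3 * w - 2 * j)

end Diagram

/-- A braid word on `m` strands. The letter `(i, ε)` with `i = 0, …, m - 2` is the Artin generator
`σ_{i+1}` to the power `ε = ±1`. -/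
abbrev BraidWord (m : ℕ) : Type := List (Fin (m - 1) × ℤˣ)

namespace BraidWord

variable {m : ℕ}

/-- The position of the left strand at a crossing of type `σ_{i+1}^{±1}`. -/
def left (i : Fin (m - 1)) : Fin m := ⟨i, by omega⟩

/-- The position of the right strand at a crossing of type `σ_{i+1}^{±1}`. -/
def right (i : Fin (m - 1)) : Fin m := ⟨i + 1, by omega⟩

/-- The diagram of the closure of a braid word of length `L`. The braid is drawn upwards, and the
arc `(t, p)` passes through height `t` (for `0 ≤ t ≤ L`) at position `p`. The `t`-th letter is
drawn between the heights `t` and `t + 1`: for `σ_i` the strand from the bottom left to the top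
right passes over, and for `σ_i⁻¹` it passes under. The other strands go straight up, and the
top end of each position is joined to its bottom end. -/
def closure (β : BraidWord m) : Diagram where
  Crossing := Fin β.length
  Arc := Fin (β.length + 1) × Fin m
  ends t :=
    if (β.get t).2 = 1 then
      ![(t.castSucc, right (β.get t).1), (t.succ, right (β.get t).1),
        (t.succ, left (β.get t).1), (t.castSucc, left (β.get t).1)]
    else
      ![(t.castSucc, left (β.get t).1), (t.castSucc, right (β.get t).1),
        (t.succ, right (β.get t).1), (t.succ, left (β.get t).1)]
  joint x y :=
    (∃ (t : Fin β.length) (p : Fin m), p ≠ left (β.get t).1 ∧ p ≠ right (β.get t).1 ∧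
      x = (t.castSucc, p) ∧ y = (t.succ, p)) ∨
    (∃ p : Fin m, x = (Fin.last β.length, p) ∧ y = (0, p))

/-- The writhe of the closed braid, all strands being oriented upwards: a letter `σ_i` gives a
positive crossing and a letter `σ_i⁻¹` a negative one. -/
def writhe (β : BraidWord m) : ℤ := (β.map fun l => (l.2 : ℤ)).sum

/-- The Khovanov cohomology `H^{i,j}` of the closure of a braid word, with all strands oriented in
parallel. -/
abbrev Cohomology (β : BraidWord m) (i j : ℤ) : Type := β.closure.Cohomology β.writhe i j

end BraidWord

/-- The braid word `(σ_{m-1} σ_{m-2} ⋯ σ_1) ^ n σ_1 ^ k`, whose closure is the diagram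
`T^{(k)}(m, n)`: the torus link `T(m, n)` with `k` half twists added on two strands. -/
def twistedTorusWord (m : ℕ) (hm : 2 ≤ m) (n : ℕ) (k : ℤ) : BraidWord m :=
  (List.replicate n ((List.finRange (m - 1)).reverse.map fun i => (i, (1 : ℤˣ)))).flatten ++
    List.replicate k.natAbs (⟨0, by omega⟩, if 0 ≤ k then 1 else -1)

/-- The abelian group `G` has `ℤ_{p^r}`-torsion: it is finitely generated, and `ℤ_{p^r}` is a
summand in its primary decomposition. -/
def HasPrimaryTorsion (G : Type) [AddCommGroup G] (p r : ℕ) : Prop :=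
  ∃ (n : ℕ) (ι : Type) (_ : Fintype ι) (q e : ι → ℕ),
    (∀ i, (q i).Prime ∧ 0 < e i) ∧
    Nonempty (G ≃+ (Fin n →₀ ℤ) × ⨁ i, ZMod (q i ^ e i)) ∧
    ∃ i, q i = p ∧ e i = r

end Khovanov

end

noncomputable section
namespace Khovanov
namespace Diagram

variable (D : Diagram)

theorem mk_eq_of_joined {s s' : D.State}
    (h : ∀ x y, D.Joined s x y → (Quot.mk (D.Joined s') x) = Quot.mk (D.Joined s') y)
    {x y : D.Arc} (hxy : Quot.mk (D.Joined s) x = Quot.mk (D.Joined s) y) :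
    Quot.mk (D.Joined s') x = Quot.mk (D.Joined s') y :=
  congrArg (Quot.lift (Quot.mk (D.Joined s')) h) hxy

variable {D}

/-- Two arcs lie on the same circle of a state. -/
def Same (s : D.State) (x y : D.Arc) : Prop :=
  Quot.mk (D.Joined s) x = Quot.mk (D.Joined s) y

theorem Same.refl (s : D.State) (x : D.Arc) : Same s x x := rfl
theorem Same.symm {s : D.State} {x y : D.Arc} (h : Same s x y) : Same s y x := Eq.symm h
theorem Same.trans {s : D.State} {x y z : D.Arc} (h : Same s x y) (h' : Same s y z) :
    Same s x z := Eq.trans h h'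
theorem Same.of_joined {s : D.State} {x y : D.Arc} (h : D.Joined s x y) : Same s x y :=
  Quot.sound h

theorem Same.map {α : Type*} {s : D.State} (f : D.Arc → α)
    (h : ∀ x y, D.Joined s x y → f x = f y) {x y : D.Arc} (hxy : Same s x y) : f x = f y :=
  congrArg (Quot.lift f h) hxy

theorem marker_ne_A {m : Marker} : m ≠ Marker.A ↔ m = Marker.B := by cases m <;> simp
theorem marker_ne_B {m : Marker} : m ≠ Marker.B ↔ m = Marker.A := by cases m <;> simp

/-- Every end at `v` lies on the circle of the end `0` or of the end `2`. -/
theorem same_ends (s : D.State) (v : D.Crossing) (j : Fin 4) :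
    Same s (D.ends v j) (D.ends v 0) ∨ Same s (D.ends v j) (D.ends v 2) := by
  rcases hv : s v with _ | _
  · fin_cases j
    · exact Or.inl rfl
    · exact Or.inl (Same.of_joined (.a_zero_one v hv)).symm
    · exact Or.inr rfl
    · exact Or.inr (Same.of_joined (.a_two_three v hv)).symm
  · fin_cases j
    · exact Or.inl rfl
    · exact Or.inr (Same.of_joined (.b_one_two v hv))
    · exact Or.inr rfl
    · exact Or.inl (Same.of_joined (.b_zero_three v hv)).symm

/-- Away from `v` the joins of `s` and `s'` are the same. -/
theorem joined_of_eq_off {s s' : D.State} {v : D.Crossing} (h : ∀ w, w ≠ v → s' w = s w)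
    {x y : D.Arc} (hxy : D.Joined s x y) :
    D.Joined s' x y ∨ ∃ i j, x = D.ends v i ∧ y = D.ends v j := by
  cases hxy with
  | joint h' => exact Or.inl (.joint h')
  | a_zero_one w hw =>
    by_cases hwv : w = v
    · exact Or.inr ⟨_, _, by rw [hwv], by rw [hwv]⟩
    · exact Or.inl (.a_zero_one w (by rw [h w hwv, hw]))
  | a_two_three w hw =>
    by_cases hwv : w = v
    · exact Or.inr ⟨_, _, by rw [hwv], by rw [hwv]⟩
    · exact Or.inl (.a_two_three w (by rw [h w hwv, hw]))
  | b_zero_three w hw =>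
    by_cases hwv : w = v
    · exact Or.inr ⟨_, _, by rw [hwv], by rw [hwv]⟩
    · exact Or.inl (.b_zero_three w (by rw [h w hwv, hw]))
  | b_one_two w hw =>
    by_cases hwv : w = v
    · exact Or.inr ⟨_, _, by rw [hwv], by rw [hwv]⟩
    · exact Or.inl (.b_one_two w (by rw [h w hwv, hw]))

/-- Passing from `s` to `s'` changes the smoothing at `v` only, and merges two circles. -/
structure IsMerge (s s' : D.State) (v : D.Crossing) : Prop where
  off : ∀ w, w ≠ v → s' w = s w
  ne : ¬ Same s (D.ends v 0) (D.ends v 2)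
  eq : Same s' (D.ends v 0) (D.ends v 2)

namespace IsMerge

variable {s s' : D.State} {v : D.Crossing} (h : IsMerge s s' v)
include h

theorem same_ends' (j : Fin 4) : Same s' (D.ends v j) (D.ends v 0) :=
  (same_ends s' v j).elim id fun h' => h'.trans h.eq.symm

theorem same {x y : D.Arc} (hxy : Same s x y) : Same s' x y := by
  refine Same.map (Quot.mk (D.Joined s')) (fun x y hj => ?_) hxy
  rcases joined_of_eq_off h.off hj with hj | ⟨i, j, rfl, rfl⟩
  · exact Quot.sound hj
  · exact (h.same_ends' i).trans (h.same_ends' j).symm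

open Classical in
theorem same_iff {x y : D.Arc} : Same s' x y ↔ Same s x y ∨
    ((Same s x (D.ends v 0) ∨ Same s x (D.ends v 2)) ∧
      (Same s y (D.ends v 0) ∨ Same s y (D.ends v 2))) := by
  constructor
  · intro hxy
    have key := Same.map (s := s') (fun x => if Same s x (D.ends v 2) then
      Quot.mk (D.Joined s) (D.ends v 0) else Quot.mk (D.Joined s) x) (fun x y hj => by
        rcases joined_of_eq_off (s := s') (s' := s) (fun w hw => (h.off w hw).symm) hj with
          hj | ⟨i, j, rfl, rfl⟩
        · have hq : Same s x y := Same.of_joined hj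
          by_cases h2 : Same s y (D.ends v 2)
          · rw [if_pos h2, if_pos (hq.trans h2)]
          · rw [if_neg h2, if_neg fun h3 => h2 (hq.symm.trans h3)]
            exact hq
        · have aux : ∀ i, (if Same s (D.ends v i) (D.ends v 2) then
              Quot.mk (D.Joined s) (D.ends v 0) else Quot.mk (D.Joined s) (D.ends v i)) =
              Quot.mk (D.Joined s) (D.ends v 0) := by
            intro i
            split_ifs with h1
            · rfl
            · exact (same_ends s v i).resolve_right h1
          simp only [aux]) hxy
    split_ifs at key with h1 h2 h2
    · exact Or.inl (h1.trans h2.symm)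
    · exact Or.inr ⟨Or.inr h1, Or.inl key.symm⟩
    · exact Or.inr ⟨Or.inl key, Or.inr h2⟩
    · exact Or.inl key
  · have aux : ∀ z, (Same s z (D.ends v 0) ∨ Same s z (D.ends v 2)) → Same s' z (D.ends v 0) :=
      fun z hz => hz.elim h.same fun hz => (h.same hz).trans h.eq.symm
    rintro (hxy | ⟨hx, hy⟩)
    · exact h.same hxy
    · exact (aux x hx).trans (aux y hy).symm

theorem same_end_iff {x : D.Arc} : Same s' x (D.ends v 0) ↔
    (Same s x (D.ends v 0) ∨ Same s x (D.ends v 2)) := by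
  rw [h.same_iff]
  have : Same s (D.ends v 0) (D.ends v 0) := rfl
  tauto

/-- A circle of `s` off the crossing is a circle of `s'`. -/
theorem meets_iff {x : D.Arc} : (∀ j, ¬ Same s x (D.ends v j)) ↔ ¬ Same s' x (D.ends v 0) := by
  rw [h.same_end_iff]
  constructor
  · intro h'
    have := h' 0; have := h' 2; tauto
  · rintro h' j hj
    rcases same_ends s v j with h1 | h1
    · exact h' (Or.inl (hj.trans h1))
    · exact h' (Or.inr (hj.trans h1))

theorem meets_iff' {x : D.Arc} : (∀ j, ¬ Same s' x (D.ends v j)) ↔ ¬ Same s' x (D.ends v 0) :=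
  ⟨fun h' => h' 0, fun h' j hj => h' (hj.trans (h.same_ends' j))⟩

open Classical in
@[to_additive]
theorem prod_circles {M : Type*} [CommMonoid M] (F : D.Circle s → M) (F' : D.Circle s' → M)
    (hF : ∀ x, ¬ Same s' x (D.ends v 0) → F' (Quot.mk _ x) = F (Quot.mk _ x)) :
    ∏ c, F c = F (Quot.mk _ (D.ends v 0)) * F (Quot.mk _ (D.ends v 2)) *
      ∏ c ∈ Finset.univ.erase (Quot.mk _ (D.ends v 0)), F' c := by
  rw [← Finset.mul_prod_erase Finset.univ F (Finset.mem_univ (Quot.mk _ (D.ends v 0))),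
    ← Finset.mul_prod_erase (Finset.univ.erase _) F
      (a := Quot.mk _ (D.ends v 2)) (by
        simp only [Finset.mem_erase, Finset.mem_univ, and_true]
        exact fun h' => h.ne (Eq.symm h')), ← mul_assoc]
  congr 1
  refine Finset.prod_bij (fun c _ => Quot.lift (Quot.mk (D.Joined s'))
    (fun x y hj => h.same (Same.of_joined hj)) c) ?_ ?_ ?_ ?_
  · intro c hc
    induction c using Quot.ind with | _ x =>
    simp only [Finset.mem_erase, Finset.mem_univ, and_true] at hc ⊢
    exact fun h' => (h.same_end_iff.1 h').elim hc.2 hc.1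
  · intro c hc c' hc' hcc
    induction c using Quot.ind with | _ x =>
    induction c' using Quot.ind with | _ y =>
    simp only [Finset.mem_erase, Finset.mem_univ, and_true] at hc hc'
    rcases h.same_iff.1 hcc with h1 | ⟨h1, h2⟩
    · exact h1
    · exact (h1.elim hc.2 hc.1).elim
  · intro c hc
    induction c using Quot.ind with | _ x =>
    simp only [Finset.mem_erase, Finset.mem_univ, and_true] at hc
    refine ⟨Quot.mk _ x, ?_, rfl⟩
    have := mt h.same_end_iff.2 hc
    simp only [Finset.mem_erase, Finset.mem_univ, and_true]
    exact ⟨fun h' => this (Or.inr h'), fun h' => this (Or.inl h')⟩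
  · intro c hc
    induction c using Quot.ind with | _ x =>
    simp only [Finset.mem_erase, Finset.mem_univ, and_true] at hc
    exact (hF x fun h' => (h.same_end_iff.1 h').elim hc.2 hc.1).symm

theorem card_circles : Fintype.card (D.Circle s) = Fintype.card (D.Circle s') + 1 := by
  classical
  have h1 := h.sum_circles (fun _ => 1) (fun _ => 1) (fun _ _ => rfl)
  simp only [Finset.sum_const, smul_eq_mul, mul_one, Finset.card_univ, Finset.card_erase_of_mem,
    Finset.mem_univ] at h1
  have h2 : 0 < Fintype.card (D.Circle s') := Fintype.card_pos_iff.2 ⟨Quot.mk _ (D.ends v 0)⟩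
  change _ = 1 + 1 + (Fintype.card (D.Circle s') - 1) at h1
  change Fintype.card (D.Circle s) = _ at h1
  omega

theorem tau_sub (l : D.Circle s → ℤˣ) (l' : D.Circle s' → ℤˣ)
    (hl : ∀ x, ¬ Same s' x (D.ends v 0) → l' (Quot.mk _ x) = l (Quot.mk _ x)) :
    tau ⟨s', l'⟩ + l (Quot.mk _ (D.ends v 0)) + l (Quot.mk _ (D.ends v 2)) =
      tau ⟨s, l⟩ + l' (Quot.mk _ (D.ends v 0)) := by
  classical
  have h1 := h.sum_circles (fun c => (l c : ℤ)) (fun c => (l' c : ℤ)) (fun x hx => by rw [hl x hx])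
  have h2 := Finset.add_sum_erase Finset.univ (fun c => (l' c : ℤ))
    (Finset.mem_univ (Quot.mk _ (D.ends v 0)))
  simp only [tau]
  linarith

end IsMerge

variable (D) in
/-- Changing an `A`-smoothing to a `B`-smoothing always merges two circles or splits one. -/
def Coherent : Prop :=
  ∀ (s : D.State) (v : D.Crossing), s v = Marker.A →
    (Same s (D.ends v 0) (D.ends v 2) ↔
      ¬ Same (Function.update s v Marker.B) (D.ends v 0) (D.ends v 2))

theorem Coherent.merge (hD : D.Coherent) {s : D.State} {v : D.Crossing} (hv : s v = Marker.A)
    (h : ¬ Same s (D.ends v 0) (D.ends v 2)) :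
    IsMerge s (Function.update s v Marker.B) v :=
  ⟨fun _ hw => Function.update_of_ne hw _ _, h, not_not.1 (mt (hD s v hv).2 h)⟩

theorem Coherent.split (hD : D.Coherent) {s : D.State} {v : D.Crossing} (hv : s v = Marker.A)
    (h : Same s (D.ends v 0) (D.ends v 2)) :
    IsMerge (Function.update s v Marker.B) s v :=
  ⟨fun _ hw => (Function.update_of_ne hw _ _).symm, (hD s v hv).1 h, h⟩

theorem aDeg_update {s : D.State} {v : D.Crossing} (hv : s v = Marker.A) (l l') :
    aDeg (⟨Function.update s v Marker.B, l'⟩ : D.EnhancedState) =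
      aDeg (⟨s, l⟩ : D.EnhancedState) - 2 := by
  have h1 : (Finset.univ.filter fun w => s w = Marker.A) =
      insert v (Finset.univ.filter fun w => Function.update s v Marker.B w = Marker.A) := by
    ext w
    by_cases hw : w = v
    · subst hw; simp [hv]
    · simp [hw]
  have h2 : (Finset.univ.filter fun w => Function.update s v Marker.B w = Marker.B) =
      insert v (Finset.univ.filter fun w => s w = Marker.B) := by
    ext w
    by_cases hw : w = v
    · subst hw; simp
    · simp [hw]
  simp only [aDeg]
  rw [h1, h2, Finset.card_insert_of_notMem (by rw [Finset.mem_filter]; simp [hv]),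
    Finset.card_insert_of_notMem (by rw [Finset.mem_filter]; simp)]
  push_cast; ring

theorem IsAdjacentAt.fst_eq {x y : D.EnhancedState} {v : D.Crossing} (h : IsAdjacentAt x y v) :
    y.1 = Function.update x.1 v Marker.B := by
  funext w
  by_cases hw : w = v
  · subst hw; simp [h.2.2.2.1]
  · simp [hw, h.2.2.2.2.1 w hw]

theorem adjacent_merge_iff {s : D.State} {v : D.Crossing} (hv : s v = Marker.A)
    (h : IsMerge s (Function.update s v Marker.B) v) (l l') :
    IsAdjacentAt (⟨s, l⟩ : D.EnhancedState) ⟨Function.update s v Marker.B, l'⟩ v ↔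
      (∀ x, ¬ Same (Function.update s v Marker.B) x (D.ends v 0) →
        l' (Quot.mk _ x) = l (Quot.mk _ x)) ∧
      (l' (Quot.mk _ (D.ends v 0)) : ℤ) =
        l (Quot.mk _ (D.ends v 0)) + l (Quot.mk _ (D.ends v 2)) + 1 := by
  have key : (∀ x : D.Arc, (∀ j, circleThrough (⟨s, l⟩ : D.EnhancedState) x ≠
      circleThrough (⟨s, l⟩ : D.EnhancedState) (D.ends v j)) →
        l' (circleThrough ⟨Function.update s v Marker.B, l'⟩ x) = l (circleThrough ⟨s, l⟩ x)) ↔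
      (∀ x, ¬ Same (Function.update s v Marker.B) x (D.ends v 0) →
        l' (Quot.mk _ x) = l (Quot.mk _ x)) :=
    forall_congr' fun x => imp_congr h.meets_iff Iff.rfl
  have ha := aDeg_update hv l l'
  simp only [IsAdjacentAt, bDeg, ha, hv, Function.update_self, true_and, key]
  constructor
  · rintro ⟨h1, -, h3⟩
    have := h.tau_sub l l' h3
    exact ⟨h3, by linarith⟩
  · rintro ⟨h1, h2⟩
    have := h.tau_sub l l' h1
    exact ⟨by linarith, fun w hw => Function.update_of_ne hw _ _, h1⟩

theorem adjacent_split_iff {s : D.State} {v : D.Crossing} (hv : s v = Marker.A)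
    (h : IsMerge (Function.update s v Marker.B) s v) (l l') :
    IsAdjacentAt (⟨s, l⟩ : D.EnhancedState) ⟨Function.update s v Marker.B, l'⟩ v ↔
      (∀ x, ¬ Same s x (D.ends v 0) → l' (Quot.mk _ x) = l (Quot.mk _ x)) ∧
      (l' (Quot.mk _ (D.ends v 0)) : ℤ) + l' (Quot.mk _ (D.ends v 2)) =
        l (Quot.mk _ (D.ends v 0)) + 1 := by
  have key : (∀ x : D.Arc, (∀ j, circleThrough (⟨s, l⟩ : D.EnhancedState) x ≠
      circleThrough (⟨s, l⟩ : D.EnhancedState) (D.ends v j)) →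
        l' (circleThrough ⟨Function.update s v Marker.B, l'⟩ x) = l (circleThrough ⟨s, l⟩ x)) ↔
      (∀ x, ¬ Same s x (D.ends v 0) →
        l' (Quot.mk _ x) = l (Quot.mk _ x)) :=
    forall_congr' fun x => imp_congr h.meets_iff' Iff.rfl
  have ha := aDeg_update hv l l'
  simp only [IsAdjacentAt, bDeg, ha, hv, Function.update_self, true_and, key]
  constructor
  · rintro ⟨h1, -, h3⟩
    have := h.tau_sub l' l (fun x hx => (h3 x hx).symm)
    exact ⟨h3, by linarith⟩
  · rintro ⟨h1, h2⟩
    have := h.tau_sub l' l (fun x hx => (h1 x hx).symm)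
    exact ⟨by linarith, fun w hw => Function.update_of_ne hw _ _, h1⟩

end Diagram

namespace Diagram

variable {D : Diagram}

instance instFintypeEnhancedState : Fintype D.EnhancedState := Fintype.ofFinite _

namespace IsMerge

variable {s s' : D.State} {v : D.Crossing}

open Classical in
theorem exists_label (h : IsMerge s s' v) (l : D.Circle s → ℤˣ) (e : ℤˣ) :
    ∃ l' : D.Circle s' → ℤˣ,
      (∀ x, ¬ Same s' x (D.ends v 0) → l' (Quot.mk _ x) = l (Quot.mk _ x)) ∧
      l' (Quot.mk _ (D.ends v 0)) = e := by
  refine ⟨fun c => if c = Quot.mk _ (D.ends v 0) then e else l (Quot.mk _ c.out), ?_, if_pos rfl⟩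
  intro x hx
  have h1 : Same s' (Quot.mk (D.Joined s') x).out x := Quot.out_eq _
  simp only [show (Quot.mk (D.Joined s') x = Quot.mk (D.Joined s') (D.ends v 0)) = False from
    eq_false hx, if_false]
  rcases h.same_iff.1 h1 with h2 | ⟨-, h2⟩
  · exact congrArg l h2
  · exact (hx (h.same_end_iff.2 h2)).elim

theorem label_ext {l₁ l₂ : D.Circle s' → ℤˣ}
    (h₁ : ∀ x, ¬ Same s' x (D.ends v 0) → l₁ (Quot.mk _ x) = l₂ (Quot.mk _ x))
    (h₂ : l₁ (Quot.mk _ (D.ends v 0)) = l₂ (Quot.mk _ (D.ends v 0))) : l₁ = l₂ := by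
  funext c
  induction c using Quot.ind with | _ x =>
  by_cases hx : Same s' x (D.ends v 0)
  · rw [show Quot.mk (D.Joined s') x = _ from hx, h₂]
  · exact h₁ x hx

open Classical in
theorem exists_label' (h : IsMerge s s' v) (l' : D.Circle s' → ℤˣ) (e d : ℤˣ) :
    ∃ l : D.Circle s → ℤˣ,
      (∀ x, ¬ Same s' x (D.ends v 0) → l (Quot.mk _ x) = l' (Quot.mk _ x)) ∧
      l (Quot.mk _ (D.ends v 0)) = e ∧ l (Quot.mk _ (D.ends v 2)) = d := by
  refine ⟨fun c => if c = Quot.mk _ (D.ends v 0) then e else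
    if c = Quot.mk _ (D.ends v 2) then d else l' (Quot.mk _ c.out), ?_, if_pos rfl, ?_⟩
  · intro x hx
    have h1 : Same s (Quot.mk (D.Joined s) x).out x := Quot.out_eq _
    have h2 := mt h.same_end_iff.2 hx
    simp only [show (Quot.mk (D.Joined s) x = Quot.mk (D.Joined s) (D.ends v 0)) = False from
      eq_false fun h' => h2 (Or.inl h'),
      show (Quot.mk (D.Joined s) x = Quot.mk (D.Joined s) (D.ends v 2)) = False from
      eq_false fun h' => h2 (Or.inr h'), if_false]
    exact congrArg l' (h.same h1)
  · simp only [if_true, show (Quot.mk (D.Joined s) (D.ends v 2) =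
      Quot.mk (D.Joined s) (D.ends v 0)) = False from eq_false fun h' => h.ne (Eq.symm h'),
      if_false]

theorem label_ext' (h : IsMerge s s' v) {l₁ l₂ : D.Circle s → ℤˣ}
    (h₁ : ∀ x, ¬ Same s' x (D.ends v 0) → l₁ (Quot.mk _ x) = l₂ (Quot.mk _ x))
    (h₂ : l₁ (Quot.mk _ (D.ends v 0)) = l₂ (Quot.mk _ (D.ends v 0)))
    (h₃ : l₁ (Quot.mk _ (D.ends v 2)) = l₂ (Quot.mk _ (D.ends v 2))) : l₁ = l₂ := by
  funext c
  induction c using Quot.ind with | _ x =>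
  by_cases hx : Same s' x (D.ends v 0)
  · rcases h.same_end_iff.1 hx with hx | hx
    · rw [show Quot.mk (D.Joined s) x = _ from hx, h₂]
    · rw [show Quot.mk (D.Joined s) x = _ from hx, h₃]
  · exact h₁ x hx

end IsMerge

open MvPolynomial

/-- The ideal of `ℤ[x_a]`, `a` an arc, which makes all `x_a` square to zero and identifies the
variables of arcs on the same circle. -/
def circleIdeal (s : D.State) : Ideal (MvPolynomial D.Arc ℤ) :=
  Ideal.span ({p | ∃ a, p = X a * X a} ∪ {p | ∃ a b, Same s a b ∧ p = X a - X b})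

/-- The quotient map onto the algebra of the circles of a state. -/
abbrev toAlg (s : D.State) : MvPolynomial D.Arc ℤ →+* MvPolynomial D.Arc ℤ ⧸ circleIdeal s :=
  Ideal.Quotient.mk (circleIdeal s)

theorem toAlg_sq (s : D.State) (a : D.Arc) : toAlg s (X a) * toAlg s (X a) = 0 := by
  rw [← map_mul]
  exact Ideal.Quotient.eq_zero_iff_mem.2 (Ideal.subset_span (Or.inl ⟨a, rfl⟩))

theorem toAlg_same {s : D.State} {a b : D.Arc} (h : Same s a b) :
    toAlg s (X a) = toAlg s (X b) :=
  Ideal.Quotient.eq.2 (Ideal.subset_span (Or.inr ⟨a, b, h, rfl⟩))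

open Classical in
/-- The factor of a circle through `a` with label `e`: the label `+` stands for the variable. -/
def factor (e : ℤˣ) (a : D.Arc) : MvPolynomial D.Arc ℤ := if e = 1 then X a else 1

theorem toAlg_factor_same {s : D.State} {a b : D.Arc} (h : Same s a b) (e : ℤˣ) :
    toAlg s (factor e a) = toAlg s (factor e b) := by
  unfold factor; split_ifs
  · exact toAlg_same h
  · rfl

/-- The monomial of an enhanced state. -/
def mono (x : D.EnhancedState) : MvPolynomial D.Arc ℤ := ∏ c : D.Circle x.1, factor (x.2 c) c.out

theorem same_out (s : D.State) (x : D.Arc) : Same s (Quot.mk (D.Joined s) x).out x :=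
  Quot.out_eq _

theorem mono_merge {s s' : D.State} {v : D.Crossing} (h : IsMerge s s' v) (t : D.State)
    (ht : t = s ∨ t = s') (l' : D.Circle s' → ℤˣ) :
    ∃ q a, Same s' a (D.ends v 0) ∧
      toAlg t (mono ⟨s', l'⟩) = toAlg t (factor (l' (Quot.mk _ (D.ends v 0))) a) * q ∧
      ∀ l : D.Circle s → ℤˣ,
        (∀ x, ¬ Same s' x (D.ends v 0) → l' (Quot.mk _ x) = l (Quot.mk _ x)) →
        toAlg t (mono ⟨s, l⟩) = toAlg t (factor (l (Quot.mk _ (D.ends v 0))) (D.ends v 0)) *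
          toAlg t (factor (l (Quot.mk _ (D.ends v 2))) (D.ends v 2)) * q := by
  classical
  have hst : ∀ {x y}, Same s x y → Same t x y := by
    rcases ht with rfl | rfl
    · exact id
    · exact h.same
  refine ⟨∏ c ∈ Finset.univ.erase (Quot.mk _ (D.ends v 0)), toAlg t (factor (l' c) c.out),
    (Quot.mk (D.Joined s') (D.ends v 0)).out, same_out _ _, ?_, fun l hl => ?_⟩
  · rw [mono, map_prod]
    exact (Finset.mul_prod_erase Finset.univ (fun c => toAlg t (factor (l' c) c.out))
      (Finset.mem_univ (Quot.mk _ (D.ends v 0)))).symm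
  · rw [mono, map_prod, h.prod_circles (fun c => toAlg t (factor (l c) c.out))
      (fun c => toAlg t (factor (l' c) c.out))]
    · rw [toAlg_factor_same (hst (same_out s (D.ends v 0))),
        toAlg_factor_same (hst (same_out s (D.ends v 2)))]
    · intro x hx
      rw [hl x hx, toAlg_factor_same (hst (same_out s x))]
      rcases h.same_iff.1 (same_out s' x) with h1 | ⟨-, h1⟩
      · exact toAlg_factor_same (hst h1) _
      · exact (hx (h.same_end_iff.2 h1)).elim

open Classical in
/-- The multiplier of the edge of the cube at `v`: it is `1` for a merge. -/
def multiplier (s : D.State) (v : D.Crossing) : MvPolynomial D.Arc ℤ :=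
  if Same s (D.ends v 0) (D.ends v 2) then X (D.ends v 0) + X (D.ends v 2) else 1

theorem units_cases (e : ℤˣ) : e = 1 ∨ e = -1 := Int.units_eq_one_or e

theorem factor_one (a : D.Arc) : factor 1 a = X a := if_pos rfl
theorem factor_neg_one (a : D.Arc) : factor (-1) a = 1 := if_neg (by decide)

theorem sum_eq_of_forall {α M : Type*} [Fintype α] [AddCommMonoid M] (p : α → Prop)
    [DecidablePred p] (f : α → M) (t : Finset α) (ht : ∀ a, p a ↔ a ∈ t) :
    (∑ a, if p a then f a else 0) = ∑ a ∈ t, f a := by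
  rw [← Finset.sum_filter]
  exact Finset.sum_congr (by ext a; simp [ht]) fun _ _ => rfl

open Classical in
theorem sum_adjacent_merge {s : D.State} {v : D.Crossing} (hv : s v = Marker.A)
    (h : IsMerge s (Function.update s v Marker.B) v) (l : D.Circle s → ℤˣ) :
    (∑ y : D.EnhancedState, if IsAdjacentAt ⟨s, l⟩ y v then
      toAlg (Function.update s v Marker.B) (mono y) else 0) =
      toAlg (Function.update s v Marker.B) (mono ⟨s, l⟩) := by
  set s' := Function.update s v Marker.B with hs'
  have hX : toAlg s' (X (D.ends v 2)) = toAlg s' (X (D.ends v 0)) := toAlg_same h.eq.symm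
  have one : ∀ e : ℤˣ, (e : ℤ) = l (Quot.mk _ (D.ends v 0)) + l (Quot.mk _ (D.ends v 2)) + 1 →
      toAlg s' (factor e (D.ends v 0)) =
        toAlg s' (factor (l (Quot.mk _ (D.ends v 0))) (D.ends v 0)) *
        toAlg s' (factor (l (Quot.mk _ (D.ends v 2))) (D.ends v 2)) →
      (∑ y : D.EnhancedState, if IsAdjacentAt ⟨s, l⟩ y v then toAlg s' (mono y) else 0) =
        toAlg s' (mono ⟨s, l⟩) := by
    intro e he hf
    obtain ⟨l', h1, h2⟩ := h.exists_label l e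
    rw [sum_eq_of_forall _ _ {⟨s', l'⟩}, Finset.sum_singleton]
    · obtain ⟨q, a, ha, h4, h3⟩ := mono_merge h s' (Or.inr rfl) l'
      rw [h3 l h1, h4, h2, toAlg_factor_same ha, hf]
    · intro y
      rw [Finset.mem_singleton]
      constructor
      · intro hy
        obtain ⟨t, m⟩ := y
        obtain rfl : t = s' := hy.fst_eq
        have h5 := (adjacent_merge_iff hv h l m).1 hy
        rw [IsMerge.label_ext (l₁ := m) (l₂ := l') (v := v)
          (fun x hx => (h5.1 x hx).trans (h1 x hx).symm)]
        rw [h2]; exact Units.ext (h5.2.trans he.symm)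
      · rintro rfl
        exact (adjacent_merge_iff hv h l l').2 ⟨h1, by rw [h2, he]⟩
  rcases units_cases (l (Quot.mk _ (D.ends v 0))) with h0 | h0 <;>
    rcases units_cases (l (Quot.mk _ (D.ends v 2))) with h2 | h2
  · obtain ⟨l', h1, -⟩ := h.exists_label l 1
    rw [sum_eq_of_forall _ _ ∅, Finset.sum_empty]
    · obtain ⟨q, a, ha, h4, h3⟩ := mono_merge h s' (Or.inr rfl) l'
      rw [h3 l h1, h0, h2, factor_one, factor_one, hX, toAlg_sq, zero_mul]
    · intro y
      refine iff_of_false (fun hy => ?_) (Finset.notMem_empty _)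
      obtain ⟨t, m⟩ := y
      obtain rfl : t = s' := hy.fst_eq
      have h5 := ((adjacent_merge_iff hv h l m).1 hy).2
      rcases units_cases (m (Quot.mk _ (D.ends v 0))) with h6 | h6 <;>
        · rw [h6, h0, h2] at h5; revert h5; decide
  · exact one 1 (by rw [h0, h2]; decide) (by
      rw [h0, h2, factor_one, factor_neg_one, map_one, mul_one])
  · exact one 1 (by rw [h0, h2]; decide) (by
      rw [h0, h2, factor_one, factor_neg_one, factor_one, map_one, one_mul, hX])
  · exact one (-1) (by rw [h0, h2]; decide) (by
      rw [h0, h2, factor_neg_one, factor_neg_one, map_one, one_mul])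

open Classical in
theorem sum_adjacent_split {s : D.State} {v : D.Crossing} (hv : s v = Marker.A)
    (h : IsMerge (Function.update s v Marker.B) s v) (l : D.Circle s → ℤˣ) :
    (∑ y : D.EnhancedState, if IsAdjacentAt ⟨s, l⟩ y v then
      toAlg (Function.update s v Marker.B) (mono y) else 0) =
      toAlg (Function.update s v Marker.B) ((X (D.ends v 0) + X (D.ends v 2)) * mono ⟨s, l⟩) := by
  set s' := Function.update s v Marker.B with hs'
  have adj : ∀ (t : Finset (ℤˣ × ℤˣ)) (f : ℤˣ × ℤˣ → D.Circle s' → ℤˣ),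
      (∀ e, ((∀ x, ¬ Same s x (D.ends v 0) → f e (Quot.mk _ x) = l (Quot.mk _ x)) ∧
        f e (Quot.mk _ (D.ends v 0)) = e.1 ∧ f e (Quot.mk _ (D.ends v 2)) = e.2)) →
      (∀ e : ℤˣ × ℤˣ, (e.1 : ℤ) + e.2 = l (Quot.mk _ (D.ends v 0)) + 1 ↔ e ∈ t) →
      (∑ y : D.EnhancedState, if IsAdjacentAt ⟨s, l⟩ y v then toAlg s' (mono y) else 0) =
        ∑ e ∈ t, toAlg s' (mono ⟨s', f e⟩) := by
    intro t f hf ht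
    rw [sum_eq_of_forall _ _ (t.image fun e => ⟨s', f e⟩), Finset.sum_image]
    · intro e _ e' _ hee
      have := eq_of_heq (Sigma.mk.inj hee).2
      refine Prod.ext ?_ ?_
      · rw [← (hf e).2.1, ← (hf e').2.1, this]
      · rw [← (hf e).2.2, ← (hf e').2.2, this]
    · rintro ⟨t', m⟩
      rw [Finset.mem_image]
      constructor
      · intro hy
        obtain rfl : t' = s' := hy.fst_eq
        have h5 := (adjacent_split_iff hv h l m).1 hy
        refine ⟨(m (Quot.mk _ (D.ends v 0)), m (Quot.mk _ (D.ends v 2))), (ht _).1 h5.2, ?_⟩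
        congr 1
        exact h.label_ext' (fun x hx => ((hf _).1 x hx).trans (h5.1 x hx).symm) (hf _).2.1
          (hf _).2.2
      · rintro ⟨e, he, hy⟩
        rw [← hy]
        exact (adjacent_split_iff hv h l _).2 ⟨(hf e).1, by rw [(hf e).2.1, (hf e).2.2, ht e]; exact he⟩
  choose f hf using fun e : ℤˣ × ℤˣ => h.exists_label' l e.1 e.2
  have h0 := toAlg_sq s' (D.ends v 0)
  have h2 := toAlg_sq s' (D.ends v 2)
  obtain ⟨q, a, ha, h4, h3⟩ := mono_merge h s' (Or.inl rfl) l
  have hm := fun e : ℤˣ × ℤˣ => h3 (f e) fun x hx => ((hf e).1 x hx).symm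
  rcases units_cases (l (Quot.mk _ (D.ends v 0))) with hl | hl
  · rw [adj {(1, 1)} f hf (by rw [hl]; decide), Finset.sum_singleton, hm, (hf _).2.1, (hf _).2.2,
      map_mul, h4, hl, factor_one, factor_one, factor_one, map_add, ← mul_assoc]
    rcases h.same_end_iff.1 ha with h5 | h5
    · rw [toAlg_same h5, add_mul, h0, zero_add, mul_comm (toAlg s' (X (D.ends v 2)))]
    · rw [toAlg_same h5, add_mul, h2, add_zero]
  · rw [adj {(1, -1), (-1, 1)} f hf (by rw [hl]; decide), Finset.sum_pair (by decide), hm, hm,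
      (hf _).2.1, (hf _).2.2, (hf _).2.1, (hf _).2.2, map_mul, h4, hl, factor_one, factor_one,
      factor_neg_one, factor_neg_one, factor_neg_one, map_add, map_one]
    ring

open Classical in
theorem sum_adjacent (hD : D.Coherent) (x : D.EnhancedState) {v : D.Crossing}
    (hv : x.1 v = Marker.A) :
    (∑ y : D.EnhancedState, if IsAdjacentAt x y v then
      toAlg (Function.update x.1 v Marker.B) (mono y) else 0) =
      toAlg (Function.update x.1 v Marker.B) (multiplier x.1 v * mono x) := by
  obtain ⟨s, l⟩ := x
  by_cases h : Same s (D.ends v 0) (D.ends v 2)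
  · rw [sum_adjacent_split hv (hD.split hv h), multiplier, if_pos h]
  · rw [sum_adjacent_merge hv (hD.merge hv h), multiplier, if_neg h, one_mul]

theorem multiplier_mul_mem (hD : D.Coherent) {s : D.State} {v : D.Crossing}
    (hv : s v = Marker.A) {p : MvPolynomial D.Arc ℤ} (hp : p ∈ circleIdeal s) :
    multiplier s v * p ∈ circleIdeal (Function.update s v Marker.B) := by
  unfold multiplier
  split_ifs with h
  · have hm := hD.split hv h
    set s' := Function.update s v Marker.B
    refine Submodule.span_induction (p := fun p _ => (X (D.ends v 0) + X (D.ends v 2) :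
      MvPolynomial D.Arc ℤ) * p ∈ circleIdeal s') ?_ ?_ ?_ ?_ hp
    · rintro _ (⟨a, rfl⟩ | ⟨a, b, hab, rfl⟩)
      · exact Ideal.mul_mem_left _ _ (Ideal.subset_span (Or.inl ⟨a, rfl⟩))
      · rw [← Ideal.Quotient.eq_zero_iff_mem, map_mul, map_add, map_sub]
        have h0 := toAlg_sq s' (D.ends v 0)
        have h2 := toAlg_sq s' (D.ends v 2)
        rcases hm.same_iff.1 hab with h1 | ⟨h1 | h1, h3 | h3⟩
        · rw [toAlg_same h1, sub_self, mul_zero]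
        · rw [toAlg_same h1, toAlg_same h3, sub_self, mul_zero]
        · rw [toAlg_same h1, toAlg_same h3]
          linear_combination h0 - h2
        · rw [toAlg_same h1, toAlg_same h3]
          linear_combination h2 - h0
        · rw [toAlg_same h1, toAlg_same h3, sub_self, mul_zero]
    · rw [mul_zero]; exact Ideal.zero_mem _
    · intro x y _ _ hx hy; rw [mul_add]; exact Ideal.add_mem _ hx hy
    · intro c x _ hx
      rw [smul_eq_mul, mul_left_comm]; exact Ideal.mul_mem_left _ _ hx
  · have hm := hD.merge hv h
    rw [one_mul]
    refine Ideal.span_mono ?_ hp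
    rintro _ (⟨a, rfl⟩ | ⟨a, b, hab, rfl⟩)
    · exact Or.inl ⟨a, rfl⟩
    · exact Or.inr ⟨a, b, hm.same hab, rfl⟩

open Classical in
/-- The exponent of the monomial of an enhanced state in the variables of the circles of `s`. -/
def exponent (s : D.State) (x : D.EnhancedState) : D.Circle s →₀ ℕ :=
  ∑ c : D.Circle x.1, if x.2 c = 1 then Finsupp.single (Quot.mk _ c.out) 1 else 0

theorem exponent_apply (s : D.State) (l : D.Circle s → ℤˣ) (c : D.Circle s) :
    exponent s ⟨s, l⟩ c = if l c = 1 then 1 else 0 := by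
  classical
  rw [exponent, Finsupp.finsetSum_apply, Finset.sum_eq_single c]
  · rw [show Quot.mk (D.Joined s) c.out = c from Quot.out_eq c]
    dsimp only
    split_ifs <;> simp
  · intro b _ hb
    rw [show Quot.mk (D.Joined s) b.out = b from Quot.out_eq b]
    split_ifs
    · exact Finsupp.single_eq_of_ne (Ne.symm hb)
    · rfl
  · intro h; exact (h (Finset.mem_univ c)).elim

theorem exponent_injective {s : D.State} {x y : D.EnhancedState} (hx : x.1 = s) (hy : y.1 = s)
    (h : exponent s x = exponent s y) : x = y := by
  obtain ⟨_, l⟩ := x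
  obtain ⟨_, m⟩ := y
  subst hx
  obtain rfl := hy
  congr 1
  funext c
  have hc := DFunLike.congr_fun h c
  rw [exponent_apply, exponent_apply] at hc
  rcases units_cases (l c) with h1 | h1 <;> rcases units_cases (m c) with h2 | h2 <;>
    simp_all

theorem rename_mono (s : D.State) (x : D.EnhancedState) :
    rename (Quot.mk (D.Joined s)) (mono x) = monomial (exponent s x) (1 : ℤ) := by
  classical
  rw [mono, map_prod, exponent, monomial_sum_one]
  refine Finset.prod_congr rfl fun c _ => ?_
  unfold factor
  split_ifs
  · rw [rename_X]; rfl
  · rw [map_one]; rfl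

theorem rename_mem {s : D.State} {p : MvPolynomial D.Arc ℤ} (hp : p ∈ circleIdeal s) :
    rename (Quot.mk (D.Joined s)) p ∈ Ideal.span ((fun e => monomial e (1 : ℤ)) ''
      Set.range fun c : D.Circle s => Finsupp.single c 2) := by
  suffices hle : circleIdeal s ≤ Ideal.comap (rename (Quot.mk (D.Joined s)) :
      MvPolynomial D.Arc ℤ →ₐ[ℤ] MvPolynomial (D.Circle s) ℤ)
      (Ideal.span ((fun e => monomial e (1 : ℤ)) ''
        Set.range fun c : D.Circle s => Finsupp.single c 2)) from hle hp
  refine Ideal.span_le.2 ?_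
  rintro _ (⟨a, rfl⟩ | ⟨a, b, hab, rfl⟩)
  · rw [SetLike.mem_coe, Ideal.mem_comap, map_mul, rename_X]
    refine Ideal.subset_span ⟨_, ⟨Quot.mk _ a, rfl⟩, ?_⟩
    rw [X, monomial_mul, ← Finsupp.single_add, one_mul]
  · rw [SetLike.mem_coe, Ideal.mem_comap, map_sub, rename_X, rename_X,
      show Quot.mk (D.Joined s) a = _ from hab, sub_self]
    exact Ideal.zero_mem _

/-- The monomials of the enhanced states over `s` are independent in the algebra of `s`. -/
theorem mono_independent (s : D.State) (f : D.EnhancedState → ℤ) (hf : ∀ x, f x ≠ 0 → x.1 = s)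
    (h : ∑ x, f x • toAlg s (mono x) = 0) : f = 0 := by
  classical
  have h1 : ∑ x, f x • mono x ∈ circleIdeal s := by
    rw [← Ideal.Quotient.eq_zero_iff_mem, map_sum, ← h]
    exact Finset.sum_congr rfl fun x _ => map_zsmul _ _ _
  have h2 := rename_mem h1
  rw [map_sum, Finset.sum_congr rfl fun x _ => (map_zsmul _ _ _).trans
    (congrArg _ (rename_mono s x)), mem_ideal_span_monomial_image] at h2
  funext x
  by_contra hx
  have hxs := hf x hx
  obtain ⟨_, ⟨c, rfl⟩, hc⟩ := h2 (exponent s x) (by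
    rw [mem_support_iff, coeff_sum, Finset.sum_eq_single x]
    · rw [coeff_smul, coeff_monomial, if_pos rfl]; simpa using hx
    · intro y _ hy
      rw [coeff_smul, coeff_monomial]
      split_ifs with he
      · have : f y = 0 := by
          by_contra hy'
          exact hy (exponent_injective (hf y hy') hxs he)
        rw [this, zero_smul]
      · exact smul_zero _
    · intro h; exact (h (Finset.mem_univ x)).elim)
  obtain ⟨_, l⟩ := x
  obtain rfl := hxs
  have := hc c
  rw [exponent_apply, Finsupp.single_eq_same] at this
  split_ifs at this <;> omega

theorem Coherent.card_cases (hD : D.Coherent) {s : D.State} {v : D.Crossing}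
    (hv : s v = Marker.A) :
    (Same s (D.ends v 0) (D.ends v 2) ∧
      Fintype.card (D.Circle (Function.update s v Marker.B)) = Fintype.card (D.Circle s) + 1) ∨
    (¬ Same s (D.ends v 0) (D.ends v 2) ∧
      Fintype.card (D.Circle s) = Fintype.card (D.Circle (Function.update s v Marker.B)) + 1) := by
  by_cases h : Same s (D.ends v 0) (D.ends v 2)
  · exact Or.inl ⟨h, (hD.split hv h).card_circles⟩
  · exact Or.inr ⟨h, (hD.merge hv h).card_circles⟩

theorem multiplier_comm (hD : D.Coherent) {s : D.State} {u v : D.Crossing} (huv : u ≠ v)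
    (hu : s u = Marker.A) (hv : s v = Marker.A) :
    toAlg (Function.update (Function.update s u Marker.B) v Marker.B)
        (multiplier (Function.update s u Marker.B) v * multiplier s u) =
      toAlg (Function.update (Function.update s u Marker.B) v Marker.B)
        (multiplier (Function.update s v Marker.B) u * multiplier s v) := by
  have hc : Function.update (Function.update s v Marker.B) u Marker.B =
    Function.update (Function.update s u Marker.B) v Marker.B := Function.update_comm huv.symm _ _ _
  have hu' : Function.update s v Marker.B u = Marker.A := by rw [Function.update_of_ne huv, hu]
  have hv' : Function.update s u Marker.B v = Marker.A := by
    rw [Function.update_of_ne huv.symm, hv]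
  set su := Function.update s u Marker.B
  set sv := Function.update s v Marker.B
  set t := Function.update su v Marker.B
  have key : ∀ {a b c d : D.Arc}, (Same t a c ∧ Same t b d) ∨ (Same t a d ∧ Same t b c) →
      toAlg t (X a + X b) = toAlg t (X c + X d) := by
    rintro a b c d (⟨h1, h2⟩ | ⟨h1, h2⟩)
    · rw [map_add, map_add, toAlg_same h1, toAlg_same h2]
    · rw [map_add, map_add, toAlg_same h1, toAlg_same h2, add_comm]
  unfold multiplier
  have e1 := hD.card_cases hu
  have e2 := hD.card_cases hv'
  have e3 := hD.card_cases hv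
  have e4 := hD.card_cases hu'
  rw [hc] at e4
  change (_ ∧ Fintype.card (D.Circle su) = _) ∨ (_ ∧ _ = Fintype.card (D.Circle su) + 1) at e1
  change (_ ∧ Fintype.card (D.Circle t) = _) ∨ (_ ∧ _ = Fintype.card (D.Circle t) + 1) at e2
  change (_ ∧ Fintype.card (D.Circle sv) = _) ∨ (_ ∧ _ = Fintype.card (D.Circle sv) + 1) at e3
  rcases e1 with ⟨h1, c1⟩ | ⟨h1, c1⟩ <;> rcases e2 with ⟨h2, c2⟩ | ⟨h2, c2⟩ <;>
    rcases e3 with ⟨h3, c3⟩ | ⟨h3, c3⟩ <;> rcases e4 with ⟨h4, c4⟩ | ⟨h4, c4⟩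
  all_goals
    simp only [h1, h2, h3, h4, if_true, if_false, one_mul, mul_one]
  all_goals first | rfl | omega | rw [mul_comm] | skip
  · have m1 := hD.split hu h1
    have m2 := hD.merge hv' h2
    have m4 := hD.merge hu' h4
    rw [hc] at m4
    have hv0 : Same t (D.ends v 0) (D.ends u 0) := by
      rcases m1.same_iff.1 h3 with h5 | ⟨h5 | h5, -⟩
      · exact (h2 h5).elim
      · exact m2.same h5
      · exact (m2.same h5).trans m4.eq.symm
    exact key (Or.inl ⟨hv0.symm, m4.eq.symm.trans (hv0.symm.trans m2.eq)⟩)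
  · have m1 := hD.merge hu h1
    have m2 := hD.split hv' h2
    have m4 := hD.split hu' h4
    rw [hc] at m4
    have hv0 : Same su (D.ends u 0) (D.ends v 0) := by
      rcases m1.same_iff.1 h2 with h5 | ⟨h5, -⟩
      · exact (h3 h5).elim
      · exact (m1.same_end_iff.2 h5).symm
    have a0 := m2.same_end_iff.1 hv0
    have a2 := m2.same_end_iff.1 (m1.eq.symm.trans hv0)
    have := m4.ne
    refine key ?_
    rcases a0 with a0 | a0 <;> rcases a2 with a2 | a2
    · exact (this (a0.trans a2.symm)).elim
    · exact Or.inl ⟨a0.symm, a2.symm⟩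
    · exact Or.inr ⟨a2.symm, a0.symm⟩
    · exact (this (a0.trans a2.symm)).elim

open Classical in
/-- The number of ways to pass from `x` to `z` through an adjacency at `u` and then one at `v`. -/
def paths (u v : D.Crossing) (x z : D.EnhancedState) : ℤ :=
  ∑ y : D.EnhancedState, if IsAdjacentAt x y u ∧ IsAdjacentAt y z v then 1 else 0

theorem paths_ne_zero {u v : D.Crossing} {x z : D.EnhancedState} (h : paths u v x z ≠ 0) :
    u ≠ v ∧ x.1 u = Marker.A ∧ x.1 v = Marker.A ∧
      z.1 = Function.update (Function.update x.1 u Marker.B) v Marker.B := by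
  obtain ⟨y, -, hy⟩ := Finset.exists_ne_zero_of_sum_ne_zero h
  have hy' : IsAdjacentAt x y u ∧ IsAdjacentAt y z v := by
    by_contra h'
    exact hy (if_neg h')
  obtain ⟨h1, h2⟩ := hy'
  have huv : u ≠ v := by
    rintro rfl
    have := h1.2.2.2.1
    rw [h2.2.2.1] at this
    cases this
  refine ⟨huv, h1.2.2.1, ?_, ?_⟩
  · rw [← h1.2.2.2.2.1 v huv.symm]; exact h2.2.2.1
  · rw [h2.fst_eq, h1.fst_eq]

theorem sum_paths (hD : D.Coherent) {x : D.EnhancedState} {u v : D.Crossing} (huv : u ≠ v)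
    (hu : x.1 u = Marker.A) (hv : x.1 v = Marker.A) :
    ∑ z, paths u v x z •
        toAlg (Function.update (Function.update x.1 u Marker.B) v Marker.B) (mono z) =
      toAlg (Function.update (Function.update x.1 u Marker.B) v Marker.B)
        (multiplier (Function.update x.1 u Marker.B) v * multiplier x.1 u * mono x) := by
  classical
  set su := Function.update x.1 u Marker.B with hsu
  set t := Function.update su v Marker.B with ht
  have hv' : su v = Marker.A := by rw [hsu, Function.update_of_ne huv.symm, hv]
  have h1 : ∑ y, (if IsAdjacentAt x y u then mono y else 0) - multiplier x.1 u * mono x ∈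
      circleIdeal su := by
    rw [← Ideal.Quotient.eq, ← sum_adjacent hD x hu, map_sum]
    refine Finset.sum_congr rfl fun y _ => ?_
    split_ifs
    · rfl
    · exact map_zero _
  have h2 := multiplier_mul_mem hD hv' h1
  rw [mul_sub, ← Ideal.Quotient.eq, Finset.mul_sum, map_sum, ← mul_assoc] at h2
  rw [← h2]
  simp only [paths, Finset.sum_smul]
  rw [Finset.sum_comm]
  refine Finset.sum_congr rfl fun y _ => ?_
  by_cases hy : IsAdjacentAt x y u
  · have h3 := sum_adjacent hD y (v := v) (by rw [hy.fst_eq]; exact hv')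
    rw [hy.fst_eq] at h3
    rw [if_pos hy, ← h3]
    refine Finset.sum_congr rfl fun z _ => ?_
    by_cases hz : IsAdjacentAt y z v
    · simp only [hy, hz, and_self, if_true, one_smul]; rfl
    · simp [hz]
  · simp [hy]

theorem paths_comm (hD : D.Coherent) {x : D.EnhancedState} (u v : D.Crossing)
    (z : D.EnhancedState) : paths u v x z = paths v u x z := by
  by_cases h : u ≠ v ∧ x.1 u = Marker.A ∧ x.1 v = Marker.A
  · obtain ⟨huv, hu, hv⟩ := h
    have hc := Function.update_comm huv Marker.B Marker.B x.1
    have h1 := sum_paths hD huv hu hv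
    have h2 := sum_paths hD huv.symm hv hu
    have h3 := multiplier_comm hD huv hu hv
    rw [← hc, map_mul, ← h3, ← map_mul] at h2
    have h4 := mono_independent _ (fun z => paths u v x z - paths v u x z) (fun z hz => by
      by_cases h5 : paths u v x z = 0
      · have h6 : paths v u x z ≠ 0 := by
          intro h6; exact hz (by rw [h5, h6, sub_zero])
        rw [(paths_ne_zero h6).2.2.2, ← hc]
      · exact (paths_ne_zero h5).2.2.2) (by
      simp only [sub_smul, Finset.sum_sub_distrib]
      rw [h1, h2, sub_self])
    exact sub_eq_zero.1 (congrFun h4 z)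
  · have h1 : paths u v x z = 0 := by
      by_contra h'
      have := paths_ne_zero h'
      tauto
    have h2 : paths v u x z = 0 := by
      by_contra h'
      have := paths_ne_zero h'
      exact h ⟨this.1.symm, this.2.2.1, this.2.1⟩
    rw [h1, h2]

/-- The sign of the edge of the cube at `v`. -/
def edgeSign (s : D.State) (v : D.Crossing) : ℤ :=
  (-1) ^ (Finset.univ.filter fun w => v < w ∧ s w = Marker.B).card

theorem edgeSign_update {s : D.State} {u v : D.Crossing} (hu : s u = Marker.A) :
    edgeSign (Function.update s u Marker.B) v = (if v < u then -1 else 1) * edgeSign s v := by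
  unfold edgeSign
  split_ifs with h
  · have : (Finset.univ.filter fun w => v < w ∧ Function.update s u Marker.B w = Marker.B) =
        insert u (Finset.univ.filter fun w => v < w ∧ s w = Marker.B) := by
      ext w
      by_cases hw : w = u
      · subst hw; simp [h]
      · simp [hw]
    rw [this, Finset.card_insert_of_notMem (by simp [hu]), pow_succ, mul_comm]
  · have : (Finset.univ.filter fun w => v < w ∧ Function.update s u Marker.B w = Marker.B) =
        (Finset.univ.filter fun w => v < w ∧ s w = Marker.B) := by
      ext w
      by_cases hw : w = u
      · subst hw; simp [h]
      · simp [hw]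
    rw [this, one_mul]

theorem incidence_eq (x y : D.EnhancedState) [∀ v, Decidable (IsAdjacentAt x y v)] :
    incidence x y = ∑ v, if IsAdjacentAt x y v then edgeSign x.1 v else 0 := by
  unfold incidence edgeSign
  exact Finset.sum_congr rfl fun v _ => by congr

/-- The square of the differential vanishes. -/
theorem sum_incidence_mul (hD : D.Coherent) (x z : D.EnhancedState) :
    ∑ y, incidence x y * incidence y z = 0 := by
  classical
  let G : D.Crossing → D.Crossing → ℤ := fun u v =>
    edgeSign x.1 u * edgeSign (Function.update x.1 u Marker.B) v * paths u v x z
  have h1 : ∑ y, incidence x y * incidence y z = ∑ u, ∑ v, G u v := by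
    simp only [incidence_eq, Finset.sum_mul_sum]
    rw [Finset.sum_comm]
    refine Finset.sum_congr rfl fun u _ => ?_
    rw [Finset.sum_comm]
    refine Finset.sum_congr rfl fun v _ => ?_
    simp only [G, paths, Finset.mul_sum]
    refine Finset.sum_congr rfl fun y _ => ?_
    by_cases h : IsAdjacentAt x y u
    · rw [h.fst_eq]
      by_cases h' : IsAdjacentAt y z v <;> simp [h, h']
    · simp [h]
  have h2 : ∀ u v, G u v = - G v u := by
    intro u v
    simp only [G]
    rw [← paths_comm hD u v]
    by_cases h : paths u v x z = 0
    · rw [h]; simp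
    · obtain ⟨huv, hu, hv, -⟩ := paths_ne_zero h
      rw [edgeSign_update hu, edgeSign_update hv]
      rcases lt_or_gt_of_ne huv with h' | h'
      · rw [if_neg h'.not_gt, if_pos h']; ring
      · rw [if_neg h'.not_gt, if_pos h']; ring
  have h3 : ∑ u, ∑ v, G u v = - ∑ u, ∑ v, G u v := by
    conv_lhs => rw [Finset.sum_comm]
    rw [← Finset.sum_neg_distrib]
    refine Finset.sum_congr rfl fun u _ => ?_
    rw [← Finset.sum_neg_distrib]
    exact Finset.sum_congr rfl fun v _ => h2 v u
  rw [h1]; omega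

end Diagram

section Exactness

variable {X : Type*}

/-- `S` contains all intermediate elements of the two-step paths between its elements. -/
def PathConvex (d : X → X → ℤ) (S : Set X) : Prop :=
  ∀ x ∈ S, ∀ z ∈ S, ∀ y, d x y ≠ 0 → d y z ≠ 0 → y ∈ S

theorem PathConvex.of_closed {d : X → X → ℤ} {S T : Set X} (hS : PathConvex d S) (hT : T ⊆ S)
    (h : ∀ x ∈ T, ∀ y ∈ S, d x y ≠ 0 → y ∈ T) : PathConvex d T :=
  fun x hx z hz y hxy hyz => h x hx y (hS x (hT hx) z (hT hz) y hxy hyz) hxy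

theorem PathConvex.of_open {d : X → X → ℤ} {S Q : Set X} (hS : PathConvex d S) (hQ : Q ⊆ S)
    (h : ∀ y ∈ Q, ∀ x ∈ S, d x y ≠ 0 → x ∈ Q) : PathConvex d Q :=
  fun x hx z hz y hxy hyz => h z hz y (hS x (hQ hx) z (hQ hz) y hxy hyz) hyz

variable [Fintype X] (d : X → X → ℤ) (deg : X → ℤ)

/-- The linear extension of the matrix `d` to chains, written as functions. -/
def applyMatrix (f : X → ℤ) (y : X) : ℤ := ∑ x, f x * d x y

/-- The part of the complex with matrix `d` spanned by `S` is exact in degree `a`. -/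
def ExactOn (S : Set X) (a : ℤ) : Prop :=
  ∀ f : X → ℤ, (∀ x, f x ≠ 0 → x ∈ S ∧ deg x = a) → (∀ y ∈ S, applyMatrix d f y = 0) →
    ∃ g : X → ℤ, (∀ x, g x ≠ 0 → x ∈ S ∧ deg x = a + 2) ∧ ∀ y ∈ S, applyMatrix d g y = f y

variable {d deg}

theorem applyMatrix_add (f g : X → ℤ) (y : X) :
    applyMatrix d (fun x => f x + g x) y = applyMatrix d f y + applyMatrix d g y := by
  simp only [applyMatrix, add_mul, Finset.sum_add_distrib]

theorem applyMatrix_sub (f g : X → ℤ) (y : X) :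
    applyMatrix d (fun x => f x - g x) y = applyMatrix d f y - applyMatrix d g y := by
  simp only [applyMatrix, sub_mul, Finset.sum_sub_distrib]

theorem applyMatrix_congr {f g : X → ℤ} {y : X} (h : ∀ x, d x y ≠ 0 → f x = g x) :
    applyMatrix d f y = applyMatrix d g y := by
  refine Finset.sum_congr rfl fun x _ => ?_
  by_cases hx : d x y = 0
  · rw [hx, mul_zero, mul_zero]
  · rw [h x hx]

theorem applyMatrix_eq_zero {f : X → ℤ} {y : X} (h : ∀ x, f x ≠ 0 → d x y = 0) :
    applyMatrix d f y = 0 :=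
  Finset.sum_eq_zero fun x _ => by
    by_cases hx : f x = 0
    · rw [hx, zero_mul]
    · rw [h x hx, mul_zero]

open Classical in
theorem applyMatrix_applyMatrix (hd : ∀ x z, ∑ y, d x y * d y z = 0) {S : Set X}
    (hS : PathConvex d S) {g : X → ℤ} (hg : ∀ x, g x ≠ 0 → x ∈ S) {z : X} (hz : z ∈ S) :
    applyMatrix d (fun y => if y ∈ S then applyMatrix d g y else 0) z = 0 := by
  have h1 : applyMatrix d (fun y => if y ∈ S then applyMatrix d g y else 0) z =
      ∑ x, g x * ∑ y, d x y * d y z := by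
    simp only [applyMatrix, Finset.mul_sum]
    rw [Finset.sum_comm]
    refine Finset.sum_congr rfl fun y _ => ?_
    split_ifs with hy
    · rw [Finset.sum_mul]
      exact Finset.sum_congr rfl fun x _ => mul_assoc _ _ _
    · rw [zero_mul]
      refine (Finset.sum_eq_zero fun x _ => ?_).symm
      by_contra h
      have h2 := left_ne_zero_of_mul h
      have h3 := right_ne_zero_of_mul h
      exact hy (hS x (hg x h2) z hz y (left_ne_zero_of_mul h3) (right_ne_zero_of_mul h3))
  rw [h1]
  exact Finset.sum_eq_zero fun x _ => by rw [hd, mul_zero]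

/-- If `T` spans a subcomplex with quotient spanned by `Q`, exactness of both gives exactness. -/
theorem ExactOn.extension (hd : ∀ x z, ∑ y, d x y * d y z = 0)
    (hdeg : ∀ x y, d x y ≠ 0 → deg y = deg x - 2) {S Q T : Set X} (hS : PathConvex d S)
    (hQT : ∀ x, x ∈ S ↔ x ∈ Q ∨ x ∈ T)
    (hTQ : ∀ x ∈ T, ∀ y ∈ Q, d x y = 0) {a : ℤ}
    (h₁ : ExactOn d deg Q a) (h₂ : ExactOn d deg T a) : ExactOn d deg S a := by
  classical
  intro f hf hcyc
  have hTQ' : ∀ {f : X → ℤ} {y : X}, y ∈ Q → (∀ x, f x ≠ 0 → x ∈ T) → applyMatrix d f y = 0 :=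
    fun hy hf => applyMatrix_eq_zero fun x hx => hTQ x (hf x hx) _ hy
  obtain ⟨g, hg, hgf⟩ := h₁ (fun x => if x ∈ Q then f x else 0)
    (fun x hx => by
      split_ifs at hx with h
      · exact ⟨h, (hf x hx).2⟩
      · exact (hx rfl).elim)
    (fun y hy => by
      refine (applyMatrix_congr fun x hx => ?_).trans (hcyc y ((hQT y).2 (Or.inl hy)))
      split_ifs with h
      · rfl
      · by_contra h'
        have h'' : f x ≠ 0 := fun h0 => h' h0.symm
        exact hx (hTQ x (((hQT x).1 (hf x h'').1).resolve_left h) y hy))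
  have hgS : ∀ x, g x ≠ 0 → x ∈ S := fun x hx => (hQT x).2 (Or.inl (hg x hx).1)
  obtain ⟨k, hk, hkf⟩ := h₂ (fun x => f x - if x ∈ S then applyMatrix d g x else 0)
    (fun x hx => by
      have hxS : x ∈ S := by
        by_contra h
        refine hx ?_
        rw [if_neg h, sub_zero]
        by_contra h'
        exact h (hf x h').1
      rw [if_pos hxS] at hx
      refine ⟨((hQT x).1 hxS).resolve_left fun h => ?_, ?_⟩
      · rw [hgf x h, if_pos h, sub_self] at hx
        exact hx rfl
      · by_cases h : f x = 0
        · rw [h, zero_sub, neg_ne_zero] at hx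
          obtain ⟨y, -, hy⟩ := Finset.exists_ne_zero_of_sum_ne_zero hx
          rw [hdeg y x (right_ne_zero_of_mul hy), (hg y (left_ne_zero_of_mul hy)).2]
          ring
        · exact (hf x h).2)
    (fun y hy => by
      have hyS := (hQT y).2 (Or.inr hy)
      rw [applyMatrix_sub, hcyc y hyS, applyMatrix_applyMatrix hd hS hgS hyS, sub_zero])
  refine ⟨fun x => g x + k x, fun x hx => ?_, fun y hy => ?_⟩
  · by_cases h : g x = 0
    · dsimp only at hx
      rw [h, zero_add] at hx
      exact ⟨(hQT x).2 (Or.inr (hk x hx).1), (hk x hx).2⟩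
    · exact ⟨hgS x h, (hg x h).2⟩
  · rw [applyMatrix_add]
    rcases (hQT y).1 hy with h | h
    · rw [hgf y h, if_pos h, hTQ' h fun x hx => (hk x hx).1, add_zero]
    · rw [hkf y h, if_pos hy, add_sub_cancel]

/-- The cone of a monomial isomorphism is exact. -/
theorem ExactOn.cone (hd : ∀ x z, ∑ y, d x y * d y z = 0)
    (hdeg : ∀ x y, d x y ≠ 0 → deg y = deg x - 2) {S Y Z : Set X} (hS : PathConvex d S)
    (hYZ : ∀ x, x ∈ S ↔ x ∈ Y ∨ x ∈ Z) (hdis : ∀ x ∈ Y, x ∉ Z)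
    (hunit : ∀ y ∈ Y, ∀ z ∈ Z, d y z ≠ 0 → d y z * d y z = 1)
    (h₁ : ∀ y ∈ Y, ∃ z ∈ Z, d y z ≠ 0) (h₂ : ∀ z ∈ Z, ∃ y ∈ Y, d y z ≠ 0)
    (u₁ : ∀ y ∈ Y, ∀ z ∈ Z, ∀ z' ∈ Z, d y z ≠ 0 → d y z' ≠ 0 → z = z')
    (u₂ : ∀ y ∈ Y, ∀ y' ∈ Y, ∀ z ∈ Z, d y z ≠ 0 → d y' z ≠ 0 → y = y') (a : ℤ) :
    ExactOn d deg S a := by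
  classical
  intro f hf hcyc
  have hval : ∀ (g : X → ℤ), (∀ x, g x ≠ 0 → x ∈ S) → ∀ y ∈ Y, ∀ z ∈ Z, d y z ≠ 0 →
      (∀ x ∈ Z, g x = 0) → applyMatrix d g z = g y * d y z := by
    intro g hg y hy z hz hyz hgZ
    refine Finset.sum_eq_single y (fun x _ hxy => ?_) fun h => (h (Finset.mem_univ y)).elim
    by_contra h
    have hx := (hYZ x).1 (hg x (left_ne_zero_of_mul h))
    rcases hx with hx | hx
    · exact hxy (u₂ x hx y hy z hz (right_ne_zero_of_mul h) hyz)
    · exact left_ne_zero_of_mul h (hgZ x hx)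
  choose! φ hφ hφd using h₁
  let g : X → ℤ := fun y => if y ∈ Y then d y (φ y) * f (φ y) else 0
  have hgY : ∀ x, g x ≠ 0 → x ∈ Y := fun x hx => by
    by_contra h
    exact hx (if_neg h)
  have hgS : ∀ x, g x ≠ 0 → x ∈ S := fun x hx => (hYZ x).2 (Or.inl (hgY x hx))
  have hgZ : ∀ z ∈ Z, applyMatrix d g z = f z := by
    intro z hz
    obtain ⟨y, hy, hyz⟩ := h₂ z hz
    obtain rfl := u₁ y hy z hz (φ y) (hφ y hy) hyz (hφd y hy)
    rw [hval g hgS y hy (φ y) hz hyz fun x hx => by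
      by_contra h
      exact hdis x (hgY x h) hx]
    simp only [g, if_pos hy]
    linear_combination f (φ y) * hunit y hy (φ y) hz hyz
  refine ⟨g, fun x hx => ⟨hgS x hx, ?_⟩, fun y hy => ?_⟩
  · have hxY := hgY x hx
    simp only [g, if_pos hxY] at hx
    have h1 := (hf _ (right_ne_zero_of_mul hx)).2
    have h2 := hdeg x (φ x) (hφd x hxY)
    omega
  · rcases (hYZ y).1 hy with hyY | hyZ
    · let k : X → ℤ := fun x => f x - if x ∈ S then applyMatrix d g x else 0
      have hkS : ∀ x, k x ≠ 0 → x ∈ S := fun x hx => by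
        by_contra h
        refine hx ?_
        simp only [k]
        rw [if_neg h, sub_zero]
        by_contra h'
        exact h (hf x h').1
      have h1 : applyMatrix d k (φ y) = 0 := by
        have hS' := (hYZ _).2 (Or.inr (hφ y hyY))
        rw [applyMatrix_sub, hcyc _ hS', applyMatrix_applyMatrix hd hS hgS hS', sub_zero]
      rw [hval k hkS y hyY _ (hφ y hyY) (hφd y hyY) fun x hx => by
        simp only [k, if_pos ((hYZ x).2 (Or.inr hx)), hgZ x hx, sub_self]] at h1
      have h2 := (mul_eq_zero.1 h1).resolve_right (hφd y hyY)
      simp only [k, if_pos hy] at h2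
      omega
    · exact hgZ y hyZ

/-- A direct summand of an exact complex is exact. -/
theorem ExactOn.summand {S Q : Set X} (hQ : Q ⊆ S)
    (h₁ : ∀ x ∈ Q, ∀ y ∈ S, d x y ≠ 0 → y ∈ Q) (h₂ : ∀ y ∈ Q, ∀ x ∈ S, d x y ≠ 0 → x ∈ Q)
    {a : ℤ} (h : ExactOn d deg S a) : ExactOn d deg Q a := by
  classical
  intro f hf hcyc
  obtain ⟨g, hg, hgf⟩ := h f (fun x hx => ⟨hQ (hf x hx).1, (hf x hx).2⟩) fun y hy => by
    by_cases hyQ : y ∈ Q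
    · exact hcyc y hyQ
    · refine applyMatrix_eq_zero fun x hx => ?_
      by_contra h'
      exact hyQ (h₁ x (hf x hx).1 y hy h')
  refine ⟨fun x => if x ∈ Q then g x else 0, fun x hx => ?_, fun y hy => ?_⟩
  · dsimp only at hx
    split_ifs at hx with h'
    · exact ⟨h', (hg x hx).2⟩
    · exact (hx rfl).elim
  · rw [← hgf y (hQ hy)]
    refine applyMatrix_congr fun x hx => ?_
    split_ifs with h'
    · rfl
    · by_contra h''
      exact h' (h₂ y hy x (hg x (Ne.symm h'')).1 hx)

theorem ExactOn.of_forall_ne {S : Set X} {a : ℤ} (h : ∀ x ∈ S, deg x ≠ a) :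
    ExactOn d deg S a := by
  intro f hf _
  have hf0 : ∀ x, f x = 0 := fun x => by
    by_contra hx
    exact h x (hf x hx).1 (hf x hx).2
  exact ⟨fun _ => 0, fun x hx => (hx rfl).elim, fun y _ => by
    rw [hf0 y]; exact applyMatrix_eq_zero fun x hx => (hx rfl).elim⟩

end Exactness

namespace Diagram

variable {D : Diagram}

theorem adjacent_of_incidence_ne_zero {x y : D.EnhancedState} (h : incidence x y ≠ 0) :
    ∃ v, IsAdjacentAt x y v := by
  classical
  by_contra h'
  push Not at h'
  exact h ((incidence_eq x y).trans (Finset.sum_eq_zero fun v _ => if_neg (h' v)))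

theorem IsAdjacentAt.unique {x y : D.EnhancedState} {v w : D.Crossing} (h : IsAdjacentAt x y v)
    (h' : IsAdjacentAt x y w) : w = v := by
  by_contra hne
  have h1 := h.2.2.2.2.1 w hne
  rw [h'.2.2.1, h'.2.2.2.1] at h1
  cases h1

theorem incidence_of_adjacent {x y : D.EnhancedState} {v : D.Crossing} (h : IsAdjacentAt x y v) :
    incidence x y = edgeSign x.1 v := by
  classical
  rw [incidence_eq, Finset.sum_eq_single v (fun w _ hw => if_neg fun h' => hw (h.unique h'))
    fun h' => (h' (Finset.mem_univ v)).elim, if_pos h]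

theorem edgeSign_mul_self (s : D.State) (v : D.Crossing) : edgeSign s v * edgeSign s v = 1 := by
  unfold edgeSign
  rw [← mul_pow]; simp

theorem incidence_ne_zero_iff {x y : D.EnhancedState} :
    incidence x y ≠ 0 ↔ ∃ v, IsAdjacentAt x y v :=
  ⟨adjacent_of_incidence_ne_zero, fun ⟨v, h⟩ h0 => by
    have := edgeSign_mul_self x.1 v
    rw [← incidence_of_adjacent h, h0] at this
    cases this⟩

theorem incidence_mul_self {x y : D.EnhancedState} (h : incidence x y ≠ 0) :
    incidence x y * incidence x y = 1 := by
  obtain ⟨v, hv⟩ := adjacent_of_incidence_ne_zero h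
  rw [incidence_of_adjacent hv, edgeSign_mul_self]

theorem aDeg_of_incidence {x y : D.EnhancedState} (h : incidence x y ≠ 0) :
    aDeg y = aDeg x - 2 := by
  obtain ⟨v, hv⟩ := adjacent_of_incidence_ne_zero h
  exact hv.1

variable (D) in
/-- A partial state, which fixes the smoothings of some of the crossings. -/
abbrev PartialState : Type := D.Crossing → Option Marker

/-- The enhanced states which extend a partial state, in a fixed degree `b`. -/
def cube (P : D.PartialState) (b : ℤ) : Set D.EnhancedState :=
  {x | (∀ v m, P v = some m → x.1 v = m) ∧ bDeg x = b}

/-- Exactness of the complex of a partial state in bidegree `(a, b)`. -/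
def CubeExact (P : D.PartialState) (a b : ℤ) : Prop := ExactOn incidence aDeg (cube P b) a

theorem marker_le {x y : D.EnhancedState} (h : incidence x y ≠ 0) {v : D.Crossing}
    (hv : x.1 v = Marker.B) : y.1 v = Marker.B := by
  obtain ⟨w, hw⟩ := adjacent_of_incidence_ne_zero h
  by_cases hvw : v = w
  · subst hvw; exact hw.2.2.2.1
  · rw [hw.2.2.2.2.1 v hvw, hv]

theorem marker_ge {x y : D.EnhancedState} (h : incidence x y ≠ 0) {v : D.Crossing}
    (hv : y.1 v = Marker.A) : x.1 v = Marker.A := by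
  rcases hx : x.1 v with _ | _
  · rfl
  · rw [marker_le h hx] at hv; cases hv

theorem pathConvex_cube (P : D.PartialState) (b : ℤ) : PathConvex incidence (cube P b) := by
  rintro x ⟨hx, hxb⟩ z ⟨hz, -⟩ y hxy hyz
  refine ⟨fun v m hm => ?_, ?_⟩
  · cases m with
    | A => exact marker_ge hyz (hz v _ hm)
    | B => exact marker_le hxy (hx v _ hm)
  · obtain ⟨w, hw⟩ := adjacent_of_incidence_ne_zero hxy
    rw [hw.2.1, hxb]

theorem mem_cube_update {P : D.PartialState} {u : D.Crossing} (hu : P u = none) (m : Marker)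
    {b : ℤ} {x : D.EnhancedState} :
    x ∈ cube (Function.update P u (some m)) b ↔ x ∈ cube P b ∧ x.1 u = m := by
  constructor
  · rintro ⟨h1, h2⟩
    refine ⟨⟨fun v m' hm' => h1 v m' ?_, h2⟩, h1 u m (Function.update_self _ _ _)⟩
    have : v ≠ u := by rintro rfl; rw [hu] at hm'; cases hm'
    rw [Function.update_of_ne this, hm']
  · rintro ⟨⟨h1, h2⟩, h3⟩
    refine ⟨fun v m' hm' => ?_, h2⟩
    by_cases hv : v = u
    · subst hv
      rw [Function.update_self] at hm'
      cases hm'; exact h3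
    · rw [Function.update_of_ne hv] at hm'
      exact h1 v m' hm'

theorem eq_none_of_adjacent {P : D.PartialState} {b : ℤ} {x y : D.EnhancedState} {v : D.Crossing}
    (hx : x ∈ cube P b) (hy : y ∈ cube P b) (h : IsAdjacentAt x y v) : P v = none := by
  rcases hP : P v with _ | m
  · rfl
  · have h1 := hx.1 v m hP
    rw [h.2.2.1] at h1
    have h2 := hy.1 v m hP
    rw [h.2.2.2.1, ← h1] at h2
    cases h2

theorem CubeExact.branch (hD : D.Coherent) {P : D.PartialState} {u : D.Crossing}
    (hu : P u = none) {a b : ℤ} (h₁ : CubeExact (Function.update P u (some Marker.A)) a b)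
    (h₂ : CubeExact (Function.update P u (some Marker.B)) a b) : CubeExact P a b := by
  refine ExactOn.extension (sum_incidence_mul hD) (fun x y => aDeg_of_incidence)
    (pathConvex_cube P b) (fun x => ?_) (fun x hx y hy => ?_) h₁ h₂
  · rw [mem_cube_update hu, mem_cube_update hu]
    rcases x.1 u with _ | _ <;> simp
  · rw [mem_cube_update hu] at hx hy
    by_contra h
    rw [marker_le h hx.2] at hy
    cases hy.2

/-- The part of the complex spanned by `Y` and `Z` is exact if the adjacencies at `v` match the
elements of `Y` with those of `Z`. -/
theorem exactOn_of_matching (hD : D.Coherent) {S Y Z : Set D.EnhancedState} {v : D.Crossing}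
    (hS : PathConvex incidence S) (hYZ : ∀ x, x ∈ S ↔ x ∈ Y ∨ x ∈ Z)
    (hY : ∀ y ∈ Y, y.1 v = Marker.A) (hZ : ∀ z ∈ Z, z.1 v = Marker.B)
    (h₁ : ∀ y ∈ Y, ∃ z ∈ Z, IsAdjacentAt y z v) (h₂ : ∀ z ∈ Z, ∃ y ∈ Y, IsAdjacentAt y z v)
    (u₁ : ∀ y ∈ Y, ∀ z ∈ Z, ∀ z' ∈ Z, IsAdjacentAt y z v → IsAdjacentAt y z' v → z = z')
    (u₂ : ∀ y ∈ Y, ∀ y' ∈ Y, ∀ z ∈ Z, IsAdjacentAt y z v → IsAdjacentAt y' z v → y = y')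
    (a : ℤ) : ExactOn incidence aDeg S a := by
  have key : ∀ y ∈ Y, ∀ z ∈ Z, incidence y z ≠ 0 → IsAdjacentAt y z v := by
    intro y hy z hz h
    obtain ⟨w, hw⟩ := adjacent_of_incidence_ne_zero h
    by_cases hvw : v = w
    · subst hvw; exact hw
    · have h1 := hw.2.2.2.2.1 v hvw
      rw [hY y hy, hZ z hz] at h1
      cases h1
  refine ExactOn.cone (Y := Y) (Z := Z) (sum_incidence_mul hD)
    (fun x y => aDeg_of_incidence) hS hYZ (fun x hx hx' => ?_)
    (fun y _ z _ h => incidence_mul_self h) (fun y hy => ?_) (fun z hz => ?_)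
    (fun y hy z hz z' hz' h h' => ?_) (fun y hy y' hy' z hz h h' => ?_) a
  · have h1 := hY x hx
    rw [hZ x hx'] at h1
    cases h1
  · obtain ⟨z, hz, h⟩ := h₁ y hy
    exact ⟨z, hz, incidence_ne_zero_iff.2 ⟨v, h⟩⟩
  · obtain ⟨y, hy, h⟩ := h₂ z hz
    exact ⟨y, hy, incidence_ne_zero_iff.2 ⟨v, h⟩⟩
  · exact u₁ y hy z hz z' hz' (key y hy z hz h) (key y hy z' hz' h')
  · exact u₂ y hy y' hy' z hz (key y hy z hz h) (key y' hy' z hz h')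

/-- The circle through `y` meets the crossing `v` at exactly one of its two sides. -/
def MeetsOnce (s : D.State) (y : D.Arc) (v : D.Crossing) : Prop :=
  (Same s y (D.ends v 0) ∧ ¬ Same s y (D.ends v 2)) ∨
    (¬ Same s y (D.ends v 0) ∧ Same s y (D.ends v 2))

theorem MeetsOnce.ne {s : D.State} {y : D.Arc} {v : D.Crossing} (h : MeetsOnce s y v) :
    ¬ Same s (D.ends v 0) (D.ends v 2) := fun h' =>
  h.elim (fun h => h.2 (h.1.trans h')) fun h => h.1 (h.2.trans h'.symm)

section Matching

variable {s : D.State} {v : D.Crossing} (hv : s v = Marker.A) {y : D.Arc}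
include hv

/-- Merging a circle labelled `-` is a bijection. -/
theorem exists_adjacent_merge (h : IsMerge s (Function.update s v Marker.B) v)
    (hy : MeetsOnce s y v) (l : D.Circle s → ℤˣ) (hl : l (Quot.mk _ y) = -1) :
    ∃ l', IsAdjacentAt (⟨s, l⟩ : D.EnhancedState) ⟨Function.update s v Marker.B, l'⟩ v := by
  rcases hy with ⟨h0, -⟩ | ⟨-, h2⟩
  · obtain ⟨l', h1, h3⟩ := h.exists_label l (l (Quot.mk _ (D.ends v 2)))
    rw [show Quot.mk (D.Joined s) y = _ from h0] at hl
    exact ⟨l', (adjacent_merge_iff hv h l l').2 ⟨h1, by rw [h3, hl]; push_cast; ring⟩⟩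
  · obtain ⟨l', h1, h3⟩ := h.exists_label l (l (Quot.mk _ (D.ends v 0)))
    rw [show Quot.mk (D.Joined s) y = _ from h2] at hl
    exact ⟨l', (adjacent_merge_iff hv h l l').2 ⟨h1, by rw [h3, hl]; push_cast; ring⟩⟩

theorem exists_adjacent_merge' (h : IsMerge s (Function.update s v Marker.B) v)
    (hy : MeetsOnce s y v) (l' : D.Circle (Function.update s v Marker.B) → ℤˣ) :
    ∃ l : D.Circle s → ℤˣ, l (Quot.mk _ y) = -1 ∧
      IsAdjacentAt (⟨s, l⟩ : D.EnhancedState) ⟨Function.update s v Marker.B, l'⟩ v := by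
  rcases hy with ⟨h0, -⟩ | ⟨-, h2⟩
  · obtain ⟨l, h1, h3, h4⟩ := h.exists_label' l' (-1) (l' (Quot.mk _ (D.ends v 0)))
    refine ⟨l, by rw [show Quot.mk (D.Joined s) y = _ from h0, h3],
      (adjacent_merge_iff hv h l l').2 ⟨fun x hx => (h1 x hx).symm, ?_⟩⟩
    rw [h3, h4]; push_cast; ring
  · obtain ⟨l, h1, h3, h4⟩ := h.exists_label' l' (l' (Quot.mk _ (D.ends v 0))) (-1)
    refine ⟨l, by rw [show Quot.mk (D.Joined s) y = _ from h2, h4],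
      (adjacent_merge_iff hv h l l').2 ⟨fun x hx => (h1 x hx).symm, ?_⟩⟩
    rw [h3, h4]; push_cast; ring

theorem adjacent_merge_unique (h : IsMerge s (Function.update s v Marker.B) v)
    {l : D.Circle s → ℤˣ} {l₁ l₂ : D.Circle (Function.update s v Marker.B) → ℤˣ}
    (h₁ : IsAdjacentAt (⟨s, l⟩ : D.EnhancedState) ⟨Function.update s v Marker.B, l₁⟩ v)
    (h₂ : IsAdjacentAt (⟨s, l⟩ : D.EnhancedState) ⟨Function.update s v Marker.B, l₂⟩ v) :
    l₁ = l₂ := by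
  rw [adjacent_merge_iff hv h] at h₁ h₂
  exact IsMerge.label_ext (fun x hx => (h₁.1 x hx).trans (h₂.1 x hx).symm)
    (Units.ext (h₁.2.trans h₂.2.symm))

theorem adjacent_merge_unique' (h : IsMerge s (Function.update s v Marker.B) v)
    (hy : MeetsOnce s y v) {l₁ l₂ : D.Circle s → ℤˣ}
    {l' : D.Circle (Function.update s v Marker.B) → ℤˣ}
    (hl₁ : l₁ (Quot.mk _ y) = -1) (hl₂ : l₂ (Quot.mk _ y) = -1)
    (h₁ : IsAdjacentAt (⟨s, l₁⟩ : D.EnhancedState) ⟨Function.update s v Marker.B, l'⟩ v)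
    (h₂ : IsAdjacentAt (⟨s, l₂⟩ : D.EnhancedState) ⟨Function.update s v Marker.B, l'⟩ v) :
    l₁ = l₂ := by
  rw [adjacent_merge_iff hv h] at h₁ h₂
  have h3 := h₁.2.symm.trans h₂.2
  rcases hy with ⟨h0, -⟩ | ⟨-, h0⟩ <;>
    rw [show Quot.mk (D.Joined s) y = _ from h0] at hl₁ hl₂
  · exact h.label_ext' (fun x hx => (h₁.1 x hx).symm.trans (h₂.1 x hx)) (hl₁.trans hl₂.symm)
      (Units.ext (by rw [hl₁, hl₂] at h3; linarith))
  · exact h.label_ext' (fun x hx => (h₁.1 x hx).symm.trans (h₂.1 x hx))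
      (Units.ext (by rw [hl₁, hl₂] at h3; linarith)) (hl₁.trans hl₂.symm)

/-- Splitting off a circle labelled `+` is a bijection. -/
theorem exists_adjacent_split (h : IsMerge (Function.update s v Marker.B) s v)
    (hy : MeetsOnce (Function.update s v Marker.B) y v) (l : D.Circle s → ℤˣ) :
    ∃ l' : D.Circle (Function.update s v Marker.B) → ℤˣ, l' (Quot.mk _ y) = 1 ∧
      IsAdjacentAt (⟨s, l⟩ : D.EnhancedState) ⟨Function.update s v Marker.B, l'⟩ v := by
  rcases hy with ⟨h0, -⟩ | ⟨-, h2⟩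
  · obtain ⟨l', h1, h3, h4⟩ := h.exists_label' l 1 (l (Quot.mk _ (D.ends v 0)))
    refine ⟨l', by rw [show Quot.mk (D.Joined _) y = _ from h0, h3],
      (adjacent_split_iff hv h l l').2 ⟨h1, ?_⟩⟩
    rw [h3, h4]; push_cast; ring
  · obtain ⟨l', h1, h3, h4⟩ := h.exists_label' l (l (Quot.mk _ (D.ends v 0))) 1
    refine ⟨l', by rw [show Quot.mk (D.Joined _) y = _ from h2, h4],
      (adjacent_split_iff hv h l l').2 ⟨h1, ?_⟩⟩
    rw [h3, h4]; push_cast; ring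

theorem exists_adjacent_split' (h : IsMerge (Function.update s v Marker.B) s v)
    (hy : MeetsOnce (Function.update s v Marker.B) y v)
    (l' : D.Circle (Function.update s v Marker.B) → ℤˣ) (hl : l' (Quot.mk _ y) = 1) :
    ∃ l, IsAdjacentAt (⟨s, l⟩ : D.EnhancedState) ⟨Function.update s v Marker.B, l'⟩ v := by
  rcases hy with ⟨h0, -⟩ | ⟨-, h2⟩
  · obtain ⟨l, h1, h3⟩ := h.exists_label l' (l' (Quot.mk _ (D.ends v 2)))
    rw [show Quot.mk (D.Joined _) y = _ from h0] at hl
    exact ⟨l, (adjacent_split_iff hv h l l').2 ⟨fun x hx => (h1 x hx).symm, by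
      rw [h3, hl]; push_cast; ring⟩⟩
  · obtain ⟨l, h1, h3⟩ := h.exists_label l' (l' (Quot.mk _ (D.ends v 0)))
    rw [show Quot.mk (D.Joined _) y = _ from h2] at hl
    exact ⟨l, (adjacent_split_iff hv h l l').2 ⟨fun x hx => (h1 x hx).symm, by
      rw [h3, hl]; push_cast; ring⟩⟩

theorem adjacent_split_unique (h : IsMerge (Function.update s v Marker.B) s v)
    (hy : MeetsOnce (Function.update s v Marker.B) y v) {l : D.Circle s → ℤˣ}
    {l₁ l₂ : D.Circle (Function.update s v Marker.B) → ℤˣ}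
    (hl₁ : l₁ (Quot.mk _ y) = 1) (hl₂ : l₂ (Quot.mk _ y) = 1)
    (h₁ : IsAdjacentAt (⟨s, l⟩ : D.EnhancedState) ⟨Function.update s v Marker.B, l₁⟩ v)
    (h₂ : IsAdjacentAt (⟨s, l⟩ : D.EnhancedState) ⟨Function.update s v Marker.B, l₂⟩ v) :
    l₁ = l₂ := by
  rw [adjacent_split_iff hv h] at h₁ h₂
  have h3 := h₁.2.trans h₂.2.symm
  rcases hy with ⟨h0, -⟩ | ⟨-, h0⟩ <;>
    rw [show Quot.mk (D.Joined _) y = _ from h0] at hl₁ hl₂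
  · exact h.label_ext' (fun x hx => (h₁.1 x hx).trans (h₂.1 x hx).symm) (hl₁.trans hl₂.symm)
      (Units.ext (by rw [hl₁, hl₂] at h3; linarith))
  · exact h.label_ext' (fun x hx => (h₁.1 x hx).trans (h₂.1 x hx).symm)
      (Units.ext (by rw [hl₁, hl₂] at h3; linarith)) (hl₁.trans hl₂.symm)

theorem adjacent_split_unique' (h : IsMerge (Function.update s v Marker.B) s v)
    {l₁ l₂ : D.Circle s → ℤˣ} {l' : D.Circle (Function.update s v Marker.B) → ℤˣ}
    (h₁ : IsAdjacentAt (⟨s, l₁⟩ : D.EnhancedState) ⟨Function.update s v Marker.B, l'⟩ v)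
    (h₂ : IsAdjacentAt (⟨s, l₂⟩ : D.EnhancedState) ⟨Function.update s v Marker.B, l'⟩ v) :
    l₁ = l₂ := by
  rw [adjacent_split_iff hv h] at h₁ h₂
  exact IsMerge.label_ext (fun x hx => (h₁.1 x hx).symm.trans (h₂.1 x hx))
    (Units.ext (by linarith [h₁.2, h₂.2]))

end Matching

end Diagram

namespace Diagram

variable {D : Diagram}

theorem exists_eq_update {t : D.State} {u : D.Crossing} (h : t u = Marker.B) :
    ∃ s : D.State, s u = Marker.A ∧ t = Function.update s u Marker.B :=
  ⟨Function.update t u Marker.A, Function.update_self _ _ _, by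
    rw [Function.update_idem, ← h, Function.update_eq_self]⟩

theorem eq_of_adjacent_of_adjacent {x y z : D.EnhancedState} {u : D.Crossing}
    (h : IsAdjacentAt x z u) (h' : IsAdjacentAt y z u) : x.1 = y.1 := by
  funext w
  by_cases hw : w = u
  · subst hw; exact h.2.2.1.trans h'.2.2.1.symm
  · exact (h.2.2.2.2.1 w hw).symm.trans (h'.2.2.2.2.1 w hw)

/-- The cone over the merges at `u` of a circle labelled `-` is exact. -/
theorem exactOn_merge (hD : D.Coherent) {K : D.State → Prop} {b : ℤ} {T : Set D.EnhancedState}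
    {u : D.Crossing} {y : D.Arc}
    (hK : ∀ s, s u = Marker.A → (K s ↔ K (Function.update s u Marker.B)))
    (hm : ∀ s, K s → s u = Marker.A → MeetsOnce s y u) (hT : PathConvex incidence T)
    (hT' : ∀ x, x ∈ T ↔ (K x.1 ∧ bDeg x = b) ∧
      ((x.1 u = Marker.A ∧ x.2 (Quot.mk _ y) = -1) ∨ x.1 u = Marker.B)) (a : ℤ) :
    ExactOn incidence aDeg T a := by
  refine exactOn_of_matching hD (v := u)
    (Y := {x | (K x.1 ∧ bDeg x = b) ∧ x.1 u = Marker.A ∧ x.2 (Quot.mk _ y) = -1})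
    (Z := {x | (K x.1 ∧ bDeg x = b) ∧ x.1 u = Marker.B}) hT (fun x => ?_) (fun x hx => hx.2.1)
    (fun x hx => hx.2) ?_ ?_ ?_ ?_ a
  · rw [hT', and_or_left]; rfl
  · rintro ⟨s, l⟩ ⟨⟨h1, hb⟩, h2, h3⟩
    have hy := hm _ h1 h2
    obtain ⟨l', hl'⟩ := exists_adjacent_merge h2 (hD.merge h2 hy.ne) hy l h3
    exact ⟨_, ⟨⟨(hK _ h2).1 h1, hl'.2.1.trans hb⟩, Function.update_self _ _ _⟩, hl'⟩
  · rintro ⟨t, l'⟩ ⟨⟨h1, hb⟩, h2⟩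
    obtain ⟨s, hs, rfl⟩ := exists_eq_update h2
    have h1' := (hK s hs).2 h1
    have hy := hm s h1' hs
    obtain ⟨l, h3, hl⟩ := exists_adjacent_merge' hs (hD.merge hs hy.ne) hy l'
    exact ⟨⟨s, l⟩, ⟨⟨h1', hl.2.1.symm.trans hb⟩, hs, h3⟩, hl⟩
  · rintro ⟨s, l⟩ ⟨⟨h1, -⟩, h2, h3⟩ ⟨t, m⟩ - ⟨t', m'⟩ - ha ha'
    obtain rfl : t = _ := ha.fst_eq
    obtain rfl : t' = _ := ha'.fst_eq
    obtain rfl := adjacent_merge_unique h2 (hD.merge h2 (hm _ h1 h2).ne) ha ha'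
    rfl
  · rintro ⟨s, l⟩ ⟨⟨h1, -⟩, h2, h3⟩ ⟨s', l'⟩ ⟨-, h2', h3'⟩ ⟨t, m⟩ - ha ha'
    obtain rfl : t = _ := ha.fst_eq
    obtain rfl : s = s' := eq_of_adjacent_of_adjacent ha ha'
    obtain rfl := adjacent_merge_unique' h2 (hD.merge h2 (hm _ h1 h2).ne) (hm _ h1 h2) h3 h3' ha ha'
    rfl

/-- The cone over the splittings at `v` of a circle labelled `+` is exact. -/
theorem exactOn_split (hD : D.Coherent) {K : D.State → Prop} {b : ℤ} {W : Set D.EnhancedState}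
    {v : D.Crossing} {y : D.Arc}
    (hK : ∀ s, s v = Marker.A → (K s ↔ K (Function.update s v Marker.B)))
    (hm : ∀ s, K s → s v = Marker.B → MeetsOnce s y v) (hW : PathConvex incidence W)
    (hW' : ∀ x, x ∈ W ↔ (K x.1 ∧ bDeg x = b) ∧
      (x.1 v = Marker.A ∨ (x.1 v = Marker.B ∧ x.2 (Quot.mk _ y) = 1))) (a : ℤ) :
    ExactOn incidence aDeg W a := by
  have hsplit : ∀ s, K s → s v = Marker.A → IsMerge (Function.update s v Marker.B) s v ∧
      MeetsOnce (Function.update s v Marker.B) y v := by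
    intro s h1 h2
    have hy := hm _ ((hK s h2).1 h1) (Function.update_self _ _ _)
    exact ⟨hD.split h2 ((hD s v h2).2 hy.ne), hy⟩
  refine exactOn_of_matching hD (v := v)
    (Y := {x | (K x.1 ∧ bDeg x = b) ∧ x.1 v = Marker.A})
    (Z := {x | (K x.1 ∧ bDeg x = b) ∧ x.1 v = Marker.B ∧ x.2 (Quot.mk _ y) = 1}) hW (fun x => ?_)
    (fun x hx => hx.2) (fun x hx => hx.2.1) ?_ ?_ ?_ ?_ a
  · rw [hW', and_or_left]; rfl
  · rintro ⟨s, l⟩ ⟨⟨h1, hb⟩, h2⟩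
    obtain ⟨h, hy⟩ := hsplit s h1 h2
    obtain ⟨l', h3, hl'⟩ := exists_adjacent_split h2 h hy l
    exact ⟨_, ⟨⟨(hK _ h2).1 h1, hl'.2.1.trans hb⟩, Function.update_self _ _ _, h3⟩, hl'⟩
  · rintro ⟨t, l'⟩ ⟨⟨h1, hb⟩, h2, h3⟩
    obtain ⟨s, hs, rfl⟩ := exists_eq_update h2
    have h1' := (hK s hs).2 h1
    obtain ⟨h, hy⟩ := hsplit s h1' hs
    obtain ⟨l, hl⟩ := exists_adjacent_split' hs h hy l' h3
    exact ⟨⟨s, l⟩, ⟨⟨h1', hl.2.1.symm.trans hb⟩, hs⟩, hl⟩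
  · rintro ⟨s, l⟩ ⟨⟨h1, -⟩, h2⟩ ⟨t, m⟩ ⟨-, -, h3⟩ ⟨t', m'⟩ ⟨-, -, h3'⟩ ha ha'
    obtain rfl : t = _ := ha.fst_eq
    obtain rfl : t' = _ := ha'.fst_eq
    obtain ⟨h, hy⟩ := hsplit s h1 h2
    obtain rfl := adjacent_split_unique h2 h hy h3 h3' ha ha'
    rfl
  · rintro ⟨s, l⟩ ⟨⟨h1, -⟩, h2⟩ ⟨s', l'⟩ - ⟨t, m⟩ - ha ha'
    obtain rfl : t = _ := ha.fst_eq
    obtain rfl : s = s' := eq_of_adjacent_of_adjacent ha ha'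
    obtain rfl := adjacent_split_unique' h2 (hsplit s h1 h2).1 ha ha'
    rfl

/-- States extending a partial state. -/
def Extends (s : D.State) (P : D.PartialState) : Prop := ∀ v m, P v = some m → s v = m

theorem extends_update_iff {s : D.State} {P : D.PartialState} {u : D.Crossing} (hu : P u = none)
    (m : Marker) : Extends s P ↔ Extends (Function.update s u m) P := by
  refine forall_congr' fun v => forall_congr' fun m' => imp_congr_right fun h => ?_
  have : v ≠ u := by rintro rfl; rw [hu] at h; cases h
  rw [Function.update_of_ne this]

theorem IsAdjacentAt.label_eq {x z : D.EnhancedState} {w : D.Crossing} (h : IsAdjacentAt x z w)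
    {y : D.Arc} (hy : ∀ j, ¬ Same x.1 y (D.ends w j)) :
    z.2 (Quot.mk _ y) = x.2 (Quot.mk _ y) := h.2.2.2.2.2 y hy

/-- A kink: if the `A`-smoothing of `u` splits off a circle, then only this smoothing matters. -/
theorem CubeExact.kink (hD : D.Coherent) {P : D.PartialState} {u : D.Crossing}
    (hu : P u = none) {y : D.Arc}
    (hm : ∀ s, Extends s P → s u = Marker.A → MeetsOnce s y u)
    (hiso : ∀ s, Extends s P → s u = Marker.A → ∀ w, P w = none → w ≠ u → ∀ j,
      ¬ Same s y (D.ends w j)) {a b : ℤ}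
    (h : CubeExact (Function.update P u (some Marker.A)) a b) : CubeExact P a b := by
  have hlabel : ∀ x ∈ cube P b, ∀ z ∈ cube P b, incidence x z ≠ 0 → x.1 u = Marker.A →
      z.1 u = Marker.A → z.2 (Quot.mk _ y) = x.2 (Quot.mk _ y) := by
    intro x hx z hz h hxu hzu
    obtain ⟨w, hw⟩ := adjacent_of_incidence_ne_zero h
    refine hw.label_eq (hiso x.1 hx.1 hxu w (eq_none_of_adjacent hx hz hw) ?_)
    rintro rfl
    rw [hw.2.2.2.1] at hzu; cases hzu
  have hTQ : ∀ x ∈ cube P b, ((x.1 u = Marker.A ∧ x.2 (Quot.mk _ y) = -1) ∨ x.1 u = Marker.B) →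
      ∀ z ∈ cube P b, incidence x z ≠ 0 →
      ((z.1 u = Marker.A ∧ z.2 (Quot.mk _ y) = -1) ∨ z.1 u = Marker.B) := by
    rintro x hx hxu z hz h
    rcases hzu : z.1 u with _ | _
    · have hxu' := marker_ge h hzu
      rw [hxu'] at hxu
      refine Or.inl ⟨rfl, ?_⟩
      rw [hlabel x hx z hz h hxu' hzu]
      simpa using hxu
    · exact Or.inr rfl
  refine ExactOn.extension
    (Q := {x | x ∈ cube P b ∧ x.1 u = Marker.A ∧ x.2 (Quot.mk _ y) = 1})
    (T := {x | x ∈ cube P b ∧ ((x.1 u = Marker.A ∧ x.2 (Quot.mk _ y) = -1) ∨ x.1 u = Marker.B)})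
    (sum_incidence_mul hD) (fun x y => aDeg_of_incidence) (pathConvex_cube P b) ?_ ?_ ?_ ?_
  · intro x
    rcases hxu : x.1 u with _ | _
    · rcases units_cases (x.2 (Quot.mk _ y)) with h1 | h1 <;> simp [hxu, h1]
    · simp [hxu]
  · rintro x ⟨hx, hxu⟩ z ⟨hz, hzu⟩
    by_contra h
    have := hTQ x hx hxu z hz h
    rw [hzu.1, hzu.2] at this
    revert this; decide
  · refine ExactOn.summand (S := cube (Function.update P u (some Marker.A)) b) ?_ ?_ ?_ h
    · rintro x ⟨hx, hxu, -⟩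
      exact (mem_cube_update hu _).2 ⟨hx, hxu⟩
    · rintro x ⟨hx, hxu, hl⟩ z hz h
      rw [mem_cube_update hu] at hz
      exact ⟨hz.1, hz.2, (hlabel x hx z hz.1 h hxu hz.2).trans hl⟩
    · rintro z ⟨hz, hzu, hl⟩ x hx h
      rw [mem_cube_update hu] at hx
      exact ⟨hx.1, hx.2, (hlabel x hx.1 z hz h hx.2 hzu).symm.trans hl⟩
  · exact exactOn_merge hD (K := fun s => Extends s P) (fun s _ => extends_update_iff hu _) hm
      ((pathConvex_cube P b).of_closed (fun x hx => hx.1) fun x hx z hz h =>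
        (⟨hz, hTQ x hx.1 hx.2 z hz h⟩ : z ∈ cube P b ∧ _)) (fun x => Iff.rfl) a

/-- A strand slides over a cap: if smoothing `u` by `A` and `v` by `B` splits off a circle, then
only the opposite smoothings of `u` and `v` matter. -/
theorem CubeExact.slide (hD : D.Coherent) {P : D.PartialState} {u v : D.Crossing} (huv : u ≠ v)
    (hu : P u = none) (hv : P v = none) {y : D.Arc}
    (hmu : ∀ s, Extends s P → s u = Marker.A → s v = Marker.B → MeetsOnce s y u)
    (hmv : ∀ s, Extends s P → s u = Marker.A → s v = Marker.B → MeetsOnce s y v)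
    (hiso : ∀ s, Extends s P → s u = Marker.A → s v = Marker.B → ∀ w, P w = none → w ≠ u →
      w ≠ v → ∀ j, ¬ Same s y (D.ends w j)) {a b : ℤ}
    (h : CubeExact (Function.update (Function.update P u (some Marker.B)) v (some Marker.A)) a b) :
    CubeExact P a b := by
  have hS := pathConvex_cube P b
  set S := cube P b with hSdef
  set T : Set D.EnhancedState := {x | x ∈ S ∧ x.1 v = Marker.B ∧
    ((x.1 u = Marker.A ∧ x.2 (Quot.mk _ y) = -1) ∨ x.1 u = Marker.B)} with hT
  set W : Set D.EnhancedState := {x | x ∈ S ∧ x.1 u = Marker.A ∧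
    (x.1 v = Marker.A ∨ (x.1 v = Marker.B ∧ x.2 (Quot.mk _ y) = 1))} with hW
  set R : Set D.EnhancedState := {x | x ∈ S ∧ x.1 u = Marker.B ∧ x.1 v = Marker.A} with hR
  have hTclosed : ∀ x ∈ T, ∀ z ∈ S, incidence x z ≠ 0 → z ∈ T := by
    rintro x ⟨hx, hxv, hxu⟩ z hz h
    have hzv := marker_le h hxv
    refine ⟨hz, hzv, ?_⟩
    rcases hzu : z.1 u with _ | _
    · have hxu' := marker_ge h hzu
      rw [hxu'] at hxu
      refine Or.inl ⟨rfl, ?_⟩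
      obtain ⟨w, hw⟩ := adjacent_of_incidence_ne_zero h
      rw [hw.label_eq (hiso x.1 hx.1 hxu' hxv w (eq_none_of_adjacent hx hz hw) ?_ ?_)]
      · simpa using hxu
      · rintro rfl
        rw [hw.2.2.2.1] at hzu; cases hzu
      · rintro rfl
        rw [hw.2.2.1] at hxv; cases hxv
    · exact Or.inr rfl
  have hWR : ∀ x, x ∈ W ∪ R ↔ x ∈ S ∧ x ∉ T := by
    intro x
    simp only [hW, hR, hT, Set.mem_union, Set.mem_ofPred_eq]
    rcases hxu : x.1 u with _ | _ <;> rcases hxv : x.1 v with _ | _ <;>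
      rcases units_cases (x.2 (Quot.mk _ y)) with h1 | h1 <;> simp [h1]
  have hRW : ∀ x ∈ R, ∀ z ∈ W, incidence x z = 0 := by
    rintro x ⟨-, hx, -⟩ z ⟨-, hz, -⟩
    by_contra h
    rw [marker_le h hx] at hz; cases hz
  have hWRc : PathConvex incidence (W ∪ R) := by
    refine hS.of_open (fun x hx => ((hWR x).1 hx).1) fun z hz x hx h => ?_
    rw [hWR] at hz ⊢
    exact ⟨hx, fun hxT => hz.2 (hTclosed x hxT z hz.1 h)⟩
  refine ExactOn.extension (Q := W ∪ R) (T := T) (sum_incidence_mul hD)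
    (fun x y => aDeg_of_incidence) hS (fun x => ?_) (fun x hx z hz => ?_) ?_ ?_
  · rw [hWR]
    have : x ∈ T → x ∈ S := fun hx => hx.1
    tauto
  · by_contra h
    rw [hWR] at hz
    exact hz.2 (hTclosed x hx z hz.1 h)
  · refine ExactOn.extension (Q := W) (T := R) (sum_incidence_mul hD)
      (fun x y => aDeg_of_incidence) hWRc (fun x => Iff.rfl) hRW ?_ ?_
    · refine exactOn_split hD (K := fun s => Extends s P ∧ s u = Marker.A) (v := v) (y := y)
        (b := b) (fun s _ => ?_) (fun s hs hsv => hmv s hs.1 hs.2 hsv)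
        (hWRc.of_open Set.subset_union_left fun z hz x hx h => ?_) (fun x => ?_) a
      · rw [← extends_update_iff hv, Function.update_of_ne huv]
      · refine hx.resolve_right fun hxR => h (hRW x hxR z hz)
      · simp only [hW, hSdef, Set.mem_ofPred_eq, cube, Extends]; tauto
    · have hRe : R =
          cube (Function.update (Function.update P u (some Marker.B)) v (some Marker.A)) b := by
        ext x
        rw [mem_cube_update (by rw [Function.update_of_ne huv.symm, hv]), mem_cube_update hu]
        simp only [hR, Set.mem_ofPred_eq]; tauto
      rw [hRe]; exact h
  · refine exactOn_merge hD (K := fun s => Extends s P ∧ s v = Marker.B) (u := u) (y := y)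
      (b := b) (fun s _ => ?_) (fun s hs hsu => hmu s hs.1 hsu hs.2)
      (hS.of_closed (fun x hx => hx.1) hTclosed) (fun x => ?_) a
    · rw [← extends_update_iff hu, Function.update_of_ne huv.symm]
    · simp only [hT, hSdef, Set.mem_ofPred_eq, cube, Extends]; tauto

end Diagram

section Perm

open Equiv

variable {α : Type*} [Finite α] [DecidableEq α]

theorem sameCycle_mul_swap_of_not {π : Perm α} {p q : α} (h : ¬ π.SameCycle p q) :
    (π * swap p q).SameCycle p q := by
  have key : ∀ j : ℕ, (π * swap p q).SameCycle q p ∨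
      (π * swap p q).SameCycle q ((π ^ (j + 1)) p) := by
    intro j
    induction j with
    | zero => exact Or.inr ⟨1, by simp⟩
    | succ j ih =>
      rcases ih with ih | ih
      · exact Or.inl ih
      · by_cases hp : (π ^ (j + 1)) p = p
        · rw [hp] at ih; exact Or.inl ih
        · refine Or.inr (ih.trans ⟨1, ?_⟩)
          have hq : (π ^ (j + 1)) p ≠ q := fun h' => h ⟨(j + 1 : ℕ), by rw [zpow_natCast, h']⟩
          rw [zpow_one, Perm.mul_apply, swap_apply_of_ne_of_ne hp hq, pow_succ' π (j + 1),
            Perm.mul_apply]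
  obtain ⟨n, hn, hn'⟩ := (isOfFinOrder_of_finite π).exists_pow_eq_one
  obtain ⟨k, rfl⟩ := Nat.exists_eq_add_of_lt hn
  rcases key k with h1 | h1
  · exact h1.symm
  · rw [zero_add] at hn'
    rw [hn'] at h1
    exact h1.symm

theorem not_sameCycle_mul_swap {π : Perm α} {p q : α} (hpq : p ≠ q) (h : π.SameCycle p q) :
    ¬ (π * swap p q).SameCycle p q := by
  have hex : ∃ n : ℕ, 0 < n ∧ (π ^ n) p = q := by
    obtain ⟨n, hn, -, hn'⟩ := h.exists_pow_eq''
    exact ⟨n, hn, hn'⟩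
  classical
  have hm := Nat.find_spec hex
  have hmin : ∀ j, 0 < j → (π ^ j) p = q → Nat.find hex ≤ j := fun j h1 h2 =>
    Nat.find_min' hex ⟨h1, h2⟩
  set n := Nat.find hex
  have hp : ∀ j, 0 < j → j ≤ n → (π ^ j) p ≠ p := by
    intro j h1 h2 h3
    rcases h2.eq_or_lt with rfl | h2
    · exact hpq (h3.symm.trans hm.2)
    · have h4 : (π ^ (n - j)) p = q := by
        have h5 := hm.2
        rw [← Nat.sub_add_cancel h2.le, pow_add, Perm.mul_apply, h3] at h5
        exact h5
      have := hmin (n - j) (by omega) h4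
      omega
  have hclosed : ∀ i : ℕ, ∃ j, 0 < j ∧ j ≤ n ∧ ((π * swap p q) ^ i) q = (π ^ j) p := by
    intro i
    induction i with
    | zero => exact ⟨n, hm.1, le_rfl, hm.2.symm⟩
    | succ i ih =>
      obtain ⟨j, h1, h2, h3⟩ := ih
      rw [pow_succ', Perm.mul_apply, h3, Perm.mul_apply]
      rcases h2.eq_or_lt with rfl | h2
      · exact ⟨1, one_pos, h1, by rw [hm.2, swap_apply_right, pow_one]⟩
      · refine ⟨j + 1, by omega, h2, ?_⟩
        rw [swap_apply_of_ne_of_ne (hp j h1 h2.le) fun h4 => ?_, pow_succ', Perm.mul_apply]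
        have := hmin j h1 h4
        omega
  intro h'
  obtain ⟨i, -, -, hi⟩ := h'.symm.exists_pow_eq''
  obtain ⟨j, h1, h2, h3⟩ := hclosed i
  exact hp j h1 h2 (h3.symm.trans hi)

theorem sameCycle_mul_swap_iff {π : Perm α} {p q : α} (hpq : p ≠ q) :
    π.SameCycle p q ↔ ¬ (π * swap p q).SameCycle p q :=
  ⟨not_sameCycle_mul_swap hpq, fun h => by
    by_contra h'
    exact h (sameCycle_mul_swap_of_not h')⟩

end Perm

namespace BraidWord

open Diagram

variable {m : ℕ} (β : BraidWord m)

/-- The crossing of the closure at the `t`-th letter. -/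
def crossing (t : Fin β.length) : β.closure.Crossing := t

/-- The smoothing of `s` at the `t`-th letter is a cup and a cap. -/
def Flat (s : β.closure.State) (t : Fin β.length) : Prop :=
  ((β.get t).2 = 1 ∧ s (β.crossing t) = Marker.B) ∨
    ((β.get t).2 ≠ 1 ∧ s (β.crossing t) = Marker.A)

/-- The arc at height `t` and position `p`. -/
abbrev arc (t : Fin (β.length + 1)) (p : Fin m) : β.closure.Arc := (t, p)

variable {β}

theorem ends_pos {t : Fin β.length} (h : (β.get t).2 = 1) : β.closure.ends (β.crossing t) =
    ![β.arc t.castSucc (right (β.get t).1), β.arc t.succ (right (β.get t).1),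
      β.arc t.succ (left (β.get t).1), β.arc t.castSucc (left (β.get t).1)] := if_pos h

theorem ends_neg {t : Fin β.length} (h : (β.get t).2 ≠ 1) : β.closure.ends (β.crossing t) =
    ![β.arc t.castSucc (left (β.get t).1), β.arc t.castSucc (right (β.get t).1),
      β.arc t.succ (right (β.get t).1), β.arc t.succ (left (β.get t).1)] := if_neg h

theorem joined_cases {s : β.closure.State} {R : β.closure.Arc → β.closure.Arc → Prop}
    (hsymm : ∀ x y, R x y → R y x)
    (hvert : ∀ t p, (¬ β.Flat s t ∨ (p ≠ left (β.get t).1 ∧ p ≠ right (β.get t).1)) →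
      R (β.arc t.castSucc p) (β.arc t.succ p))
    (hcap : ∀ t, β.Flat s t → R (β.arc t.castSucc (left (β.get t).1))
      (β.arc t.castSucc (right (β.get t).1)))
    (hcup : ∀ t, β.Flat s t → R (β.arc t.succ (left (β.get t).1))
      (β.arc t.succ (right (β.get t).1)))
    (hclose : ∀ p, R (β.arc (Fin.last _) p) (β.arc 0 p))
    {x y : β.closure.Arc} (h : β.closure.Joined s x y) : R x y := by
  cases h with
  | joint h =>
    rcases h with ⟨t, p, h1, h2, rfl, rfl⟩ | ⟨p, rfl, rfl⟩
    · exact hvert t p (Or.inr ⟨h1, h2⟩)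
    · exact hclose p
  | a_zero_one t h =>
    change R (β.closure.ends (β.crossing t) 0) (β.closure.ends (β.crossing t) 1)
    change s (β.crossing t) = Marker.A at h
    by_cases hε : (β.get t).2 = 1
    · rw [ends_pos hε]
      exact hvert t _ (Or.inl fun hf => by simp [Flat, hε, h] at hf)
    · rw [ends_neg hε]
      exact hcap t (Or.inr ⟨hε, h⟩)
  | a_two_three t h =>
    change R (β.closure.ends (β.crossing t) 2) (β.closure.ends (β.crossing t) 3)
    change s (β.crossing t) = Marker.A at h
    by_cases hε : (β.get t).2 = 1
    · rw [ends_pos hε]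
      exact hsymm _ _ (hvert t _ (Or.inl fun hf => by simp [Flat, hε, h] at hf))
    · rw [ends_neg hε]
      exact hsymm _ _ (hcup t (Or.inr ⟨hε, h⟩))
  | b_zero_three t h =>
    change R (β.closure.ends (β.crossing t) 0) (β.closure.ends (β.crossing t) 3)
    change s (β.crossing t) = Marker.B at h
    by_cases hε : (β.get t).2 = 1
    · rw [ends_pos hε]
      exact hsymm _ _ (hcap t (Or.inl ⟨hε, h⟩))
    · rw [ends_neg hε]
      exact hvert t _ (Or.inl fun hf => by simp [Flat, hε, h] at hf)
  | b_one_two t h =>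
    change R (β.closure.ends (β.crossing t) 1) (β.closure.ends (β.crossing t) 2)
    change s (β.crossing t) = Marker.B at h
    by_cases hε : (β.get t).2 = 1
    · rw [ends_pos hε]
      exact hsymm _ _ (hcup t (Or.inl ⟨hε, h⟩))
    · rw [ends_neg hε]
      exact hvert t _ (Or.inl fun hf => by simp [Flat, hε, h] at hf)

theorem not_flat_iff {s : β.closure.State} {t : Fin β.length} : ¬ β.Flat s t ↔
    ((β.get t).2 = 1 ∧ s (β.crossing t) = Marker.A) ∨
      ((β.get t).2 ≠ 1 ∧ s (β.crossing t) = Marker.B) := by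
  unfold Flat
  rcases s (β.crossing t) with _ | _ <;> by_cases h : (β.get t).2 = 1 <;> simp

theorem same_vert {s : β.closure.State} {t : Fin β.length} {p : Fin m}
    (h : ¬ β.Flat s t ∨ (p ≠ left (β.get t).1 ∧ p ≠ right (β.get t).1)) :
    Same s (β.arc t.castSucc p) (β.arc t.succ p) := by
  by_cases hp : p ≠ left (β.get t).1 ∧ p ≠ right (β.get t).1
  · exact Same.of_joined (.joint (Or.inl ⟨t, p, hp.1, hp.2, rfl, rfl⟩))
  have hp' : p = left (β.get t).1 ∨ p = right (β.get t).1 := by tauto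
  rcases not_flat_iff.1 (h.resolve_right hp) with ⟨hε, hs⟩ | ⟨hε, hs⟩
  · have h1 := Same.of_joined (Joined.a_zero_one (D := β.closure) (β.crossing t) hs)
    have h2 := Same.of_joined (Joined.a_two_three (D := β.closure) (β.crossing t) hs)
    rw [ends_pos hε] at h1 h2
    rcases hp' with rfl | rfl
    · exact h2.symm
    · exact h1
  · have h1 := Same.of_joined (Joined.b_zero_three (D := β.closure) (β.crossing t) hs)
    have h2 := Same.of_joined (Joined.b_one_two (D := β.closure) (β.crossing t) hs)
    rw [ends_neg hε] at h1 h2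
    rcases hp' with rfl | rfl
    · exact h1
    · exact h2

theorem same_cap {s : β.closure.State} {t : Fin β.length} (h : β.Flat s t) :
    Same s (β.arc t.castSucc (left (β.get t).1)) (β.arc t.castSucc (right (β.get t).1)) := by
  rcases h with ⟨hε, hs⟩ | ⟨hε, hs⟩
  · have h1 := Same.of_joined (Joined.b_zero_three (D := β.closure) (β.crossing t) hs)
    rw [ends_pos hε] at h1
    exact h1.symm
  · have h1 := Same.of_joined (Joined.a_zero_one (D := β.closure) (β.crossing t) hs)
    rw [ends_neg hε] at h1
    exact h1

theorem same_cup {s : β.closure.State} {t : Fin β.length} (h : β.Flat s t) :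
    Same s (β.arc t.succ (left (β.get t).1)) (β.arc t.succ (right (β.get t).1)) := by
  rcases h with ⟨hε, hs⟩ | ⟨hε, hs⟩
  · have h1 := Same.of_joined (Joined.b_one_two (D := β.closure) (β.crossing t) hs)
    rw [ends_pos hε] at h1
    exact h1.symm
  · have h1 := Same.of_joined (Joined.a_two_three (D := β.closure) (β.crossing t) hs)
    rw [ends_neg hε] at h1
    exact h1.symm

theorem same_close (s : β.closure.State) (p : Fin m) :
    Same s (β.arc (Fin.last _) p) (β.arc 0 p) :=
  Same.of_joined (.joint (Or.inr ⟨p, rfl, rfl⟩))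

open Classical in
/-- The even one of the two positions at a letter. -/
def evenPos (i : Fin (m - 1)) : Fin m := if Even i.1 then left i else right i

open Classical in
/-- The odd one of the two positions at a letter. -/
def oddPos (i : Fin (m - 1)) : Fin m := if Even i.1 then right i else left i

theorem even_evenPos (i : Fin (m - 1)) : Even (evenPos i).1 := by
  unfold evenPos
  split_ifs with h
  · exact h
  · exact (Nat.not_even_iff_odd.1 h).add_one

theorem not_even_oddPos (i : Fin (m - 1)) : ¬ Even (oddPos i).1 := by
  unfold oddPos
  split_ifs with h
  · exact Nat.not_even_iff_odd.2 h.add_one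
  · exact h

theorem pos_cases (i : Fin (m - 1)) : (evenPos i = left i ∧ oddPos i = right i) ∨
    (evenPos i = right i ∧ oddPos i = left i) := by
  unfold evenPos oddPos
  split_ifs
  · exact Or.inl ⟨rfl, rfl⟩
  · exact Or.inr ⟨rfl, rfl⟩

theorem eq_pos_iff {i : Fin (m - 1)} {p : Fin m} :
    (p = evenPos i ∨ p = oddPos i) ↔ (p = left i ∨ p = right i) := by
  rcases pos_cases i with ⟨h1, h2⟩ | ⟨h1, h2⟩ <;> rw [h1, h2]
  exact or_comm

variable (β)

/-- The two arcs which end at a letter when the even positions are oriented upwards and the odd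
positions downwards. -/
def inArc : Fin β.length × Bool ↪ β.closure.Arc where
  toFun x := if x.2 then β.arc x.1.succ (oddPos (β.get x.1).1) else
    β.arc x.1.castSucc (evenPos (β.get x.1).1)
  inj' := by
    rintro ⟨t, b⟩ ⟨t', b'⟩ h
    cases b <;> cases b'
    · obtain rfl : t = t' := Fin.castSucc_injective _ (Prod.mk.inj h).1
      rfl
    · have := (Prod.mk.inj h).2
      exact (not_even_oddPos _ (this ▸ even_evenPos _)).elim
    · have := (Prod.mk.inj h).2
      exact (not_even_oddPos _ (this ▸ even_evenPos _)).elim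
    · obtain rfl : t = t' := Fin.succ_injective _ (Prod.mk.inj h).1
      rfl

open Classical in
/-- The permutation of the letters and arc ends which exchanges the ends at the flat letters. -/
def flipFlat (s : β.closure.State) : Equiv.Perm (Fin β.length × Bool) :=
  Function.Involutive.toPerm (fun x => (x.1, if β.Flat s x.1 then !x.2 else x.2)) fun x => by
    by_cases h : β.Flat s x.1 <;> simp [h]

/-- The move by one height along every vertical strand, upwards at the even and downwards at the odd positions. -/
def step : Equiv.Perm β.closure.Arc where
  toFun x := if Even x.2.1 then β.arc (x.1 + 1) x.2 else β.arc (x.1 - 1) x.2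
  invFun x := if Even x.2.1 then β.arc (x.1 - 1) x.2 else β.arc (x.1 + 1) x.2
  left_inv x := by by_cases h : Even x.2.1 <;> simp [h] <;> rfl
  right_inv x := by by_cases h : Even x.2.1 <;> simp [h] <;> rfl

/-- The permutation of the arcs whose cycles are the circles of the state. -/
def next (s : β.closure.State) : Equiv.Perm β.closure.Arc :=
  β.step * (β.flipFlat s).viaEmbedding β.inArc

variable {β}

theorem viaEmbedding_inArc (s : β.closure.State) (t : Fin β.length) (b : Bool)
    [Decidable (β.Flat s t)] :
    (β.flipFlat s).viaEmbedding β.inArc (β.inArc (t, b)) =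
      β.inArc (t, if β.Flat s t then !b else b) := by
  rw [Equiv.Perm.viaEmbedding_apply]
  refine congrArg β.inArc (Prod.ext rfl ?_)
  change @ite _ _ (Classical.propDecidable _) _ _ = _
  congr

theorem viaEmbedding_eq_self (s : β.closure.State) {x : β.closure.Arc}
    (h : ∀ t b, x = β.inArc (t, b) → ¬ β.Flat s t) :
    (β.flipFlat s).viaEmbedding β.inArc x = x := by
  classical
  by_cases hx : x ∈ Set.range β.inArc
  · obtain ⟨⟨t, b⟩, rfl⟩ := hx
    rw [viaEmbedding_inArc, if_neg (h t b rfl)]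
  · exact Equiv.Perm.viaEmbedding_apply_of_notMem _ _ _ hx

theorem inArc_false (t : Fin β.length) :
    β.inArc (t, false) = β.arc t.castSucc (evenPos (β.get t).1) := rfl

theorem inArc_true (t : Fin β.length) :
    β.inArc (t, true) = β.arc t.succ (oddPos (β.get t).1) := rfl

theorem step_even {p : Fin m} (hp : Even p.1) (r : Fin (β.length + 1)) :
    β.step (β.arc r p) = β.arc (r + 1) p := if_pos hp

theorem step_odd {p : Fin m} (hp : ¬ Even p.1) (r : Fin (β.length + 1)) :
    β.step (β.arc r p) = β.arc (r - 1) p := if_neg hp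

theorem castSucc_add_one' (t : Fin β.length) : t.castSucc + 1 = t.succ := Fin.coeSucc_eq_succ

theorem succ_sub_one' (t : Fin β.length) : t.succ - 1 = t.castSucc := by
  rw [← castSucc_add_one', add_sub_cancel_right]

theorem next_cap {s : β.closure.State} {t : Fin β.length} (h : β.Flat s t) :
    β.next s (β.arc t.castSucc (evenPos (β.get t).1)) =
      β.arc t.castSucc (oddPos (β.get t).1) := by
  classical
  rw [next, Equiv.Perm.mul_apply, ← inArc_false, viaEmbedding_inArc, if_pos h, Bool.not_false,
    inArc_true, step_odd (not_even_oddPos _), succ_sub_one']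

theorem next_cup {s : β.closure.State} {t : Fin β.length} (h : β.Flat s t) :
    β.next s (β.arc t.succ (oddPos (β.get t).1)) = β.arc t.succ (evenPos (β.get t).1) := by
  classical
  rw [next, Equiv.Perm.mul_apply, ← inArc_true, viaEmbedding_inArc, if_pos h, Bool.not_true,
    inArc_false, step_even (even_evenPos _), castSucc_add_one']

theorem next_up {s : β.closure.State} {r : Fin (β.length + 1)} {p : Fin m} (hp : Even p.1)
    (h : ∀ t : Fin β.length, r = t.castSucc → ¬ β.Flat s t ∨
      (p ≠ left (β.get t).1 ∧ p ≠ right (β.get t).1)) :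
    β.next s (β.arc r p) = β.arc (r + 1) p := by
  rw [next, Equiv.Perm.mul_apply, viaEmbedding_eq_self, step_even hp]
  rintro t b htb hf
  cases b
  · have h1 := h t (Prod.mk.inj htb).1
    have h2 := eq_pos_iff.1 (Or.inl (Prod.mk.inj htb).2)
    tauto
  · exact not_even_oddPos _ ((Prod.mk.inj htb).2 ▸ hp)

theorem next_down {s : β.closure.State} {r : Fin (β.length + 1)} {p : Fin m} (hp : ¬ Even p.1)
    (h : ∀ t : Fin β.length, r = t.succ → ¬ β.Flat s t ∨
      (p ≠ left (β.get t).1 ∧ p ≠ right (β.get t).1)) :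
    β.next s (β.arc r p) = β.arc (r - 1) p := by
  rw [next, Equiv.Perm.mul_apply, viaEmbedding_eq_self, step_odd hp]
  rintro t b htb hf
  cases b
  · exact hp ((Prod.mk.inj htb).2 ▸ even_evenPos _)
  · have h1 := h t (Prod.mk.inj htb).1
    have h2 := eq_pos_iff.1 (Or.inr (Prod.mk.inj htb).2)
    tauto

theorem same_cap' {s : β.closure.State} {t : Fin β.length} (h : β.Flat s t) :
    Same s (β.arc t.castSucc (evenPos (β.get t).1)) (β.arc t.castSucc (oddPos (β.get t).1)) := by
  rcases pos_cases (β.get t).1 with ⟨h1, h2⟩ | ⟨h1, h2⟩ <;> rw [h1, h2]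
  · exact same_cap h
  · exact (same_cap h).symm

theorem same_cup' {s : β.closure.State} {t : Fin β.length} (h : β.Flat s t) :
    Same s (β.arc t.succ (oddPos (β.get t).1)) (β.arc t.succ (evenPos (β.get t).1)) := by
  rcases pos_cases (β.get t).1 with ⟨h1, h2⟩ | ⟨h1, h2⟩ <;> rw [h1, h2]
  · exact (same_cup h).symm
  · exact same_cup h

theorem same_next (s : β.closure.State) (x : β.closure.Arc) : Same s x (β.next s x) := by
  obtain ⟨r, p⟩ := x
  change Same s (β.arc r p) (β.next s (β.arc r p))
  by_cases hp : Even p.1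
  · by_cases h : ∀ t : Fin β.length, r = t.castSucc → ¬ β.Flat s t ∨
      (p ≠ left (β.get t).1 ∧ p ≠ right (β.get t).1)
    · rw [next_up hp h]
      induction r using Fin.lastCases with
      | last => rw [Fin.last_add_one]; exact same_close s p
      | cast t => rw [castSucc_add_one']; exact same_vert (h t rfl)
    · push Not at h
      obtain ⟨t, rfl, hf, h'⟩ := h
      have h1 : p = evenPos (β.get t).1 :=
        (eq_pos_iff.2 (or_iff_not_imp_left.2 h')).resolve_right fun h => not_even_oddPos _ (h ▸ hp)
      rw [h1, next_cap hf]
      exact same_cap' hf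
  · by_cases h : ∀ t : Fin β.length, r = t.succ → ¬ β.Flat s t ∨
      (p ≠ left (β.get t).1 ∧ p ≠ right (β.get t).1)
    · rw [next_down hp h]
      induction r using Fin.cases with
      | zero => rw [← Fin.last_add_one, add_sub_cancel_right, Fin.last_add_one]; exact (same_close s p).symm
      | succ t => rw [succ_sub_one']; exact (same_vert (h t rfl)).symm
    · push Not at h
      obtain ⟨t, rfl, hf, h'⟩ := h
      have h1 : p = oddPos (β.get t).1 :=
        (eq_pos_iff.2 (or_iff_not_imp_left.2 h')).resolve_left fun h => hp (h ▸ even_evenPos _)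
      rw [h1, next_cup hf]
      exact same_cup' hf

theorem sameCycle_next_iff {s : β.closure.State} {x y : β.closure.Arc} :
    (β.next s).SameCycle x y ↔ Same s x y := by
  constructor
  · intro h
    obtain ⟨i, -, -, rfl⟩ := h.exists_pow_eq''
    clear h
    induction i with
    | zero => exact Same.refl _ _
    | succ i ih =>
      rw [pow_succ', Equiv.Perm.mul_apply]
      exact ih.trans (same_next s _)
  · have hstep : ∀ {x y}, β.next s x = y → (β.next s).SameCycle x y := fun h =>
      ⟨1, by rw [zpow_one, h]⟩
    intro h
    have key : ∀ x y, β.closure.Joined s x y → (β.next s).SameCycle x y := by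
      intro x y
      refine joined_cases (R := (β.next s).SameCycle) (fun _ _ h => h.symm) ?_ ?_ ?_ ?_
      · intro t p h
        by_cases hp : Even p.1
        · refine hstep ?_
          rw [next_up hp fun t' ht => Fin.castSucc_injective _ ht ▸ h, castSucc_add_one']
        · refine (hstep ?_).symm
          rw [next_down hp fun t' ht => Fin.succ_injective _ ht ▸ h, succ_sub_one']
      · intro t h
        rcases pos_cases (β.get t).1 with ⟨h1, h2⟩ | ⟨h1, h2⟩ <;> rw [← h1, ← h2]
        · exact hstep (next_cap h)
        · exact (hstep (next_cap h)).symm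
      · intro t h
        rcases pos_cases (β.get t).1 with ⟨h1, h2⟩ | ⟨h1, h2⟩ <;> rw [← h1, ← h2]
        · exact (hstep (next_cup h)).symm
        · exact hstep (next_cup h)
      · intro p
        by_cases hp : Even p.1
        · refine hstep ?_
          rw [next_up hp fun t ht => (Fin.castSucc_ne_last t ht.symm).elim, Fin.last_add_one]
        · refine (hstep ?_).symm
          rw [next_down hp fun t ht => (Fin.succ_ne_zero t ht.symm).elim, ← Fin.last_add_one,
            add_sub_cancel_right]
    have h2 : (Quotient.mk (Equiv.Perm.SameCycle.setoid (β.next s)) x) =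
        Quotient.mk (Equiv.Perm.SameCycle.setoid (β.next s)) y :=
      Same.map (Quotient.mk (Equiv.Perm.SameCycle.setoid (β.next s)))
        (fun x y hxy => Quotient.sound (key x y hxy)) h
    exact Quotient.exact h2

theorem same_one_three {D : Diagram} (s : D.State) (v : D.Crossing) :
    Same s (D.ends v 1) (D.ends v 3) ↔ Same s (D.ends v 0) (D.ends v 2) := by
  rcases h : s v with _ | _
  · have h1 := Same.of_joined (.a_zero_one v h)
    have h2 := Same.of_joined (.a_two_three v h)
    exact ⟨fun h => h1.trans (h.trans h2.symm), fun h => h1.symm.trans (h.trans h2)⟩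
  · have h1 := Same.of_joined (.b_zero_three v h)
    have h2 := Same.of_joined (.b_one_two v h)
    exact ⟨fun h => h1.trans (h.symm.trans h2), fun h => h2.trans (h.symm.trans h1)⟩

theorem same_inArc_iff (s : β.closure.State) (t : Fin β.length) :
    Same s (β.inArc (t, false)) (β.inArc (t, true)) ↔
      Same s (β.closure.ends (β.crossing t) 0) (β.closure.ends (β.crossing t) 2) := by
  rw [inArc_false, inArc_true]
  by_cases hε : (β.get t).2 = 1 <;>
    rcases pos_cases (β.get t).1 with ⟨h1, h2⟩ | ⟨h1, h2⟩ <;> rw [h1, h2]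
  · rw [← same_one_three, ends_pos hε]; exact ⟨Same.symm, Same.symm⟩
  · rw [ends_pos hε]; rfl
  · rw [ends_neg hε]; rfl
  · rw [← same_one_three, ends_neg hε]; rfl

theorem next_update {s : β.closure.State} {t : Fin β.length} (h : s (β.crossing t) = Marker.A)
    [DecidableEq β.closure.Arc] :
    β.next (Function.update s (β.crossing t) Marker.B) =
      β.next s * Equiv.swap (β.inArc (t, false)) (β.inArc (t, true)) := by
  classical
  have hflat : β.Flat (Function.update s (β.crossing t) Marker.B) t ↔ ¬ β.Flat s t := by
    rw [not_flat_iff, Flat, Function.update_self, h]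
    by_cases hε : (β.get t).2 = 1 <;> simp
  have hflat' : ∀ w, w ≠ t → (β.Flat (Function.update s (β.crossing t) Marker.B) w ↔ β.Flat s w) := by
    intro w hw
    rw [Flat, Flat, Function.update_of_ne (show β.crossing w ≠ β.crossing t from hw)]
  rw [next, next, mul_assoc]
  congr 1
  ext1 x
  rw [Equiv.Perm.mul_apply]
  by_cases hx : x ∈ Set.range β.inArc
  · obtain ⟨⟨w, b⟩, rfl⟩ := hx
    by_cases hw : w = t
    · subst hw
      cases b
      · rw [Equiv.swap_apply_left, viaEmbedding_inArc, viaEmbedding_inArc]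
        by_cases hf : β.Flat s w <;> simp [hflat, hf]
      · rw [Equiv.swap_apply_right, viaEmbedding_inArc, viaEmbedding_inArc]
        by_cases hf : β.Flat s w <;> simp [hflat, hf]
    · have hne : ∀ b', β.inArc (w, b) ≠ β.inArc (t, b') := fun b' h' =>
        hw (Prod.mk.inj (β.inArc.injective h')).1
      rw [Equiv.swap_apply_of_ne_of_ne (hne _) (hne _), viaEmbedding_inArc, viaEmbedding_inArc]
      simp [hflat' w hw]
  · have hne : ∀ y, x ≠ β.inArc y := fun y h' => hx ⟨y, h'.symm⟩
    rw [Equiv.swap_apply_of_ne_of_ne (hne _) (hne _),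
      Equiv.Perm.viaEmbedding_apply_of_notMem _ _ _ hx,
      Equiv.Perm.viaEmbedding_apply_of_notMem _ _ _ hx]

theorem same_ends_iff_update {s : β.closure.State} {t : Fin β.length}
    (hs : s (β.crossing t) = Marker.A) :
    Same s (β.closure.ends (β.crossing t) 0) (β.closure.ends (β.crossing t) 2) ↔
    ¬ Same (Function.update s (β.crossing t) Marker.B) (β.closure.ends (β.crossing t) 0)
      (β.closure.ends (β.crossing t) 2) := by
  classical
  rw [← same_inArc_iff, ← same_inArc_iff, ← sameCycle_next_iff, ← sameCycle_next_iff,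
    next_update hs]
  exact sameCycle_mul_swap_iff fun h => by
    have := (Prod.mk.inj (β.inArc.injective h)).2
    cases this

theorem coherent_closure (β : BraidWord m) : β.closure.Coherent :=
  fun _ _ hs => same_ends_iff_update hs

end BraidWord

namespace BraidWord

open Diagram

variable {m : ℕ} {β : BraidWord m}

/-- The set of arcs whose heights and positions lie in `K`. -/
def arcSet (K : Set (ℕ × ℕ)) : Set β.closure.Arc :=
  {x : Fin (β.length + 1) × Fin m | ((x.1 : ℕ), (x.2 : ℕ)) ∈ K}

/-- For all states with the property `Q`, the arcs in `K` form an arc of a circle which lies below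
the height `t` and ends there at the positions `i` and `i + 1`. -/
structure IsCap (Q : β.closure.State → Prop) (t i : ℕ) (K : Set (ℕ × ℕ)) : Prop where
  mem : ∀ p, p = i ∨ p = i + 1 → (t, p) ∈ K
  pos : ∀ r p, (r, p) ∈ K → p = i ∨ p = i + 1
  height : ∀ r p, (r, p) ∈ K → r ≤ t ∨ r = β.length
  conn : ∀ s, Q s → ∀ x ∈ arcSet (β := β) K, ∀ y ∈ arcSet (β := β) K, Same s x y
  vert : ∀ s, Q s → ∀ r : Fin β.length, r.1 ≠ t → ∀ p : Fin m,
    (¬ β.Flat s r ∨ (p ≠ left (β.get r).1 ∧ p ≠ right (β.get r).1)) →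
    ((r.1, p.1) ∈ K ↔ (r.1 + 1, p.1) ∈ K)
  flat : ∀ s, Q s → ∀ r : Fin β.length, r.1 ≠ t → β.Flat s r →
    ((r.1, (β.get r).1.1) ∈ K ↔ (r.1, (β.get r).1.1 + 1) ∈ K) ∧
    ((r.1 + 1, (β.get r).1.1) ∈ K ↔ (r.1 + 1, (β.get r).1.1 + 1) ∈ K)
  close : ∀ p : Fin m, (β.length, p.1) ∈ K ↔ (0, p.1) ∈ K

/-- The letter `t` does not involve the positions `i` and `i + 1`. -/
def Apart (β : BraidWord m) (t : Fin β.length) (i : ℕ) : Prop :=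
  (β.get t).1.1 ≠ i ∧ (β.get t).1.1 + 1 ≠ i ∧ (β.get t).1.1 ≠ i + 1

theorem ne_pos_iff {j : Fin (m - 1)} {p : Fin m} :
    (p ≠ left j ∧ p ≠ right j) ↔ p.1 ≠ j.1 ∧ p.1 ≠ j.1 + 1 := by
  simp only [left, right, ne_eq, Fin.ext_iff]

namespace IsCap

variable {Q Q' : β.closure.State → Prop} {t i : ℕ} {K : Set (ℕ × ℕ)}

theorem mono (h : IsCap Q t i K) (hQ : ∀ s, Q' s → Q s) : IsCap Q' t i K where
  mem := h.mem
  pos := h.pos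
  height := h.height
  conn s hs := h.conn s (hQ s hs)
  vert s hs := h.vert s (hQ s hs)
  flat s hs := h.flat s (hQ s hs)
  close := h.close

theorem extend (h : IsCap Q t i K) (ht : t + 1 < β.length)
    (hl : ∀ s, Q s → ¬ β.Flat s ⟨t, Nat.lt_of_succ_lt ht⟩ ∨ β.Apart ⟨t, Nat.lt_of_succ_lt ht⟩ i) :
    IsCap Q (t + 1) i (K ∪ {x | x.1 = t + 1 ∧ (x.2 = i ∨ x.2 = i + 1)}) where
  mem p hp := Or.inr ⟨rfl, hp⟩
  pos r p := by
    rintro (hr | ⟨-, hr⟩)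
    · exact h.pos r p hr
    · exact hr
  height r p := by
    rintro (hr | ⟨hr, -⟩)
    · have := h.height r p hr; omega
    · exact Or.inl (le_of_eq hr)
  conn s hs := by
    have key : ∀ x ∈ arcSet (β := β) (K ∪ {x | x.1 = t + 1 ∧ (x.2 = i ∨ x.2 = i + 1)}),
        ∃ y ∈ arcSet (β := β) K, Same s x y := by
      rintro ⟨r, p⟩ (hx | ⟨hr, hp⟩)
      · exact ⟨_, hx, Same.refl _ _⟩
      · have hr' : r = Fin.succ ⟨t, Nat.lt_of_succ_lt ht⟩ := Fin.ext hr
        subst hr'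
        refine ⟨β.arc (Fin.castSucc ⟨t, Nat.lt_of_succ_lt ht⟩) p, h.mem p.1 hp,
          (same_vert ((hl s hs).imp_right fun ha => ne_pos_iff.2 ?_)).symm⟩
        obtain ⟨h1, h2, h3⟩ := ha
        dsimp only at hp
        constructor <;> omega
    intro x hx y hy
    obtain ⟨x', hx', hxx⟩ := key x hx
    obtain ⟨y', hy', hyy⟩ := key y hy
    exact hxx.trans ((h.conn s hs x' hx' y' hy').trans hyy.symm)
  vert s hs r hr p hp := by
    simp only [Set.mem_union, Set.mem_ofPred_eq]
    by_cases hrt : r.1 = t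
    · have h1 : ¬ ((t + 1, p.1) ∈ K) := fun h' => by
        have := h.height _ _ h'; omega
      rw [hrt]
      by_cases hpi : p.1 = i ∨ p.1 = i + 1
      · simp [h.mem _ hpi, hpi]
      · have h2 : ¬ ((t, p.1) ∈ K) := fun h' => hpi (h.pos _ _ h')
        simp [h1, h2, hpi]
    · rw [h.vert s hs r hrt p hp]
      have h1 : ¬ r.1 + 1 = t + 1 := by omega
      simp [hr, hrt]
  flat s hs r hr hf := by
    simp only [Set.mem_union, Set.mem_ofPred_eq]
    by_cases hrt : r.1 = t
    · obtain rfl : r = ⟨t, Nat.lt_of_succ_lt ht⟩ := Fin.ext hrt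
      obtain ⟨a1, a2, a3⟩ := (hl s hs).resolve_left (not_not.2 hf)
      have h1 : ∀ r, ¬ ((r, (β.get ⟨t, Nat.lt_of_succ_lt ht⟩).1.1) ∈ K) := fun r h' => by
        have := h.pos _ _ h'; omega
      have h2 : ∀ r, ¬ ((r, (β.get ⟨t, Nat.lt_of_succ_lt ht⟩).1.1 + 1) ∈ K) := fun r h' => by
        have := h.pos _ _ h'; omega
      simp only [h1, h2, false_or]
      omega
    · have h1 := h.flat s hs r hrt hf
      rw [h1.1, h1.2]
      simp [hr, hrt]
  close p := by
    simp only [Set.mem_union, Set.mem_ofPred_eq]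
    rw [h.close p]
    have : β.length ≠ t + 1 := by omega
    simp [this]

theorem of_flat (ht : t + 1 < β.length) (hi : (β.get ⟨t, Nat.lt_of_succ_lt ht⟩).1.1 = i)
    (hl : ∀ s, Q s → β.Flat s ⟨t, Nat.lt_of_succ_lt ht⟩) :
    IsCap Q (t + 1) i {x | x.1 = t + 1 ∧ (x.2 = i ∨ x.2 = i + 1)} where
  mem p hp := ⟨rfl, hp⟩
  pos r p hr := hr.2
  height r p hr := Or.inl (le_of_eq hr.1)
  conn s hs := by
    have key : ∀ x ∈ arcSet (β := β) {x | x.1 = t + 1 ∧ (x.2 = i ∨ x.2 = i + 1)},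
        Same s x (β.arc (Fin.succ ⟨t, Nat.lt_of_succ_lt ht⟩) (left (β.get ⟨t, Nat.lt_of_succ_lt ht⟩).1)) := by
      rintro ⟨r, p⟩ ⟨hr, hp⟩
      have hr' : r = Fin.succ ⟨t, Nat.lt_of_succ_lt ht⟩ := Fin.ext hr
      subst hr'
      rcases hp with hp | hp
      · rw [show p = left (β.get ⟨t, Nat.lt_of_succ_lt ht⟩).1 from Fin.ext (hp.trans hi.symm)]
        exact Same.refl _ _
      · rw [show p = right (β.get ⟨t, Nat.lt_of_succ_lt ht⟩).1 from
          Fin.ext (hp.trans (by rw [← hi]; rfl))]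
        exact (same_cup (hl s hs)).symm
    intro x hx y hy
    exact (key x hx).trans (key y hy).symm
  vert s hs r hr p hp := by
    simp only [Set.mem_ofPred_eq]
    by_cases hrt : r.1 = t
    · obtain rfl : r = ⟨t, Nat.lt_of_succ_lt ht⟩ := Fin.ext hrt
      have := ne_pos_iff.1 (hp.resolve_left (not_not.2 (hl s hs)))
      rw [hi] at this
      omega
    · omega
  flat s hs r hr hf := by
    simp only [Set.mem_ofPred_eq]
    by_cases hrt : r.1 = t
    · obtain rfl : r = ⟨t, Nat.lt_of_succ_lt ht⟩ := Fin.ext hrt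
      rw [hi]
      simp
    · omega
  close p := by
    simp only [Set.mem_ofPred_eq]; omega

theorem of_last (hL : 2 ≤ β.length) (hi : (β.get ⟨β.length - 1, Nat.sub_one_lt_of_lt hL⟩).1.1 = i)
    (hl : ∀ s, Q s → β.Flat s ⟨β.length - 1, Nat.sub_one_lt_of_lt hL⟩) :
    IsCap Q 0 i {x | (x.1 = β.length ∨ x.1 = 0) ∧ (x.2 = i ∨ x.2 = i + 1)} where
  mem p hp := ⟨Or.inr rfl, hp⟩
  pos r p hr := hr.2
  height r p hr := hr.1.symm.imp le_of_eq id
  conn s hs := by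
    have hlast : Fin.last β.length = Fin.succ ⟨β.length - 1, Nat.sub_one_lt_of_lt hL⟩ :=
      Fin.ext (by simp; omega)
    have key : ∀ x ∈ arcSet (β := β) {x | (x.1 = β.length ∨ x.1 = 0) ∧ (x.2 = i ∨ x.2 = i + 1)},
        Same s x (β.arc (Fin.last _) (left (β.get ⟨β.length - 1, Nat.sub_one_lt_of_lt hL⟩).1)) := by
      rintro ⟨r, p⟩ ⟨hr, hp⟩
      have h1 : Same s (β.arc r p) (β.arc (Fin.last _) p) := by
        rcases hr with hr | hr
        · rw [show r = Fin.last _ from Fin.ext hr]; exact Same.refl _ _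
        · rw [show r = 0 from Fin.ext hr]; exact (same_close s p).symm
      refine h1.trans ?_
      rcases hp with hp | hp
      · rw [show p = left (β.get ⟨β.length - 1, Nat.sub_one_lt_of_lt hL⟩).1 from Fin.ext (hp.trans hi.symm)]
        exact Same.refl _ _
      · rw [show p = right (β.get ⟨β.length - 1, Nat.sub_one_lt_of_lt hL⟩).1 from
          Fin.ext (hp.trans (by rw [← hi]; rfl)), hlast]
        exact (same_cup (hl s hs)).symm
    intro x hx y hy
    exact (key x hx).trans (key y hy).symm
  vert s hs r hr p hp := by
    simp only [Set.mem_ofPred_eq]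
    have := r.2
    by_cases hrt : r.1 = β.length - 1
    · obtain rfl : r = ⟨β.length - 1, Nat.sub_one_lt_of_lt hL⟩ := Fin.ext hrt
      have := ne_pos_iff.1 (hp.resolve_left (not_not.2 (hl s hs)))
      rw [hi] at this
      omega
    · omega
  flat s hs r hr hf := by
    simp only [Set.mem_ofPred_eq]
    have := r.2
    by_cases hrt : r.1 = β.length - 1
    · obtain rfl : r = ⟨β.length - 1, Nat.sub_one_lt_of_lt hL⟩ := Fin.ext hrt
      rw [hi]
      simp
    · omega
  close p := by
    simp

/-- A cap which is closed by a cup at the letter `t` is a circle. -/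
theorem mem_iff (h : IsCap Q t i K) (ht : t < β.length) (hK : ∀ p, (t + 1, p) ∉ K)
    (hi : (β.get ⟨t, ht⟩).1.1 = i) {s : β.closure.State} (hs : Q s) (hf : β.Flat s ⟨t, ht⟩)
    {x y : β.closure.Arc} (hxy : Same s x y) :
    x ∈ arcSet (β := β) K ↔ y ∈ arcSet (β := β) K := by
  refine iff_of_eq (Same.map (fun x => x ∈ arcSet (β := β) K) (fun x y hj => ?_) hxy)
  refine propext ?_
  refine joined_cases (R := fun x y => x ∈ arcSet (β := β) K ↔ y ∈ arcSet (β := β) K)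
    (fun _ _ => Iff.symm) (fun r p hp => ?_) (fun r hr => ?_) (fun r hr => ?_) (fun p => ?_) hj
  · change (r.1, p.1) ∈ K ↔ (r.1 + 1, p.1) ∈ K
    by_cases hrt : r.1 = t
    · obtain rfl : r = ⟨t, ht⟩ := Fin.ext hrt
      have h1 := ne_pos_iff.1 (hp.resolve_left (not_not.2 hf))
      rw [hi] at h1
      exact iff_of_false (fun h' => by have := h.pos _ _ h'; omega) (hK _)
    · exact h.vert s hs r hrt p hp
  · change (r.1, (β.get r).1.1) ∈ K ↔ (r.1, (β.get r).1.1 + 1) ∈ K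
    by_cases hrt : r.1 = t
    · obtain rfl : r = ⟨t, ht⟩ := Fin.ext hrt
      rw [hi]
      exact iff_of_true (h.mem _ (Or.inl rfl)) (h.mem _ (Or.inr rfl))
    · exact (h.flat s hs r hrt hr).1
  · change (r.1 + 1, (β.get r).1.1) ∈ K ↔ (r.1 + 1, (β.get r).1.1 + 1) ∈ K
    by_cases hrt : r.1 = t
    · rw [hrt]
      exact iff_of_false (hK _) (hK _)
    · exact (h.flat s hs r hrt hr).2
  · exact h.close p

end IsCap

/-- The two sides of a letter: an arc `y` of a circle contained in `K` meets the letter once if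
exactly one of the ends `0` and `2` is in `K`. -/
theorem meetsOnce_of_mem {K : Set (ℕ × ℕ)} {s : β.closure.State} {y : β.closure.Arc}
    (hconn : ∀ x ∈ arcSet (β := β) K, Same s y x)
    (hK : ∀ x, Same s y x → x ∈ arcSet (β := β) K) {v : β.closure.Crossing}
    (h : (β.closure.ends v 0 ∈ arcSet (β := β) K ∧ β.closure.ends v 2 ∉ arcSet (β := β) K) ∨
      (β.closure.ends v 0 ∉ arcSet (β := β) K ∧ β.closure.ends v 2 ∈ arcSet (β := β) K)) :
    MeetsOnce s y v := by
  rcases h with ⟨h1, h2⟩ | ⟨h1, h2⟩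
  · exact Or.inl ⟨hconn _ h1, fun h' => h2 (hK _ h')⟩
  · exact Or.inr ⟨fun h' => h1 (hK _ h'), hconn _ h2⟩

/-- The heights and positions of the ends at a letter. -/
theorem ends_mem_arcSet {K : Set (ℕ × ℕ)} {t : Fin β.length} {j : Fin 4}
    (h : β.closure.ends (β.crossing t) j ∈ arcSet (β := β) K) :
    ∃ r p, (r, p) ∈ K ∧ (r = t.1 ∨ r = t.1 + 1) ∧
      (p = (β.get t).1.1 ∨ p = (β.get t).1.1 + 1) := by
  by_cases hε : (β.get t).2 = 1
  · rw [ends_pos hε] at h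
    fin_cases j
    · exact ⟨_, _, h, Or.inl rfl, Or.inr rfl⟩
    · exact ⟨_, _, h, Or.inr rfl, Or.inr rfl⟩
    · exact ⟨_, _, h, Or.inr rfl, Or.inl rfl⟩
    · exact ⟨_, _, h, Or.inl rfl, Or.inl rfl⟩
  · rw [ends_neg hε] at h
    fin_cases j
    · exact ⟨_, _, h, Or.inl rfl, Or.inl rfl⟩
    · exact ⟨_, _, h, Or.inl rfl, Or.inr rfl⟩
    · exact ⟨_, _, h, Or.inr rfl, Or.inr rfl⟩
    · exact ⟨_, _, h, Or.inr rfl, Or.inl rfl⟩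

/-- Two letters `v` and `u` of types `i` and `i ± 1` above a cap at `i`, `i + 1`: the cap slides
over the strand. -/
theorem cubeExact_slide {P : β.closure.PartialState} {u v : Fin β.length} {i : ℕ}
    {K : Set (ℕ × ℕ)} (huv : u.1 < v.1) (hvL : v.1 + 1 < β.length)
    (hu : P (β.crossing u) = none) (hv : P (β.crossing v) = none)
    (hεu : (β.get u).2 = 1) (hεv : (β.get v).2 = 1) (hiv : (β.get v).1.1 = i)
    (hiu : (β.get u).1.1 = i + 1 ∨ (β.get u).1.1 + 1 = i)
    (hcap : IsCap (fun s => Extends s P ∧ s (β.crossing u) = Marker.A) v.1 i K)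
    (hmem : ∀ p, p = i ∨ p = i + 1 → (u.1, p) ∈ K ∧ (u.1 + 1, p) ∈ K)
    (hfree : ∀ w : Fin β.length, P (β.crossing w) = none → w ≠ u → w ≠ v →
      (v.1 < w.1 ∧ w.1 + 1 < β.length) ∨ β.Apart w i) {a b : ℤ}
    (h : CubeExact (Function.update (Function.update P (β.crossing u) (some Marker.B))
      (β.crossing v) (some Marker.A)) a b) : CubeExact P a b := by
  have hKv : ∀ p, (v.1 + 1, p) ∉ K := fun p h' => by have := hcap.height _ _ h'; omega
  have him : i + 1 < m := by have := (β.get v).1.2; omega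
  have hclosed : ∀ s, Extends s P → s (β.crossing u) = Marker.A → s (β.crossing v) = Marker.B →
      (∀ x ∈ arcSet (β := β) K, Same s (β.arc v.castSucc ⟨i, by omega⟩) x) ∧
      (∀ x, Same s (β.arc v.castSucc ⟨i, by omega⟩) x → x ∈ arcSet (β := β) K) := by
    intro s hs hsu hsv
    have hy : β.arc v.castSucc ⟨i, by omega⟩ ∈ arcSet (β := β) K := hcap.mem _ (Or.inl rfl)
    exact ⟨fun x hx => hcap.conn s ⟨hs, hsu⟩ _ hy x hx, fun x hx =>
      (hcap.mem_iff v.2 hKv hiv ⟨hs, hsu⟩ (Or.inl ⟨hεv, hsv⟩) hx).1 hy⟩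
  refine CubeExact.slide (coherent_closure β) (u := β.crossing u) (v := β.crossing v)
    (y := β.arc v.castSucc ⟨i, by omega⟩) (fun h' => ?_) hu hv ?_ ?_ ?_ h
  · have : u = v := h'
    rw [this] at huv; omega
  · intro s hs hsu hsv
    obtain ⟨h1, h2⟩ := hclosed s hs hsu hsv
    refine meetsOnce_of_mem h1 h2 ?_
    rw [ends_pos hεu]
    rcases hiu with hiu | hiu
    · refine Or.inr ⟨fun h' => ?_, ?_⟩
      · have : (β.get u).1.1 + 1 = i ∨ (β.get u).1.1 + 1 = i + 1 := hcap.pos _ _ h'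
        omega
      · exact (hmem (β.get u).1.1 (Or.inr hiu)).2
    · refine Or.inl ⟨(hmem ((β.get u).1.1 + 1) (Or.inl hiu)).1, fun h' => ?_⟩
      have : (β.get u).1.1 = i ∨ (β.get u).1.1 = i + 1 := hcap.pos _ _ h'
      omega
  · intro s hs hsu hsv
    obtain ⟨h1, h2⟩ := hclosed s hs hsu hsv
    refine meetsOnce_of_mem h1 h2 (Or.inl ?_)
    rw [ends_pos hεv]
    exact ⟨hcap.mem ((β.get v).1.1 + 1) (Or.inr (by rw [hiv])), hKv _⟩
  · intro s hs hsu hsv w hw hwu hwv j hj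
    obtain ⟨r, p, h1, h2, h3⟩ := ends_mem_arcSet (t := w) ((hclosed s hs hsu hsv).2 _ hj)
    have h4 := hcap.height _ _ h1
    have h5 := hcap.pos _ _ h1
    have h6 : w.1 < β.length := w.2
    rcases hfree w hw hwu hwv with h7 | ⟨h7, h8, h9⟩ <;> omega

/-- A negative letter below a cup of the same type is a kink. -/
theorem cubeExact_kink {P : β.closure.PartialState} {u : Fin β.length}
    (huL : u.1 + 1 < β.length) (hu : P (β.crossing u) = none)
    (hv : P (β.crossing ⟨u.1 + 1, huL⟩) = some Marker.A)
    (hεu : (β.get u).2 ≠ 1) (hεv : (β.get ⟨u.1 + 1, huL⟩).2 ≠ 1)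
    (huv : (β.get u).1.1 = (β.get ⟨u.1 + 1, huL⟩).1.1) {a b : ℤ}
    (h : CubeExact (Function.update P (β.crossing u) (some Marker.A)) a b) : CubeExact P a b := by
  have hcap := IsCap.of_flat (β := β)
    (Q := fun s => Extends s P ∧ s (β.crossing u) = Marker.A) (t := u.1) huL rfl
    (fun s hs => Or.inr ⟨hεu, hs.2⟩)
  set K : Set (ℕ × ℕ) := {x | x.1 = u.1 + 1 ∧ (x.2 = (β.get u).1.1 ∨ x.2 = (β.get u).1.1 + 1)}
  have hclosed : ∀ s, Extends s P → s (β.crossing u) = Marker.A →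
      (∀ x ∈ arcSet (β := β) K, Same s (β.arc u.succ (left (β.get u).1)) x) ∧
      (∀ x, Same s (β.arc u.succ (left (β.get u).1)) x → x ∈ arcSet (β := β) K) := by
    intro s hs hsu
    have hy : β.arc u.succ (left (β.get u).1) ∈ arcSet (β := β) K := hcap.mem _ (Or.inl rfl)
    refine ⟨fun x hx => hcap.conn s ⟨hs, hsu⟩ _ hy x hx, fun x hx =>
      (hcap.mem_iff huL (fun p hp => ?_) huv.symm ⟨hs, hsu⟩
        (Or.inr ⟨hεv, hs _ _ hv⟩) hx).1 hy⟩
    have : u.1 + 1 + 1 = u.1 + 1 := hp.1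
    omega
  refine CubeExact.kink (coherent_closure β) (u := β.crossing u)
    (y := β.arc u.succ (left (β.get u).1)) hu ?_ ?_ h
  · intro s hs hsu
    obtain ⟨h1, h2⟩ := hclosed s hs hsu
    refine meetsOnce_of_mem h1 h2 (Or.inr ?_)
    rw [ends_neg hεu]
    refine ⟨fun h' => ?_, hcap.mem _ (Or.inr rfl)⟩
    have : u.1 = u.1 + 1 := h'.1
    omega
  · intro s hs hsu w hw hwu j hj
    obtain ⟨r, p, h1, h2, h3⟩ := ends_mem_arcSet (t := w) ((hclosed s hs hsu).2 _ hj)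
    have h4 : r = u.1 + 1 := h1.1
    have h6 : w.1 ≠ u.1 := fun h' => hwu (Fin.ext h')
    obtain h5 : w.1 = u.1 + 1 := by omega
    have h7 : w = β.crossing ⟨u.1 + 1, huL⟩ := Fin.ext h5
    rw [h7, hv] at hw
    cases hw

end BraidWord

namespace BraidWord

open Diagram

variable {m : ℕ} {β : BraidWord m}

theorem update_crossing (P : β.closure.PartialState) (u w : Fin β.length) (x : Option Marker) :
    Function.update P (β.crossing u) x (β.crossing w) =
      if w.1 = u.1 then x else P (β.crossing w) := by
  by_cases h : w = u
  · subst h; simp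
  · rw [Function.update_of_ne (show β.crossing w ≠ β.crossing u from h),
      if_neg fun h' => h (Fin.ext h')]

theorem extends_update {D : Diagram} {P : D.PartialState} {u : D.Crossing} (hu : P u = none)
    {m : Marker} {s : D.State} (h : Extends s (Function.update P u (some m))) : Extends s P := by
  intro v m' hv
  refine h v m' ?_
  rw [Function.update_of_ne, hv]
  rintro rfl
  rw [hu] at hv; cases hv

theorem not_flat_of_A {s : β.closure.State} {t : Fin β.length} (hε : (β.get t).2 = 1)
    (hs : s (β.crossing t) = Marker.A) : ¬ β.Flat s t :=
  not_flat_iff.2 (Or.inl ⟨hε, hs⟩)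

theorem flat_of_B {s : β.closure.State} {t : Fin β.length} (hε : (β.get t).2 = 1)
    (hs : s (β.crossing t) = Marker.B) : β.Flat s t :=
  Or.inl ⟨hε, hs⟩

theorem Apart.of_eq {t : Fin β.length} {i j : ℕ} (h : (β.get t).1.1 = j)
    (hij : j ≠ i ∧ j + 1 ≠ i ∧ j ≠ i + 1) : β.Apart t i := by
  unfold Apart; rw [h]; exact hij

/-- The number of crossings which a partial state smooths by `B`. -/
def countB {D : Diagram} (P : D.PartialState) : ℕ :=
  (Finset.univ.filter fun v => P v = some Marker.B).card

theorem countB_update_A {D : Diagram} (P : D.PartialState) (u : D.Crossing) :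
    countB (Function.update P u (some Marker.A)) ≤ countB P := by
  refine Finset.card_le_card fun v hv => ?_
  rw [Finset.mem_filter] at hv ⊢
  refine ⟨hv.1, ?_⟩
  by_cases h : v = u
  · subst h; simp at hv
  · rw [← hv.2, Function.update_of_ne h]

theorem countB_update {D : Diagram} (P : D.PartialState) (u : D.Crossing) (m : Marker) :
    countB (Function.update P u (some m)) ≤ countB P + 1 := by
  refine (Finset.card_le_card (t := insert u (Finset.univ.filter fun v => P v = some Marker.B))
    fun v hv => ?_).trans (Finset.card_insert_le _ _)
  rw [Finset.mem_insert, Finset.mem_filter]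
  rw [Finset.mem_filter] at hv
  by_cases h : v = u
  · exact Or.inl h
  · exact Or.inr ⟨hv.1, by rw [← hv.2, Function.update_of_ne h]⟩

/-- The word `(σ₃ σ₂ σ₁)^n σ₁^{-k}` with `N = 3 n` positive letters and `k > 0`. -/
structure IsTwisted (β : BraidWord 4) (N : ℕ) : Prop where
  lt : N < β.length
  sign_pos : ∀ t : Fin β.length, t.1 < N → (β.get t).2 = 1
  index_pos : ∀ t : Fin β.length, t.1 < N → (β.get t).1.1 = 2 - t.1 % 3
  sign_neg : ∀ t : Fin β.length, N ≤ t.1 → (β.get t).2 ≠ 1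
  index_neg : ∀ t : Fin β.length, N ≤ t.1 → (β.get t).1.1 = 0

/-- A partial state which smooths the letters below `t` and the negative letters, and has a cap at
the positions `i`, `i + 1` below the height `t`. -/
structure IsStage (β : BraidWord 4) (N t i c : ℕ) (P : β.closure.PartialState) : Prop where
  neg : ∀ w : Fin β.length, N ≤ w.1 → P (β.crossing w) = some Marker.A
  free : ∀ w : Fin β.length, t ≤ w.1 → w.1 < N → P (β.crossing w) = none
  fixed : ∀ w : Fin β.length, w.1 < t → P (β.crossing w) ≠ none
  cap : ∃ K, IsCap (fun s => Extends s P) t i K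
  count : countB P ≤ c

variable {β : BraidWord 4} {N : ℕ}

theorem IsStage.update {t i c j c' : ℕ} {P : β.closure.PartialState} (hP : IsStage β N t i c P)
    (htL : t < β.length) (htN : t < N) {x : Marker}
    (hcap : ∃ K, IsCap (fun s => Extends s (Function.update P (β.crossing ⟨t, htL⟩) (some x)))
      (t + 1) j K)
    (hc : countB (Function.update P (β.crossing ⟨t, htL⟩) (some x)) ≤ c') :
    IsStage β N (t + 1) j c' (Function.update P (β.crossing ⟨t, htL⟩) (some x)) where
  neg w hw := by
    rw [update_crossing, if_neg (by dsimp only; omega), hP.neg w hw]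
  free w hw hw' := by
    rw [update_crossing, if_neg (by dsimp only; omega), hP.free w (by omega) hw']
  fixed w hw := by
    rw [update_crossing]
    split_ifs with h
    · simp
    · exact hP.fixed w (by dsimp only at h; omega)
  cap := hcap
  count := hc

/-- The next letter is smoothed in both ways if it is far from the cap or of the same type. -/
theorem cubeExact_branch (hβ : IsTwisted β N) {t i c : ℕ} (htN : t < N) {a b : ℤ}
    (hl : (β.get ⟨t, htN.trans hβ.lt⟩).1.1 = i ∨ β.Apart ⟨t, htN.trans hβ.lt⟩ i)
    (ih : ∀ P, IsStage β N (t + 1) i (c + 1) P → CubeExact P a b)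
    {P : β.closure.PartialState} (hP : IsStage β N t i c P) : CubeExact P a b := by
  have hL := hβ.lt
  have hε := hβ.sign_pos ⟨t, htN.trans hβ.lt⟩ htN
  have hu : P (β.crossing ⟨t, htN.trans hβ.lt⟩) = none := hP.free _ le_rfl htN
  obtain ⟨K, hK⟩ := hP.cap
  have hA : ∀ s, Extends s (Function.update P (β.crossing ⟨t, htN.trans hβ.lt⟩) (some Marker.A)) →
      ¬ β.Flat s ⟨t, htN.trans hβ.lt⟩ := fun s hs => not_flat_of_A hε (hs _ _ (by simp))
  have hB : ∀ s, Extends s (Function.update P (β.crossing ⟨t, htN.trans hβ.lt⟩) (some Marker.B)) →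
      β.Flat s ⟨t, htN.trans hβ.lt⟩ := fun s hs => flat_of_B hε (hs _ _ (by simp))
  have hcount := fun x => (countB_update P (β.crossing ⟨t, htN.trans hβ.lt⟩) x).trans
    (Nat.succ_le_succ hP.count)
  refine CubeExact.branch (coherent_closure β) hu (ih _ (hP.update _ htN ?_ (hcount _)))
    (ih _ (hP.update _ htN ?_ (hcount _)))
  · exact ⟨_, (hK.mono fun s hs => extends_update hu hs).extend (by omega)
      fun s hs => Or.inl (hA s hs)⟩
  · rcases hl with hl | hl
    · exact ⟨_, IsCap.of_flat (by omega) hl fun s hs => hB s hs⟩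
    · exact ⟨_, (hK.mono fun s hs => extends_update hu hs).extend (by omega)
        fun s hs => Or.inr hl⟩

theorem cubeExact_slide_one (hβ : IsTwisted β N) {t i j c : ℕ} (htN : t + 1 < N) {a b : ℤ}
    (hu : (β.get ⟨t, by have := hβ.lt; omega⟩).1.1 = j)
    (hv : (β.get ⟨t + 1, by have := hβ.lt; omega⟩).1.1 = i) (hij : j = i + 1 ∨ j + 1 = i)
    (ih : ∀ P, IsStage β N (t + 2) j (c + 1) P → CubeExact P a b)
    {P : β.closure.PartialState} (hP : IsStage β N t i c P) : CubeExact P a b := by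
  have hL := hβ.lt
  obtain ⟨K, hK⟩ := hP.cap
  have fu : P (β.crossing ⟨t, by omega⟩) = none := hP.free _ le_rfl (by dsimp only; omega)
  have fv : P (β.crossing ⟨t + 1, by omega⟩) = none :=
    hP.free _ (by dsimp only; omega) (by dsimp only; omega)
  have εu := hβ.sign_pos ⟨t, by omega⟩ (by dsimp only; omega)
  have εv := hβ.sign_pos ⟨t + 1, by omega⟩ htN
  have hK1 := (hK.mono (Q' := fun s => Extends s P ∧ s (β.crossing ⟨t, by omega⟩) = Marker.A)
    fun s hs => hs.1).extend (by omega) fun s hs => Or.inl (not_flat_of_A εu hs.2)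
  have fv' : Function.update P (β.crossing ⟨t, by omega⟩) (some Marker.B)
      (β.crossing ⟨t + 1, by omega⟩) = none := by
    rw [update_crossing, if_neg (by simp), fv]
  refine cubeExact_slide (u := ⟨t, by omega⟩) (v := ⟨t + 1, by omega⟩) (Nat.lt_succ_self t)
    (by dsimp only; omega) fu fv εu εv hv (by omega) hK1
    (fun p hp => ⟨Or.inl (hK.mem p hp), Or.inr ⟨rfl, hp⟩⟩) ?_ (ih _ ?_)
  · intro w hw hwu hwv
    have h1 : w.1 ≠ t := fun h => hwu (Fin.ext h)
    have h2 : w.1 ≠ t + 1 := fun h => hwv (Fin.ext h)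
    have h3 : ¬ w.1 < t := fun h => hP.fixed w h hw
    have h4 : w.1 < N := by
      by_contra h
      rw [hP.neg w (by omega)] at hw
      cases hw
    left
    dsimp only
    omega
  · have h1 := hP.update (c' := c + 1) (x := Marker.B) (j := j) (by omega) (by omega)
      ⟨_, IsCap.of_flat (by omega) hu fun s hs => flat_of_B εu (hs _ _ (by simp))⟩
      ((countB_update _ _ _).trans (Nat.succ_le_succ hP.count))
    obtain ⟨K', hK'⟩ := h1.cap
    refine h1.update (by omega) htN ⟨_, (hK'.mono fun s hs => extends_update fv' hs).extend
      (by omega) fun s hs => Or.inl (not_flat_of_A εv (hs _ _ (by simp)))⟩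
      ((countB_update_A _ _).trans h1.count)

theorem cubeExact_slide_two (hβ : IsTwisted β N) {t i j l c : ℕ} (htN : t + 3 < N) {a b : ℤ}
    (h0 : (β.get ⟨t, by have := hβ.lt; omega⟩).1.1 = j)
    (h1 : (β.get ⟨t + 1, by have := hβ.lt; omega⟩).1.1 = l)
    (h2 : (β.get ⟨t + 2, by have := hβ.lt; omega⟩).1.1 = i)
    (h3 : (β.get ⟨t + 3, by have := hβ.lt; omega⟩).1.1 = j) (hij : j + 1 = i) (hlj : l + 1 = j)
    (ih : ∀ P, IsStage β N (t + 4) l (c + 2) P → CubeExact P a b)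
    {P : β.closure.PartialState} (hP : IsStage β N t i c P) : CubeExact P a b := by
  have hL := hβ.lt
  obtain ⟨K, hK⟩ := hP.cap
  have f : ∀ k (hk : k < 4), P (β.crossing ⟨t + k, by omega⟩) = none := fun k hk =>
    hP.free _ (by dsimp only; omega) (by dsimp only; omega)
  have ε : ∀ k (hk : k < 4), (β.get ⟨t + k, by omega⟩).2 = 1 := fun k hk =>
    hβ.sign_pos _ (by dsimp only; omega)
  have none_iff : ∀ w : Fin β.length, P (β.crossing w) = none → t ≤ w.1 ∧ w.1 < N := by
    intro w hw
    by_contra h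
    by_cases h1 : t ≤ w.1
    · rw [hP.neg w (by omega)] at hw; cases hw
    · exact hP.fixed w (by omega) hw
  have ap : β.Apart ⟨t + 1, by omega⟩ i := Apart.of_eq h1 (by omega)
  have hK2 := ((hK.mono (Q' := fun s => Extends s P ∧ s (β.crossing ⟨t, by omega⟩) = Marker.A)
    fun s hs => hs.1).extend (by omega) fun s hs =>
      Or.inl (not_flat_of_A (ε 0 (by omega)) hs.2)).extend (by omega) fun s hs => Or.inr ap
  refine cubeExact_slide (u := ⟨t, by omega⟩) (v := ⟨t + 2, by omega⟩) (by dsimp only; omega)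
    (by dsimp only; omega) (f 0 (by omega)) (f 2 (by omega)) (ε 0 (by omega)) (ε 2 (by omega)) h2
    (by omega) hK2 (fun p hp => ⟨Or.inl (Or.inl (hK.mem p hp)), Or.inl (Or.inr ⟨rfl, hp⟩)⟩) ?_ ?_
  · intro w hw hwu hwv
    have e1 : w.1 ≠ t := fun h => hwu (Fin.ext h)
    have e2 : w.1 ≠ t + 2 := fun h => hwv (Fin.ext h)
    have e3 := none_iff w hw
    by_cases e4 : w.1 = t + 1
    · rw [show w = ⟨t + 1, by omega⟩ from Fin.ext e4]
      exact Or.inr ap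
    · left; dsimp only; omega
  set P₁ := Function.update (Function.update P (β.crossing ⟨t, by omega⟩) (some Marker.B))
    (β.crossing ⟨t + 2, by omega⟩) (some Marker.A) with hP₁
  have g : ∀ w : Fin β.length, P₁ (β.crossing w) = if w.1 = t + 2 then some Marker.A else
      if w.1 = t then some Marker.B else P (β.crossing w) := by
    intro w; rw [hP₁, update_crossing, update_crossing]
  have g1 : P₁ (β.crossing ⟨t + 1, by omega⟩) = none := by rw [g]; simpa using f 1 (by omega)
  have g3 : P₁ (β.crossing ⟨t + 3, by omega⟩) = none := by rw [g]; simpa using f 3 (by omega)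
  have g0 : P₁ (β.crossing ⟨t, by omega⟩) = some Marker.B := by rw [g]; simp
  have g2 : P₁ (β.crossing ⟨t + 2, by omega⟩) = some Marker.A := by rw [g]; simp
  have hJ := ((IsCap.of_flat (β := β) (t := t) (i := j)
    (Q := fun s => Extends s P₁ ∧ s (β.crossing ⟨t + 1, by omega⟩) = Marker.A) (by omega) h0
    fun s hs => flat_of_B (ε 0 (by omega)) (hs.1 _ _ g0)).extend (by omega) fun s hs =>
      Or.inl (not_flat_of_A (ε 1 (by omega)) hs.2)).extend (by omega) fun s hs =>
      Or.inl (not_flat_of_A (ε 2 (by omega)) (hs.1 _ _ g2))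
  refine cubeExact_slide (u := ⟨t + 1, by omega⟩) (v := ⟨t + 3, by omega⟩) (by dsimp only; omega)
    (by dsimp only; omega) g1 g3 (ε 1 (by omega)) (ε 3 (by omega)) h3
    (by omega) hJ (fun p hp => ⟨Or.inl (Or.inl ⟨rfl, hp⟩), Or.inl (Or.inr ⟨rfl, hp⟩)⟩) ?_
    (ih _ ?_)
  · intro w hw hwu hwv
    rw [g] at hw
    have e1 : w.1 ≠ t + 1 := fun h => hwu (Fin.ext h)
    have e2 : w.1 ≠ t + 3 := fun h => hwv (Fin.ext h)
    split_ifs at hw with e3 e4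
    have e5 := none_iff w hw
    left; dsimp only; omega
  have k : ∀ w : Fin β.length, Function.update (Function.update P₁ (β.crossing ⟨t + 1, by omega⟩)
      (some Marker.B)) (β.crossing ⟨t + 3, by omega⟩) (some Marker.A) (β.crossing w) =
      if w.1 = t + 3 then some Marker.A else if w.1 = t + 1 then some Marker.B else
      if w.1 = t + 2 then some Marker.A else
      if w.1 = t then some Marker.B else P (β.crossing w) := by
    intro w; rw [update_crossing, update_crossing, g]
  refine ⟨fun w hw => ?_, fun w hw hw' => ?_, fun w hw => ?_, ?_, ?_⟩
  · rw [k, if_neg (by omega), if_neg (by omega), if_neg (by omega), if_neg (by omega), hP.neg w hw]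
  · rw [k, if_neg (by omega), if_neg (by omega), if_neg (by omega), if_neg (by omega),
      hP.free w (by omega) hw']
  · rw [k]
    split_ifs
    all_goals first | exact Option.some_ne_none _ | exact hP.fixed w (by omega)
  · exact ⟨_, ((IsCap.of_flat (by omega) h1 fun s hs => flat_of_B (ε 1 (by omega))
      (hs _ _ (by rw [k]; simp))).extend (by omega) fun s hs => Or.inl
      (not_flat_of_A (ε 2 (by omega)) (hs _ _ (by rw [k]; simp)))).extend (by omega) fun s hs =>
      Or.inl (not_flat_of_A (ε 3 (by omega)) (hs _ _ (by rw [k]; simp)))⟩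
  · refine (countB_update_A _ _).trans ((countB_update _ _ _).trans (Nat.succ_le_succ ?_))
    exact (countB_update_A _ _).trans ((countB_update _ _ _).trans (Nat.succ_le_succ hP.count))

theorem cubeExact_of_cap_zero (hβ : IsTwisted β N) {t c : ℕ} (ht : t % 3 = 0) (htN : t + 6 ≤ N)
    {a b : ℤ} (ih : ∀ P, IsStage β N (t + 6) 2 (c + 4) P → CubeExact P a b)
    {P : β.closure.PartialState} (hP : IsStage β N t 0 c P) : CubeExact P a b := by
  have hL := hβ.lt
  have ι : ∀ k (hk : k < 6), (β.get ⟨t + k, by omega⟩).1.1 = 2 - k % 3 := fun k hk => by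
    rw [hβ.index_pos _ (by dsimp only; omega)]; dsimp only; omega
  refine cubeExact_branch hβ (t := t) (i := 0) (by omega)
    (Or.inr (Apart.of_eq (ι 0 (by omega)) (by omega))) (fun P hP => ?_) hP
  refine cubeExact_slide_one hβ (t := t + 1) (j := 1) (by omega) (ι 1 (by omega)) (ι 2 (by omega))
    (by omega) (fun P hP => ?_) hP
  refine cubeExact_slide_one hβ (t := t + 3) (j := 2) (by omega) (ι 3 (by omega)) (ι 4 (by omega))
    (by omega) (fun P hP => ?_) hP
  exact cubeExact_branch hβ (t := t + 5) (by omega)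
    (Or.inr (Apart.of_eq (ι 5 (by omega)) (by omega))) ih hP

theorem cubeExact_of_cap_two (hβ : IsTwisted β N) {t c : ℕ} (ht : t % 3 = 0) (htN : t + 6 ≤ N)
    {a b : ℤ} (ih : ∀ P, IsStage β N (t + 6) 0 (c + 4) P → CubeExact P a b)
    {P : β.closure.PartialState} (hP : IsStage β N t 2 c P) : CubeExact P a b := by
  have hL := hβ.lt
  have ι : ∀ k (hk : k < 6), (β.get ⟨t + k, by omega⟩).1.1 = 2 - k % 3 := fun k hk => by
    rw [hβ.index_pos _ (by dsimp only; omega)]; dsimp only; omega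
  refine cubeExact_branch hβ (t := t) (i := 2) (by omega) (Or.inl (ι 0 (by omega)))
    (fun P hP => ?_) hP
  refine cubeExact_slide_two hβ (t := t + 1) (j := 1) (l := 0) (by omega) (ι 1 (by omega))
    (ι 2 (by omega)) (ι 3 (by omega)) (ι 4 (by omega)) rfl rfl (fun P hP => ?_) hP
  exact cubeExact_branch hβ (t := t + 5) (by omega) (Or.inl (ι 5 (by omega))) ih hP

theorem aDeg_eq {D : Diagram} (x : D.EnhancedState) : aDeg x = (Fintype.card D.Crossing : ℤ) -
    2 * (Finset.univ.filter fun v => x.1 v = Marker.B).card := by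
  have h := Finset.card_filter_add_card_filter_not (s := (Finset.univ : Finset D.Crossing))
    fun v => x.1 v = Marker.A
  simp only [marker_ne_A, Finset.card_univ] at h
  rw [← h, aDeg]
  push_cast
  ring

theorem aDeg_ge_of_fixed {D : Diagram} {P : D.PartialState} (hP : ∀ v, P v ≠ none) {b : ℤ}
    {x : D.EnhancedState} (hx : x ∈ cube P b) :
    (Fintype.card D.Crossing : ℤ) - 2 * countB P ≤ aDeg x := by
  have h1 : (Finset.univ.filter fun v => x.1 v = Marker.B).card ≤ countB P := by
    refine Finset.card_le_card fun v hv => ?_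
    rw [Finset.mem_filter] at hv ⊢
    refine ⟨hv.1, ?_⟩
    obtain ⟨m, hm⟩ := Option.ne_none_iff_exists'.1 (hP v)
    rw [hm, ← hx.1 v m hm, hv.2]
  rw [aDeg_eq]
  omega

theorem cubeExact_of_stage (hβ : IsTwisted β N) {n : ℕ} (hN : N = 6 * n) {a b : ℤ}
    (ha : a < β.length - 8 * n) {j i : ℕ} (hj : j ≤ n) (hi : i = 0 ∨ i = 2)
    {P : β.closure.PartialState} (hP : IsStage β N (6 * j) i (4 * j) P) : CubeExact P a b := by
  induction hj using Nat.decreasingInduction generalizing i P with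
  | of_succ j hj ih =>
    have h3 : (6 * j) % 3 = 0 := by lia
    have h6 : 6 * j + 6 ≤ N := by lia
    rcases hi with rfl | rfl
    · exact cubeExact_of_cap_zero hβ h3 h6 (fun P hP => ih (Or.inr rfl) hP) hP
    · exact cubeExact_of_cap_two hβ h3 h6 (fun P hP => ih (Or.inl rfl) hP) hP
  | self =>
    refine ExactOn.of_forall_ne fun x hx => ne_of_gt (lt_of_lt_of_le ?_ (aDeg_ge_of_fixed ?_ hx))
    · have h1 := hP.count
      have h2 : Fintype.card β.closure.Crossing = β.length := Fintype.card_fin _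
      rw [h2]
      omega
    · intro v
      by_cases hv : v.1 < N
      · exact hP.fixed v (by omega)
      · rw [show P v = _ from hP.neg v (by omega)]; simp

/-- The negative letters above the height `t` are smoothed by `A`, all others are free. -/
theorem cubeExact_of_last (hβ : IsTwisted β N) {n : ℕ} (hN : N = 6 * n) {a b : ℤ} (hL : 2 ≤ β.length)
    (ha : a < β.length - 8 * n) {t : ℕ} (ht : N ≤ t) (htL : t < β.length)
    {P : β.closure.PartialState}
    (hneg : ∀ w : Fin β.length, t ≤ w.1 → P (β.crossing w) = some Marker.A)
    (hfree : ∀ w : Fin β.length, w.1 < t → P (β.crossing w) = none) : CubeExact P a b := by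
  induction ht using Nat.leRec generalizing P with
  | refl =>
    refine cubeExact_of_stage hβ hN ha (Nat.zero_le n) (Or.inl rfl)
      ⟨hneg, fun w _ hw => hfree w hw, fun w hw => by omega, ⟨_, IsCap.of_last hL
        (hβ.index_neg _ (by dsimp only; omega)) fun s hs => Or.inr
        ⟨hβ.sign_neg _ (by dsimp only; omega), hs _ _ (hneg _ (by dsimp only; omega))⟩⟩, ?_⟩
    refine le_of_eq (Finset.card_eq_zero.2 (Finset.filter_eq_empty_iff.2 fun v _ hv => ?_))
    by_cases h : N ≤ v.1
    · rw [show P v = _ from hneg v h] at hv; cases hv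
    · rw [show P v = _ from hfree v (by omega)] at hv; cases hv
  | le_succ_of_le ht ih =>
    rename_i t
    refine cubeExact_kink (u := ⟨t, by omega⟩) htL (hfree _ (Nat.lt_succ_self t)) (hneg _ le_rfl)
      (hβ.sign_neg _ ht) (hβ.sign_neg _ (by dsimp only; omega)) ?_ (ih (by omega) ?_ ?_)
    · rw [hβ.index_neg _ ht, hβ.index_neg _ (by dsimp only; omega)]
    · intro w hw
      rw [update_crossing]
      split_ifs with h
      · rfl
      · exact hneg w (by dsimp only at h; omega)
    · intro w hw
      rw [update_crossing, if_neg (by dsimp only; omega), hfree w (by omega)]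

end BraidWord

namespace Diagram

/-- The diagram `D` arises from `D'` by the `B`-smoothing of the last crossing. -/
structure SmoothLast (D D' : Diagram) where
  /-- the crossings of `D` as crossings of `D'` -/
  cross : D.Crossing → D'.Crossing
  lt_iff : ∀ u v, cross u < cross v ↔ u < v
  /-- the crossing which is smoothed -/
  last : D'.Crossing
  lt_last : ∀ u, cross u < last
  exists_cross : ∀ w, w ≠ last → ∃ u, cross u = w
  /-- the arcs of `D` as arcs of `D'` -/
  arc : D.Arc → D'.Arc
  ends : ∀ u j, D'.ends (cross u) j = arc (D.ends u j)
  same_iff : ∀ s : D'.State, s last = Marker.B → ∀ x y,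
    Same s (arc x) (arc y) ↔ Same (fun u => s (cross u)) x y
  exists_arc : ∀ y, ∃ x, ∀ s : D'.State, s last = Marker.B → Same s y (arc x)

namespace SmoothLast

variable {D D' : Diagram} (R : SmoothLast D D')

theorem cross_injective : Function.Injective R.cross := by
  intro u v h
  by_contra huv
  rcases lt_or_gt_of_ne huv with h' | h'
  · exact absurd h (ne_of_lt ((R.lt_iff u v).2 h'))
  · exact absurd h (ne_of_gt ((R.lt_iff v u).2 h'))

theorem cross_ne_last (u : D.Crossing) : R.cross u ≠ R.last := ne_of_lt (R.lt_last u)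

theorem univ_eq : (Finset.univ : Finset D'.Crossing) =
    Finset.cons R.last (Finset.univ.map ⟨R.cross, R.cross_injective⟩)
      (by simp [R.cross_ne_last]) := by
  ext w
  by_cases hw : w = R.last
  · simp [hw]
  · simpa [hw] using R.exists_cross w hw

theorem card_filter (p : D'.Crossing → Prop) [DecidablePred p] :
    (Finset.univ.filter p).card = (if p R.last then 1 else 0) +
      (Finset.univ.filter fun u => p (R.cross u)).card := by
  simp only [Finset.card_filter, R.univ_eq, Finset.sum_cons, Finset.sum_map,
    Function.Embedding.coeFn_mk]

theorem card_crossing (R : SmoothLast D D') : Fintype.card D'.Crossing = Fintype.card D.Crossing + 1 := by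
  rw [← Finset.card_univ, R.univ_eq, Finset.card_cons, Finset.card_map, Finset.card_univ]

/-- The enhanced states of `D'` which smooth the last crossing by `B`. -/
def Lower : Set D'.EnhancedState := {x | x.1 R.last = Marker.B}

/-- The circles of `D` as circles of `D'`. -/
def circle {s : D'.State} (hs : s R.last = Marker.B) :
    D.Circle (fun u => s (R.cross u)) → D'.Circle s :=
  Quot.lift (fun x => Quot.mk _ (R.arc x)) fun x y h =>
    (R.same_iff s hs x y).2 (Same.of_joined h)

theorem circle_bijective {s : D'.State} (hs : s R.last = Marker.B) :
    Function.Bijective (R.circle hs) := by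
  constructor
  · rintro ⟨x⟩ ⟨y⟩ h
    exact (R.same_iff s hs x y).1 h
  · rintro ⟨y⟩
    obtain ⟨x, hx⟩ := R.exists_arc y
    exact ⟨Quot.mk _ x, (hx s hs).symm⟩

/-- The enhanced state of `D` given by an enhanced state of `D'` with label `B` at the last
crossing. -/
def res (x : R.Lower) : D.EnhancedState :=
  ⟨fun u => x.1.1 (R.cross u), fun c => x.1.2 (R.circle x.2 c)⟩

theorem res_bijective : Function.Bijective R.res := by
  constructor
  · rintro ⟨⟨s, l⟩, hs⟩ ⟨⟨s', l'⟩, hs'⟩ h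
    obtain rfl : s = s' := by
      funext w
      by_cases hw : w = R.last
      · rw [hw, show s R.last = _ from hs, show s' R.last = _ from hs']
      · obtain ⟨u, rfl⟩ := R.exists_cross w hw
        exact congrFun (congrArg Sigma.fst h) u
    congr 2
    have h2 := eq_of_heq (Sigma.mk.inj h).2
    funext c
    obtain ⟨c, rfl⟩ := (R.circle_bijective hs).2 c
    exact congrFun h2 c
  · rintro ⟨s, l⟩
    obtain ⟨t, ht, rfl⟩ : ∃ t : D'.State, t R.last = Marker.B ∧ (fun u => t (R.cross u)) = s := by
      classical
      refine ⟨fun w => if h : ∃ u, R.cross u = w then s h.choose else Marker.B, ?_, ?_⟩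
      · exact dif_neg fun ⟨u, hu⟩ => R.cross_ne_last u hu
      · funext u
        have h : ∃ u', R.cross u' = R.cross u := ⟨u, rfl⟩
        exact (dif_pos h).trans (congrArg s (R.cross_injective h.choose_spec))
    refine ⟨⟨⟨t, fun c => l ((Equiv.ofBijective _ (R.circle_bijective ht)).symm c)⟩, ht⟩, ?_⟩
    simp only [res]
    congr 1
    funext c
    exact congrArg l ((Equiv.ofBijective _ (R.circle_bijective ht)).symm_apply_apply c)

theorem aDeg_res (x : R.Lower) : aDeg (R.res x) = aDeg x.1 + 1 := by
  have h : (Finset.univ.filter fun v => x.1.1 v = Marker.B).card =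
      1 + (Finset.univ.filter fun u => (R.res x).1 u = Marker.B).card := by
    rw [R.card_filter, if_pos (show x.1.1 R.last = Marker.B from x.2)]
    congr!
  rw [BraidWord.aDeg_eq, BraidWord.aDeg_eq, R.card_crossing, h]
  push_cast
  ring

theorem tau_res (x : R.Lower) : tau (R.res x) = tau x.1 :=
  Fintype.sum_bijective _ (R.circle_bijective x.2) _ _ fun _ => rfl

theorem bDeg_res (x : R.Lower) : bDeg (R.res x) = bDeg x.1 + 1 := by
  rw [bDeg, bDeg, R.aDeg_res, R.tau_res]; ring

theorem adjacent_res_iff (x y : R.Lower) (u : D.Crossing) :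
    IsAdjacentAt (R.res x) (R.res y) u ↔ IsAdjacentAt x.1 y.1 (R.cross u) := by
  unfold IsAdjacentAt
  rw [R.aDeg_res, R.aDeg_res, R.bDeg_res, R.bDeg_res]
  refine and_congr (by omega) (and_congr (by omega) (and_congr Iff.rfl (and_congr Iff.rfl
    (and_congr ⟨fun h w hw => ?_, fun h w hw => ?_⟩ ⟨fun h a ha => ?_, fun h a ha => ?_⟩))))
  · by_cases hl : w = R.last
    · rw [hl, show x.1.1 R.last = _ from x.2, show y.1.1 R.last = _ from y.2]
    · obtain ⟨v, rfl⟩ := R.exists_cross w hl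
      exact h v fun hv => hw (congrArg _ hv)
  · exact h (R.cross w) fun hv => hw (R.cross_injective hv)
  · obtain ⟨a', ha'⟩ := R.exists_arc a
    have h1 : circleThrough x.1 a = circleThrough x.1 (R.arc a') := ha' _ x.2
    have h2 : circleThrough y.1 a = circleThrough y.1 (R.arc a') := ha' _ y.2
    rw [h1, h2]
    refine h a' fun j hj => ha j ?_
    rw [h1, R.ends]
    exact (R.same_iff _ x.2 _ _).2 hj
  · refine h (R.arc a) fun j hj => ha j ?_
    rw [R.ends] at hj
    exact (R.same_iff _ x.2 _ _).1 hj

theorem edgeSign_cross (x : R.Lower) (u : D.Crossing) :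
    edgeSign x.1.1 (R.cross u) = - edgeSign (R.res x).1 u := by
  rw [edgeSign, edgeSign, R.card_filter, if_pos ⟨R.lt_last u, x.2⟩, pow_add, pow_one, neg_one_mul]
  simp only [R.lt_iff, res]
  congr!

theorem incidence_res (x y : R.Lower) :
    incidence (R.res x) (R.res y) = - incidence x.1 y.1 := by
  classical
  have h : ¬ IsAdjacentAt x.1 y.1 R.last := fun h => by
    have := h.2.2.1
    rw [show x.1.1 R.last = _ from x.2] at this
    cases this
  rw [incidence_eq, incidence_eq, R.univ_eq, Finset.sum_cons, Finset.sum_map,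
    if_neg h, zero_add, ← Finset.sum_neg_distrib]
  refine Finset.sum_congr rfl fun u _ => ?_
  simp only [Function.Embedding.coeFn_mk, R.adjacent_res_iff, R.edgeSign_cross]
  split_ifs <;> simp

end SmoothLast

end Diagram

namespace BraidWord

open Diagram

variable {m : ℕ}

section Append

variable (β : BraidWord m) (l : Fin (m - 1) × ℤˣ)

/-- A letter of `β` as a letter of `β ++ [l]`. -/
def appendLetter (t : Fin β.length) : Fin (β ++ [l]).length :=
  t.castLE (by simp)

/-- The appended letter. -/
def lastLetter : Fin (β ++ [l]).length := ⟨β.length, by simp⟩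

/-- A height of `β` as a height of `β ++ [l]`. -/
def appendHeight (r : Fin (β.length + 1)) : Fin ((β ++ [l]).length + 1) :=
  r.castLE (by simp)

/-- The strands of `β ++ [l]` are retracted to those of `β`. -/
def retractHeight (r : Fin ((β ++ [l]).length + 1)) : Fin (β.length + 1) :=
  ⟨min r.1 β.length, by omega⟩

theorem retractHeight_appendHeight (r : Fin (β.length + 1)) :
    retractHeight β l (appendHeight β l r) = r :=
  Fin.ext (min_eq_left (Nat.le_of_lt_succ r.2))

theorem letter_cases (t : Fin (β ++ [l]).length) :
    (∃ t', t = appendLetter β l t') ∨ t = lastLetter β l := by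
  have h := t.2
  simp only [List.length_append, List.length_singleton] at h
  by_cases h' : t.1 < β.length
  · exact Or.inl ⟨⟨t.1, h'⟩, rfl⟩
  · exact Or.inr (Fin.ext (by simp only [lastLetter]; omega))

theorem retractHeight_castSucc (t : Fin β.length) :
    retractHeight β l (appendLetter β l t).castSucc = t.castSucc :=
  retractHeight_appendHeight β l t.castSucc

theorem retractHeight_succ (t : Fin β.length) :
    retractHeight β l (appendLetter β l t).succ = t.succ :=
  retractHeight_appendHeight β l t.succ

theorem retractHeight_last_castSucc :
    retractHeight β l (lastLetter β l).castSucc = Fin.last _ :=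
  Fin.ext (min_self _)

theorem retractHeight_last_succ :
    retractHeight β l (lastLetter β l).succ = Fin.last _ :=
  Fin.ext (min_eq_right (Nat.le_succ _))

theorem retractHeight_last : retractHeight β l (Fin.last _) = Fin.last _ :=
  Fin.ext (min_eq_right (by simp))

theorem retractHeight_zero : retractHeight β l 0 = 0 := Fin.ext (Nat.zero_min _)

theorem last_eq_succ : Fin.last (β ++ [l]).length = (lastLetter β l).succ :=
  Fin.ext (by simp [lastLetter])

theorem get_appendLetter (t : Fin β.length) : (β ++ [l]).get (appendLetter β l t) = β.get t := by
  simp [appendLetter]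

theorem get_lastLetter : (β ++ [l]).get (lastLetter β l) = l := by
  simp [lastLetter]

variable {β l}

theorem flat_appendLetter {s : (β ++ [l]).closure.State} {t : Fin β.length} :
    (β ++ [l]).Flat s (appendLetter β l t) ↔
      β.Flat (fun u => s (crossing (β := β ++ [l]) (appendLetter β l u))) t := by
  unfold Flat
  rw [get_appendLetter]
  rfl

theorem not_flat_lastLetter (hl : l.2 ≠ 1) {s : (β ++ [l]).closure.State}
    (hs : s (crossing _ (lastLetter β l)) = Marker.B) : ¬ (β ++ [l]).Flat s (lastLetter β l) :=
  not_flat_iff.2 (Or.inr ⟨by rwa [get_lastLetter], hs⟩)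

theorem same_of_same_append (hl : l.2 ≠ 1) {s : (β ++ [l]).closure.State}
    (hs : s (crossing _ (lastLetter β l)) = Marker.B) {x y : (β ++ [l]).closure.Arc}
    (h : Same s x y) : Same (D := β.closure)
      (fun u => s (crossing (β ++ [l]) (appendLetter β l u)))
      (β.arc (retractHeight β l x.1) x.2) (β.arc (retractHeight β l y.1) y.2) := by
  refine Same.map (fun x : (β ++ [l]).closure.Arc => (Quot.mk _
    (β.arc (retractHeight β l x.1) x.2) : β.closure.Circle _)) (fun x y h => ?_) h
  refine joined_cases (R := fun x y : (β ++ [l]).closure.Arc =>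
    Same (D := β.closure) (fun u => s (crossing (β ++ [l]) (appendLetter β l u)))
      (β.arc (retractHeight β l x.1) x.2) (β.arc (retractHeight β l y.1) y.2))
    (fun _ _ => Same.symm) (fun t p hp => ?_) (fun t ht => ?_) (fun t ht => ?_) (fun p => ?_) h
  · rcases letter_cases β l t with ⟨t, rfl⟩ | rfl
    · dsimp only
      rw [retractHeight_castSucc, retractHeight_succ]
      rw [flat_appendLetter, get_appendLetter] at hp
      exact same_vert hp
    · dsimp only
      rw [retractHeight_last_castSucc, retractHeight_last_succ]
      exact Same.refl _ _
  · rcases letter_cases β l t with ⟨t, rfl⟩ | rfl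
    · dsimp only
      rw [retractHeight_castSucc, get_appendLetter]
      exact same_cap (flat_appendLetter.1 ht)
    · exact absurd ht (not_flat_lastLetter hl hs)
  · rcases letter_cases β l t with ⟨t, rfl⟩ | rfl
    · dsimp only
      rw [retractHeight_succ, get_appendLetter]
      exact same_cup (flat_appendLetter.1 ht)
    · exact absurd ht (not_flat_lastLetter hl hs)
  · dsimp only
    rw [retractHeight_last, retractHeight_zero]
    exact same_close _ p

theorem same_append_of_same (hl : l.2 ≠ 1) {s : (β ++ [l]).closure.State}
    (hs : s (crossing _ (lastLetter β l)) = Marker.B) {x y : β.closure.Arc}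
    (h : Same (D := β.closure) (fun u => s (crossing (β ++ [l]) (appendLetter β l u))) x y) :
    Same s ((β ++ [l]).arc (appendHeight β l x.1) x.2)
      ((β ++ [l]).arc (appendHeight β l y.1) y.2) := by
  refine Same.map (fun x : β.closure.Arc => (Quot.mk _
    ((β ++ [l]).arc (appendHeight β l x.1) x.2) : (β ++ [l]).closure.Circle s))
    (fun x y h => ?_) h
  refine joined_cases (R := fun x y : β.closure.Arc =>
    Same s ((β ++ [l]).arc (appendHeight β l x.1) x.2)
      ((β ++ [l]).arc (appendHeight β l y.1) y.2))
    (fun _ _ => Same.symm) (fun t p hp => ?_) (fun t ht => ?_) (fun t ht => ?_) (fun p => ?_) h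
  · refine same_vert (t := appendLetter β l t) ?_
    rw [flat_appendLetter, get_appendLetter]
    exact hp
  · have h1 := same_cap (flat_appendLetter.2 ht)
    rw [get_appendLetter] at h1
    exact h1
  · have h1 := same_cup (flat_appendLetter.2 ht)
    rw [get_appendLetter] at h1
    exact h1
  · refine (same_vert (t := lastLetter β l) (p := p) (Or.inl (not_flat_lastLetter hl hs))).trans ?_
    rw [← last_eq_succ]
    exact same_close s p

/-- Appending a negative letter to a braid word and smoothing it by `B`. -/
def smoothLast (hl : l.2 ≠ 1) : SmoothLast β.closure (β ++ [l]).closure where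
  cross t := crossing (β ++ [l]) (appendLetter β l t)
  lt_iff _ _ := Iff.rfl
  last := crossing (β ++ [l]) (lastLetter β l)
  lt_last t := show t.1 < β.length from t.2
  exists_cross w hw := by
    rcases letter_cases β l w with ⟨t, ht⟩ | ht
    · exact ⟨t, ht.symm⟩
    · exact absurd ht hw
  arc x := arc (β ++ [l]) (appendHeight β l x.1) x.2
  ends t j := by
    have hg := get_appendLetter β l t
    change (β ++ [l]).closure.ends (crossing _ (appendLetter β l t)) j =
      arc (β ++ [l]) (appendHeight β l (β.closure.ends (β.crossing t) j).1)
        (β.closure.ends (β.crossing t) j).2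
    by_cases hε : (β.get t).2 = 1
    · rw [ends_pos (by rw [hg]; exact hε), ends_pos hε, hg]
      fin_cases j <;> rfl
    · rw [ends_neg (by rw [hg]; exact hε), ends_neg hε, hg]
      fin_cases j <;> rfl
  same_iff s hs x y := by
    refine ⟨fun h => ?_, same_append_of_same hl hs⟩
    have h1 := same_of_same_append hl hs h
    rw [retractHeight_appendHeight, retractHeight_appendHeight] at h1
    exact h1
  exists_arc y := by
    by_cases hy : y.1.1 ≤ β.length
    · exact ⟨β.arc ⟨y.1.1, Nat.lt_succ_of_le hy⟩ y.2, fun s _ => Same.refl s _⟩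
    · refine ⟨β.arc (Fin.last _) y.2, fun s hs => ?_⟩
      have h1 : y.1 = (lastLetter β l).succ := by
        rw [← last_eq_succ]
        have := y.1.2
        exact Fin.ext (by simp only [List.length_append, List.length_singleton] at this ⊢; simp; omega)
      have h2 : y = arc _ (lastLetter β l).succ y.2 := Prod.ext h1 rfl
      rw [h2]
      exact (same_vert (Or.inl (not_flat_lastLetter hl hs))).symm

end Append

end BraidWord

/-- A linear map which induces an isomorphism of quotients. -/
def quotientEquivOfMap {M N : Type*} [AddCommGroup M] [AddCommGroup N] (φ : M →ₗ[ℤ] N)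
    (p : Submodule ℤ M) (q : Submodule ℤ N) (hsurj : ∀ n, ∃ m, n - φ m ∈ q)
    (hker : ∀ m, φ m ∈ q ↔ m ∈ p) : (M ⧸ p) ≃+ (N ⧸ q) :=
  ((Submodule.quotEquivOfEq p (LinearMap.ker (q.mkQ.comp φ)) (by
    ext m
    rw [LinearMap.mem_ker, LinearMap.comp_apply, Submodule.mkQ_apply,
      Submodule.Quotient.mk_eq_zero, hker])).trans
    ((q.mkQ.comp φ).quotKerEquivOfSurjective (fun n => by
      obtain ⟨n, rfl⟩ := q.mkQ_surjective n
      obtain ⟨m, hm⟩ := hsurj n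
      exact ⟨m, ((Submodule.Quotient.eq q).2 hm).symm⟩))).toAddEquiv

namespace Diagram

variable (D : Diagram)

/-- The functions on the enhanced states which are supported in bidegree `(a, b)`. -/
def homogeneous (a b : ℤ) : Submodule ℤ (D.EnhancedState → ℤ) where
  carrier := {f | ∀ x, f x ≠ 0 → aDeg x = a ∧ bDeg x = b}
  zero_mem' x hx := absurd rfl hx
  add_mem' {f g} hf hg x hx := by
    by_cases h : f x = 0
    · exact hg x fun h' => hx (by rw [Pi.add_apply, h, h', add_zero])
    · exact hf x h
  smul_mem' c f hf x hx := hf x fun h => hx (by rw [Pi.smul_apply, h, smul_zero])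

/-- The differential on functions on the enhanced states. -/
def differential : (D.EnhancedState → ℤ) →ₗ[ℤ] (D.EnhancedState → ℤ) where
  toFun f y := applyMatrix incidence f y
  map_add' f g := funext fun y => applyMatrix_add f g y
  map_smul' c f := funext fun y => by
    simp only [applyMatrix, Pi.smul_apply, smul_eq_mul, RingHom.id_apply, Finset.mul_sum, mul_assoc]

variable {D}

theorem differential_mem {a a' b : ℤ} (ha : a' = a - 2) {f : D.EnhancedState → ℤ}
    (hf : f ∈ D.homogeneous a b) : D.differential f ∈ D.homogeneous a' b := by
  intro y hy
  obtain ⟨x, -, hx⟩ := Finset.exists_ne_zero_of_sum_ne_zero hy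
  have h1 := hf x (left_ne_zero_of_mul hx)
  obtain ⟨v, hv⟩ := adjacent_of_incidence_ne_zero (right_ne_zero_of_mul hx)
  exact ⟨by rw [hv.1, h1.1, ha], by rw [hv.2.1, h1.2]⟩

theorem differential_differential (hD : D.Coherent) (f : D.EnhancedState → ℤ) :
    D.differential (D.differential f) = 0 := by
  funext z
  change ∑ y, (∑ x, f x * incidence x y) * incidence y z = 0
  simp only [Finset.sum_mul]
  rw [Finset.sum_comm]
  refine Finset.sum_eq_zero fun x _ => ?_
  simp only [mul_assoc]
  rw [← Finset.mul_sum, sum_incidence_mul hD, mul_zero]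

variable (D)

/-- The homogeneous cycles. -/
def cycles (a b : ℤ) : Submodule ℤ (D.EnhancedState → ℤ) :=
  D.homogeneous a b ⊓ LinearMap.ker D.differential

/-- The homogeneous boundaries. -/
def boundaries (a b : ℤ) : Submodule ℤ (D.EnhancedState → ℤ) :=
  (D.homogeneous (a + 2) b).map D.differential

variable {D}

/-- The extension by zero of a chain to a function on all enhanced states. -/
def extendChain (a b : ℤ) : D.Chain a b →ₗ[ℤ] (D.EnhancedState → ℤ) where
  toFun f x := if h : aDeg x = a ∧ bDeg x = b then f ⟨x, h⟩ else 0
  map_add' f g := funext fun x => by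
    dsimp only [Pi.add_apply]
    split_ifs <;> simp
  map_smul' c f := funext fun x => by
    dsimp only [Pi.smul_apply, RingHom.id_apply]
    split_ifs <;> simp

theorem extendChain_apply {a b : ℤ} (f : D.Chain a b) (x : D.Generator a b) :
    extendChain a b f x.1 = f x := dif_pos x.2

theorem extendChain_mem {a b : ℤ} (f : D.Chain a b) : extendChain a b f ∈ D.homogeneous a b := by
  intro x hx
  by_contra h
  exact hx (dif_neg h)

theorem extendChain_injective (a b : ℤ) : Function.Injective (extendChain (D := D) a b) := by
  intro f g h
  ext x
  rw [← extendChain_apply, h, extendChain_apply]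

theorem exists_extendChain {a b : ℤ} {f : D.EnhancedState → ℤ} (hf : f ∈ D.homogeneous a b) :
    ∃ g, extendChain a b g = f := by
  refine ⟨Finsupp.equivFunOnFinite.symm fun x => f x.1, funext fun x => ?_⟩
  by_cases h : aDeg x = a ∧ bDeg x = b
  · exact extendChain_apply (D := D) _ ⟨x, h⟩
  · by_contra h'
    refine h (hf x fun h'' => h' ?_)
    rw [h'']
    exact dif_neg h

theorem boundary_apply {a a' b : ℤ} (f : D.Chain a b) (y : D.Generator a' b) :
    D.boundary a a' b f y = ∑ x : D.Generator a b, f x * incidence x.1 y.1 := by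
  classical
  rw [boundary, Finsupp.linearCombination_apply,
    Finsupp.sum_fintype f (fun x c => c • ∑ y : D.Generator a' b,
      Finsupp.single y (incidence x.1 y.1)) (fun _ => zero_smul ℤ _), Finsupp.finsetSum_apply]
  refine Finset.sum_congr rfl fun x _ => ?_
  rw [Finsupp.smul_apply, Finsupp.finsetSum_apply, Finset.sum_eq_single y]
  · rw [Finsupp.single_eq_same, smul_eq_mul]
  · intro z _ hz
    rw [Finsupp.single_eq_of_ne (Ne.symm hz)]
  · exact fun h => absurd (Finset.mem_univ _) h

theorem extendChain_boundary {a a' b : ℤ} (ha : a' = a - 2) (f : D.Chain a b) :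
    extendChain a' b (D.boundary a a' b f) = D.differential (extendChain a b f) := by
  funext y
  by_cases h : aDeg y = a' ∧ bDeg y = b
  · rw [extendChain_apply (D := D) _ ⟨y, h⟩, boundary_apply]
    refine Fintype.sum_of_injective Subtype.val Subtype.val_injective _ _ (fun x hx => ?_)
      fun x => by rw [extendChain_apply]
    rw [show extendChain a b f x = 0 from dif_neg fun h => hx ⟨⟨x, h⟩, rfl⟩, zero_mul]
  · rw [show extendChain a' b (D.boundary a a' b f) y = 0 from dif_neg h]
    by_contra h'
    exact h (differential_mem ha (extendChain_mem f) y (Ne.symm h'))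

/-- The homology computed with functions on the enhanced states. -/
def framedHomologyEquiv (D : Diagram) (a b : ℤ) : D.FramedHomology a b ≃+
    (D.cycles a b ⧸ (D.boundaries a b).comap (D.cycles a b).subtype) :=
  quotientEquivOfMap
    (((extendChain a b).comp (LinearMap.ker (D.boundary a (a - 2) b)).subtype).codRestrict
      (D.cycles a b) fun f => ⟨extendChain_mem f.1, LinearMap.mem_ker.2 <| by
        exact (extendChain_boundary rfl f.1).symm.trans (by rw [f.2, map_zero])⟩)
    _ _ (by
      rintro ⟨z, hz, hz'⟩
      obtain ⟨f, rfl⟩ := exists_extendChain hz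
      refine ⟨⟨f, ?_⟩, ?_⟩
      · refine extendChain_injective _ _ ?_
        rw [extendChain_boundary rfl, map_zero]
        exact hz'
      · convert Submodule.zero_mem _
        exact sub_eq_zero.2 rfl)
    (by
      rintro ⟨f, hf⟩
      constructor
      · rintro ⟨g, hg, hgf⟩
        obtain ⟨g, rfl⟩ := exists_extendChain hg
        refine ⟨g, extendChain_injective _ _ ?_⟩
        rw [extendChain_boundary (by ring)]
        exact hgf
      · rintro ⟨g, hgf⟩
        refine ⟨extendChain _ _ g, extendChain_mem g, ?_⟩
        rw [← extendChain_boundary (by ring), hgf]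
        rfl)

namespace SmoothLast

variable {D' : Diagram} (R : SmoothLast D D')

open Classical in
/-- The inclusion of the chains of `D` into those of `D'`. -/
def incl : (D.EnhancedState → ℤ) →ₗ[ℤ] (D'.EnhancedState → ℤ) where
  toFun f x := if h : x ∈ R.Lower then f (R.res ⟨x, h⟩) else 0
  map_add' f g := funext fun x => by
    dsimp only [Pi.add_apply]
    split_ifs <;> simp
  map_smul' c f := funext fun x => by
    dsimp only [Pi.smul_apply, RingHom.id_apply]
    split_ifs <;> simp

theorem incl_apply (f : D.EnhancedState → ℤ) (x : R.Lower) : R.incl f x.1 = f (R.res x) :=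
  dif_pos x.2

theorem incl_apply_of_not_mem (f : D.EnhancedState → ℤ) {x : D'.EnhancedState} (hx : x ∉ R.Lower) :
    R.incl f x = 0 :=
  dif_neg hx

theorem incl_injective : Function.Injective R.incl := by
  intro f g h
  funext x
  obtain ⟨x, rfl⟩ := R.res_bijective.2 x
  rw [← R.incl_apply f, h, R.incl_apply]

theorem incl_mem {a b a' b' : ℤ} (ha : a = a' + 1) (hb : b = b' + 1) {f : D.EnhancedState → ℤ} :
    R.incl f ∈ D'.homogeneous a' b' ↔ f ∈ D.homogeneous a b := by
  constructor
  · intro h x hx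
    obtain ⟨x, rfl⟩ := R.res_bijective.2 x
    have h1 := h x.1 (by rwa [R.incl_apply])
    rw [R.aDeg_res, R.bDeg_res, h1.1, h1.2]
    exact ⟨ha.symm, hb.symm⟩
  · intro h x hx
    by_cases hl : x ∈ R.Lower
    · have h1 := h (R.res ⟨x, hl⟩) (by rwa [← R.incl_apply f])
      rw [R.aDeg_res, R.bDeg_res] at h1
      exact ⟨by linarith [h1.1], by linarith [h1.2]⟩
    · exact absurd (R.incl_apply_of_not_mem f hl) hx

theorem exists_incl {z : D'.EnhancedState → ℤ} (hz : ∀ x, x ∉ R.Lower → z x = 0) :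
    ∃ f, R.incl f = z := by
  refine ⟨fun x => z ((Equiv.ofBijective _ R.res_bijective).symm x).1, funext fun x => ?_⟩
  by_cases hl : x ∈ R.Lower
  · rw [R.incl_apply _ ⟨x, hl⟩]
    exact congrArg (fun x : R.Lower => z x.1)
      ((Equiv.ofBijective _ R.res_bijective).symm_apply_apply ⟨x, hl⟩)
  · rw [R.incl_apply_of_not_mem _ hl, hz x hl]

theorem differential_incl (f : D.EnhancedState → ℤ) :
    D'.differential (R.incl f) = - R.incl (D.differential f) := by
  funext y
  rw [Pi.neg_apply]
  by_cases hy : y ∈ R.Lower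
  · have : Fintype R.Lower := Fintype.ofFinite _
    rw [R.incl_apply _ ⟨y, hy⟩]
    change ∑ x, R.incl f x * incidence x y = - ∑ x, f x * incidence x (R.res ⟨y, hy⟩)
    rw [← Finset.sum_neg_distrib, ← R.res_bijective.sum_comp
      fun x => -(f x * incidence x (R.res ⟨y, hy⟩))]
    refine (Fintype.sum_of_injective Subtype.val Subtype.val_injective _ _ (fun x hx => ?_)
      fun x => ?_).symm
    · rw [R.incl_apply_of_not_mem _ fun h => hx ⟨⟨x, h⟩, rfl⟩, zero_mul]
    · rw [R.incl_apply, R.incidence_res]; ring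
  · rw [R.incl_apply_of_not_mem _ hy, neg_zero]
    refine applyMatrix_eq_zero fun x hx => ?_
    by_contra h
    have hl : x ∈ R.Lower := by
      by_contra hl
      exact hx (R.incl_apply_of_not_mem _ hl)
    exact hy (marker_le h hl)

open Classical in
/-- The partial state which smooths only the last crossing, by `A`. -/
def upper : D'.PartialState := fun w => if w = R.last then some Marker.A else none

theorem mem_cube_upper {b : ℤ} {x : D'.EnhancedState} :
    x ∈ cube R.upper b ↔ x ∉ R.Lower ∧ bDeg x = b := by
  refine and_congr ⟨fun h hl => ?_, fun h v m hv => ?_⟩ Iff.rfl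
  · have := h R.last Marker.A (if_pos rfl)
    rw [show x.1 R.last = Marker.B from hl] at this
    cases this
  · by_cases hv' : v = R.last
    · rw [upper, if_pos hv'] at hv
      cases hv
      rw [hv']
      exact marker_ne_B.1 h
    · rw [upper, if_neg hv'] at hv
      cases hv

/-- A chain whose boundary lies in the subcomplex of `D` can be moved into it by a boundary. -/
theorem exists_sub_differential_mem {a b : ℤ} (h : CubeExact R.upper a b)
    {z : D'.EnhancedState → ℤ} (hz : z ∈ D'.homogeneous a b)
    (hz' : ∀ y, y ∉ R.Lower → D'.differential z y = 0) :
    ∃ g ∈ D'.homogeneous (a + 2) b, ∃ f, R.incl f = z - D'.differential g := by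
  classical
  obtain ⟨g, hg, hgz⟩ := h (fun x => if x ∈ R.Lower then 0 else z x)
    (fun x hx => by
      split_ifs at hx with hl
      · exact absurd rfl hx
      · exact ⟨R.mem_cube_upper.2 ⟨hl, (hz x hx).2⟩, (hz x hx).1⟩)
    (fun y hy => by
      have hl := (R.mem_cube_upper.1 hy).1
      refine (applyMatrix_congr fun x hx => ?_).trans (hz' y hl)
      exact if_neg fun h' => hl (marker_le hx h'))
  have hg' : g ∈ D'.homogeneous (a + 2) b := fun x hx => ⟨(hg x hx).2, (hg x hx).1.2⟩
  refine ⟨g, hg', R.exists_incl fun x hx => ?_⟩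
  rw [Pi.sub_apply, sub_eq_zero]
  by_cases hb : bDeg x = b
  · have h1 := hgz x (R.mem_cube_upper.2 ⟨hx, hb⟩)
    rw [if_neg hx] at h1
    exact h1.symm
  · have h1 : z x = 0 := by
      by_contra h
      exact hb (hz x h).2
    have h2 : D'.differential g x = 0 := by
      by_contra h
      exact hb (differential_mem rfl hg' x h).2
    rw [h1, h2]

/-- If the quotient complex is exact in degrees `a` and `a + 2`, the homology of `D'` is that of
`D`. -/
def homologyEquiv (hD : D'.Coherent) {a b a' b' : ℤ} (ha : a = a' + 1) (hb : b = b' + 1)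
    (h₀ : CubeExact R.upper a' b') (h₂ : CubeExact R.upper (a' + 2) b') :
    D.FramedHomology a b ≃+ D'.FramedHomology a' b' :=
  ((D.framedHomologyEquiv a b).trans (quotientEquivOfMap
    ((R.incl.comp (D.cycles a b).subtype).codRestrict (D'.cycles a' b') fun f =>
      ⟨(R.incl_mem ha hb).2 f.2.1, LinearMap.mem_ker.2 <| by
        exact (R.differential_incl f.1).trans (by
          rw [show D.differential f.1 = 0 from f.2.2, map_zero, neg_zero])⟩)
    _ _ (by
      rintro ⟨z, hz, hz'⟩
      obtain ⟨g, hg, f, hf⟩ := R.exists_sub_differential_mem h₀ hz fun y _ => congrFun hz' y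
      refine ⟨⟨f, (R.incl_mem ha hb).1 ?_, R.incl_injective ?_⟩, g, hg, ?_⟩
      · rw [hf]
        exact Submodule.sub_mem _ hz (differential_mem (by ring) hg)
      · rw [map_zero, ← neg_eq_zero, ← R.differential_incl, hf, map_sub,
          differential_differential hD, sub_zero]
        exact hz'
      · change D'.differential g = z - R.incl f
        rw [hf, sub_sub_cancel])
    (by
      rintro ⟨f, hf, hf'⟩
      constructor
      · rintro ⟨y, hy, hyf⟩
        change D'.differential y = R.incl f at hyf
        obtain ⟨g, hg, k, hk⟩ := R.exists_sub_differential_mem h₂ hy fun x hx => by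
          rw [hyf, R.incl_apply_of_not_mem _ hx]
        refine ⟨-k, Submodule.neg_mem _ ((R.incl_mem (a' := a' + 2) (b' := b') (by rw [ha]; ring)
          hb).1 ?_), R.incl_injective ?_⟩
        · rw [hk]
          exact Submodule.sub_mem _ hy (differential_mem (by ring) hg)
        · rw [map_neg, map_neg, ← R.differential_incl, hk, map_sub,
            differential_differential hD, sub_zero]
          exact hyf
      · rintro ⟨g, hg, hgf⟩
        refine ⟨-R.incl g, Submodule.neg_mem _ ((R.incl_mem (by rw [ha]; ring) hb).2 hg), ?_⟩
        rw [map_neg, R.differential_incl, neg_neg, hgf]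
        rfl))).trans (D'.framedHomologyEquiv a' b').symm

end SmoothLast

end Diagram

theorem HasPrimaryTorsion.of_equiv {G H : Type} [AddCommGroup G] [AddCommGroup H] {p r : ℕ}
    (h : HasPrimaryTorsion G p r) (e : G ≃+ H) : HasPrimaryTorsion H p r := by
  obtain ⟨n, ι, hι, q, f, h1, ⟨g⟩, h2⟩ := h
  exact ⟨n, ι, hι, q, f, h1, ⟨e.symm.trans g⟩, h2⟩

theorem length_flatten_replicate {α : Type*} (l : List α) (n : ℕ) :
    (List.replicate n l).flatten.length = n * l.length := by
  simp

theorem getElem_flatten_replicate {α : Type*} (l : List α) (hl : 0 < l.length) (n t : ℕ)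
    (h : t < (List.replicate n l).flatten.length) :
    (List.replicate n l).flatten[t] = l[t % l.length]'(Nat.mod_lt _ hl) := by
  induction n generalizing t with
  | zero => simp at h
  | succ n ih =>
    simp only [List.replicate_succ, List.flatten_cons] at h ⊢
    rw [List.getElem_append]
    split_ifs with h'
    · simp only [Nat.mod_eq_of_lt h']
    · rw [ih]
      simp only [Nat.mod_eq_sub_mod (le_of_not_gt h')]

namespace BraidWord

open Diagram

/-- The three letters `σ₃ σ₂ σ₁`. -/
theorem finRange_three : ((List.finRange (4 - 1)).reverse.map fun i => (i, (1 : ℤˣ))) =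
    [((2 : Fin 3), 1), (1, 1), (0, 1)] := by
  decide

theorem twistedTorusWord_of_neg (hm : 2 ≤ 4) (n : ℕ) {k : ℤ} (hk : k < 0) :
    twistedTorusWord 4 hm n k =
      (List.replicate n ([((2 : Fin 3), (1 : ℤˣ)), (1, 1), (0, 1)] : BraidWord 4)).flatten ++
        (List.replicate k.natAbs ((0 : Fin 3), (-1 : ℤˣ)) : BraidWord 4) := by
  unfold twistedTorusWord
  rw [finRange_three, if_neg (not_le.2 hk)]
  rfl

theorem length_twistedTorusWord (hm : 2 ≤ 4) (n : ℕ) {k : ℤ} (hk : k < 0) :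
    ((twistedTorusWord 4 hm n k).length : ℤ) = 3 * n - k := by
  rw [twistedTorusWord_of_neg hm n hk, List.length_append, length_flatten_replicate,
    List.length_replicate]
  simp only [List.length_cons, List.length_nil]
  omega

theorem twistedTorusWord_sub_one (hm : 2 ≤ 4) (n : ℕ) {k : ℤ} (hk : k < 0) :
    twistedTorusWord 4 hm n (k - 1) = twistedTorusWord 4 hm n k ++ [((0 : Fin 3), (-1 : ℤˣ))] := by
  rw [twistedTorusWord_of_neg hm n hk, twistedTorusWord_of_neg hm n (by omega),
    show (k - 1).natAbs = k.natAbs + 1 by omega, List.replicate_succ', List.append_assoc]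

theorem writhe_append {m : ℕ} (β γ : BraidWord m) : writhe (β ++ γ) = writhe β + writhe γ := by
  simp [writhe]

theorem writhe_twistedTorusWord (hm : 2 ≤ 4) (n : ℕ) {k : ℤ} (hk : k < 0) :
    (twistedTorusWord 4 hm n k).writhe = 3 * n + k := by
  have h1 : ∀ n : ℕ, writhe (List.replicate n
      ([((2 : Fin 3), (1 : ℤˣ)), (1, 1), (0, 1)] : BraidWord 4)).flatten = 3 * n := by
    intro n
    induction n with
    | zero => rfl
    | succ n ih =>
      rw [List.replicate_succ, List.flatten_cons, writhe_append, ih]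
      push_cast
      rw [mul_add, add_comm]
      rfl
  rw [twistedTorusWord_of_neg hm n hk, writhe_append, h1]
  simp only [writhe, List.map_replicate, List.sum_replicate, Units.val_neg, Units.val_one, nsmul_eq_mul]
  omega

theorem isTwisted_twistedTorusWord (hm : 2 ≤ 4) (n : ℕ) {k : ℤ} (hk : k < 0) :
    IsTwisted (twistedTorusWord 4 hm n k) (3 * n) := by
  have hL := length_twistedTorusWord hm n hk
  have hpos : ∀ t : Fin (twistedTorusWord 4 hm n k).length, t.1 < 3 * n →
      (twistedTorusWord 4 hm n k).get t =
        ([((2 : Fin 3), (1 : ℤˣ)), (1, 1), (0, 1)] : BraidWord 4)[t.1 % 3]'(Nat.mod_lt _ (by decide)) := by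
    intro t ht
    simp only [List.get_eq_getElem, twistedTorusWord_of_neg hm n hk]
    rw [List.getElem_append_left (by rw [length_flatten_replicate]; simp; omega),
      getElem_flatten_replicate _ (by simp)]
    rfl
  have hneg : ∀ t : Fin (twistedTorusWord 4 hm n k).length, 3 * n ≤ t.1 →
      (twistedTorusWord 4 hm n k).get t = ((0 : Fin 3), (-1 : ℤˣ)) := by
    intro t ht
    simp only [List.get_eq_getElem, twistedTorusWord_of_neg hm n hk]
    rw [List.getElem_append_right (by rw [length_flatten_replicate]; simp; omega),
      List.getElem_replicate]
  have hmod : ∀ t : ℕ, ∀ h : t % 3 < 3,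
      (([((2 : Fin 3), (1 : ℤˣ)), (1, 1), (0, 1)] : BraidWord 4)[t % 3]'h).2 = 1 ∧
      (([((2 : Fin 3), (1 : ℤˣ)), (1, 1), (0, 1)] : BraidWord 4)[t % 3]'h).1.1 = 2 - t % 3 := by
    intro t h
    generalize t % 3 = r at h
    interval_cases r <;> exact ⟨rfl, rfl⟩
  refine ⟨by omega, fun t ht => ?_, fun t ht => ?_, fun t ht => ?_, fun t ht => ?_⟩
  · rw [hpos t ht]; exact (hmod _ _).1
  · rw [hpos t ht]; exact (hmod _ _).2
  · rw [hneg t ht]; decide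
  · rw [hneg t ht]; rfl

/-- The cohomology of two consecutive twisted torus links in a range of degrees. -/
def cohomologyEquiv (hm : 2 ≤ 4) (s : ℕ) (hs : 1 ≤ s) {k : ℤ} (hk : k ≤ -4 * (s : ℤ) - 2) (j : ℤ) :
    (twistedTorusWord 4 hm (4 * s + 2) k).Cohomology (6 * (s : ℤ) + 1) j ≃+
      (twistedTorusWord 4 hm (4 * s + 2) (k - 1)).Cohomology (6 * (s : ℤ) + 1) (j - 1) := by
  have hk0 : k < 0 := by omega
  have hw := writhe_twistedTorusWord hm (4 * s + 2) hk0
  have hw' := writhe_twistedTorusWord hm (4 * s + 2) (k := k - 1) (by omega)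
  have hL := length_twistedTorusWord hm (4 * s + 2) (k := k - 1) (by omega)
  have hT := isTwisted_twistedTorusWord hm (4 * s + 2) (k := k - 1) (by omega)
  rw [twistedTorusWord_sub_one hm _ hk0] at hw' hL hT ⊢
  have hl : ((0 : Fin 3), (-1 : ℤˣ)).2 ≠ 1 := by decide
  have exact (a b : ℤ) (ha : a < 3 * (4 * s + 2 : ℕ) - (k - 1) - 8 * (2 * s + 1 : ℕ)) :
      CubeExact (smoothLast (β := twistedTorusWord 4 hm (4 * s + 2) k) hl).upper a b := by
    refine cubeExact_of_last hT (n := 2 * s + 1) (by ring) (by push_cast at hL; omega)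
      (by rw [hL]; exact ha) (t := (twistedTorusWord 4 hm (4 * s + 2) k).length) ?_ (by simp)
      (fun w hw => if_pos (Fin.ext ?_)) (fun w hw => if_neg fun h => ?_)
    · have := hT.lt
      simp only [List.length_append, List.length_singleton] at this
      omega
    · have := w.2
      simp only [List.length_append, List.length_singleton] at this
      exact le_antisymm (by change w.1 ≤ List.length _; omega) hw
    · exact absurd (congrArg Fin.val h) (ne_of_lt hw)
  refine (smoothLast (β := twistedTorusWord 4 hm (4 * s + 2) k) hl).homologyEquiv
    (coherent_closure _) ?_ ?_ (exact _ _ ?_) (exact _ _ ?_)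
  all_goals
    push_cast at hw hw' ⊢
    omega

end BraidWord
end Khovanov
end

theorem mainTheorem9 (s : ℕ) (hs : 1 ≤ s)
    (h : Khovanov.HasPrimaryTorsion
      ((Khovanov.twistedTorusWord 4 (by norm_num) (4 * s + 2) (-4 * (s : ℤ) - 2)).Cohomology
        (6 * (s : ℤ) + 1) (16 * (s : ℤ) + 4)) 2 s)
    (k : ℤ) (hk : k ≤ -4 * (s : ℤ) - 2) :
    Khovanov.HasPrimaryTorsion
      ((Khovanov.twistedTorusWord 4 (by norm_num) (4 * s + 2) k).Cohomology
        (6 * (s : ℤ) + 1) (20 * (s : ℤ) + 6 + k)) 2 s := by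
  induction k, hk using Int.leInductionDown with
  | base =>
    rw [show 20 * (s : ℤ) + 6 + (-4 * (s : ℤ) - 2) = 16 * (s : ℤ) + 4 by ring]
    exact h
  | pred k hk ih =>
    rw [show 20 * (s : ℤ) + 6 + (k - 1) = 20 * (s : ℤ) + 6 + k - 1 by ring]
    exact ih.of_equiv (Khovanov.BraidWord.cohomologyEquiv _ s hs hk _)
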